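/- Let $D\ge 1$ and let $M_D$ be the complex $D\times D$ matrices with the trace norm $\|\cdot\|$; linear maps $\psi:M_D\to M_D$ carry the induced operator norm, and $\psi^*$ is the adjoint of $\psi$ with respect to $\langle A,B\rangle=\mathrm{tr}(A^\dagger B)$. A state is a positive semidefinite matrix of trace one. For a positive map $\psi$ and a state $\rho$ put $\psi\cdot\rho=\psi(\rho)/\mathrm{tr}\,\psi(\rho)$. Let $m(A,B)=\sup\{x\in\mathbb R: xB\le A\}$, $d(A,B)=\frac{1-m(A,B)m(B,A)}{1+m(A,B)m(B,A)}$, and $c(\psi)=\sup\{d(\psi\cdot\rho,\psi\cdot\sigma):\rho,\sigma\text{ states}\}$. The map $\psi$ is strictly positive if it maps every nonzero positive semidefinite matrix to a positive definite one. Let $(\Omega,\mathcal F,\mathbb P)$ be a probability space with a one-parameter group $(\theta_h)_{h\in\mathbb R}$ of measure-preserving maps, and let $(\varphi_{s,t})_{s<t}$, $s,t\in\mathbb R$, be random positive linear maps on $M_D$, each measurable in $\omega$, with $\varphi_{s,t}\circ\varphi_{r,s}=\varphi_{r,t}$ for all $r<s<t$ almost surely, and, for each $h$, $\varphi^{\theta_h\omega}_{s,t}=\varphi^{\omega}_{s+h,t+h}$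 for all $s<t$ almost surely. Assume that almost surely: (1) for all $s<t$ neither $\varphi_{s,t}$ nor $\varphi_{s,t}^*$ annihilates a state; (2) $\varphi_{s,t}$ is strictly positive for some $s<t$. Let $R_{s,t}$ and $L_{s,t}$ be the right and left Perron–Frobenius eigenmatrices of $\varphi_{s,t}$ (the states with $\varphi_{s,t}(R_{s,t})=\Lambda R_{s,t}$ and $\varphi_{s,t}^*(L_{s,t})=\Lambda L_{s,t}$, where $\Lambda$ is the spectral radius of $\varphi_{s,t}$) if $c(\varphi_{s,t})<1$, and $R_{s,t}=L_{s,t}=I/D$ otherwise. Then there are a random variable $\kappa$ and random matrices $Z_t$, $Z_s'$ ($s,t\in\mathbb R$) such that almost surely $0\le\kappa<1$, $\kappa=\lim_{t\to\infty}c(\varphi_{0,t})^{1/t}=\lim_{s\to-\infty}c(\varphi_{s,0})^{1/|s|}$, all $Z_t$ and $Z'_s$ are positive definite states, for every $t$ and every state $\rho$ one has $Z_t=\lim_{s\to-\infty}R_{s,t}=\lim_{s\to-\infty}\varphi_{s,t}\cdot\rho$, and for every $s$ and every state $\rho$ one has $Z_s'=\lim_{t\to\infty}L_{s,t}=\lim_{t\to\infty}\varphi_{s,t}^*\cdot\rho$.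 Moreover, with $$E_{s,t}=\left\|\frac{\varphi_{s,t}}{\mathrm{tr}(\varphi_{s,t}^*(I))}-\Xi_{s,t}\right\|,\qquad \Xi_{s,t}(X)=\mathrm{tr}(Z'_sX)\,Z_t :$$ (a) almost surely, $E_{s,t}\le 8\,c(\varphi_{s,t})$ for all $s<t$; (b) for every $\lambda\in(0,1)$, with $\mu_\lambda=\lambda\kappa+(1-\lambda)$, there are $\mathbb N_0$-valued random variables $T_{\lambda,n}$, $n\in\mathbb N_0$, such that almost surely, for every real $r\ge0$ and all $s<t$ with $|s|\le r$ or $|t|\le r$ and $t-s\ge T_{\lambda,\lceil r\rceil}$, $$E_{s,t}\le 8\,c(\varphi_{s,t})\le 8\,\mu_\lambda^{\,t-s-2};$$ (c) for every $\lambda\in(0,1)$, almost surely $0<\mu_\lambda<1$ and for every $r\ge0$ there is a (random) constant $C$ with $E_{s,t}\le C\mu_\lambda^{\,t-s}$ for all $s<t$ with $|s|\le r$ or $|t|\le r$; (d) almost surely, $E_{s,t}\to0$ as $s\to-\infty$ for every $t$, and as $t\to\infty$ for every $s$. -/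

import Mathlib

open MeasureTheory Filter Topology
open scoped Matrix ComplexOrder

namespace QDyn

/-- The `D × D` complex matrices. -/
abbrev Mat (D : ℕ) := Matrix (Fin D) (Fin D) ℂ

/-- Super-operators, i.e. linear maps on the space of `D × D` matrices. -/
abbrev SuperOp (D : ℕ) := Mat D →ₗ[ℂ] Mat D

/-- The trace norm: the sum of the singular values. -/
noncomputable def traceNorm {D : ℕ} (X : Mat D) : ℝ :=
  ∑ i, √((Matrix.isHermitian_conjTranspose_mul_self X).eigenvalues i)

/-- The operator norm of a super-operator induced by the trace norm: the least `C ≥ 0` such that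
`‖ψ X‖₁ ≤ C ‖X‖₁` for every matrix `X`. -/
noncomputable def opNorm {D : ℕ} (ψ : SuperOp D) : ℝ :=
  sInf {C : ℝ | 0 ≤ C ∧ ∀ X : Mat D, traceNorm (ψ X) ≤ C * traceNorm X}

/-- States (density matrices). -/
def IsState {D : ℕ} (ρ : Mat D) : Prop := ρ.PosSemidef ∧ ρ.trace = 1

/-- Full-rank states. -/
def IsInteriorState {D : ℕ} (ρ : Mat D) : Prop := ρ.PosDef ∧ ρ.trace = 1

/-- Positive super-operators. -/
def IsPositive {D : ℕ} (ψ : SuperOp D) : Prop :=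
  ∀ A : Mat D, A.PosSemidef → (ψ A).PosSemidef

/-- Strictly positive super-operators: every nonzero positive semidefinite matrix is mapped to a
positive definite one. -/
def IsStrictlyPositive {D : ℕ} (ψ : SuperOp D) : Prop :=
  ∀ A : Mat D, A.PosSemidef → A ≠ 0 → (ψ A).PosDef

/-- The adjoint of a super-operator for the Hilbert–Schmidt inner product `tr (Aᴴ B)`;
see `trace_adj`. -/
noncomputable def adj {D : ℕ} (ψ : SuperOp D) : SuperOp D where
  toFun A := Matrix.of fun i j => ((ψ (Matrix.single i j 1))ᴴ * A).trace
  map_add' A B := by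
    ext i j
    simp [Matrix.mul_add]
  map_smul' c A := by
    ext i j
    simp

theorem trace_adj {D : ℕ} (ψ : SuperOp D) (A B : Mat D) :
    (Bᴴ * adj ψ A).trace = ((ψ B)ᴴ * A).trace := by
  have h : B = ∑ i, ∑ j, B i j • Matrix.single i j (1 : ℂ) := by
    conv_lhs => rw [Matrix.matrix_eq_sum_single B]
    simp [Matrix.smul_single]
  conv_rhs => rw [h]
  simp only [map_sum, map_smul, Matrix.conjTranspose_sum, Matrix.conjTranspose_smul,
    Finset.sum_mul, Matrix.trace_sum, smul_mul_assoc, Matrix.trace_smul]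
  rw [Finset.sum_comm]
  simp [Matrix.trace, Matrix.mul_apply, adj]

/-- The projective action `ψ · ρ = ψ(ρ) / tr ψ(ρ)`. -/
noncomputable def proj {D : ℕ} (ψ : SuperOp D) (ρ : Mat D) : Mat D :=
  ((ψ ρ).trace)⁻¹ • ψ ρ

/-- `m(A, B)` is the largest real `x` with `x B ≤ A` (for `A` positive semidefinite and `B ≠ 0`
positive semidefinite the set is bounded above and contains `0`). -/
noncomputable def mconst {D : ℕ} (A B : Mat D) : ℝ :=
  sSup {x : ℝ | (A - (x : ℂ) • B).PosSemidef}

/-- The projective distance on states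
`d(A, B) = (1 - m(A, B) m(B, A)) / (1 + m(A, B) m(B, A))`. -/
noncomputable def dist {D : ℕ} (A B : Mat D) : ℝ :=
  (1 - mconst A B * mconst B A) / (1 + mconst A B * mconst B A)

/-- The contraction coefficient `c(ψ)`: the diameter of `ψ · (states)` for `dist`. -/
noncomputable def cnum {D : ℕ} (ψ : SuperOp D) : ℝ :=
  sSup {x : ℝ | ∃ ρ σ : Mat D, IsState ρ ∧ IsState σ ∧ x = dist (proj ψ ρ) (proj ψ σ)}

/-- The spectral radius of a super-operator. -/
noncomputable def specRad {D : ℕ} (ψ : SuperOp D) : ℝ :=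
  (spectralRadius ℂ (ψ : Module.End ℂ (Mat D))).toReal

open Classical in
/-- The normalized right Perron–Frobenius eigenmatrix of `ψ` when `c(ψ) < 1`, and the maximally
mixed state otherwise. -/
noncomputable def rightPF {D : ℕ} (ψ : SuperOp D) : Mat D :=
  if h : cnum ψ < 1 ∧ ∃ R : Mat D, IsState R ∧ ψ R = (specRad ψ : ℂ) • R
  then h.2.choose else (D : ℂ)⁻¹ • (1 : Mat D)

open Classical in
/-- The normalized left Perron–Frobenius eigenmatrix of `ψ` when `c(ψ) < 1`, and the maximally
mixed state otherwise. -/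
noncomputable def leftPF {D : ℕ} (ψ : SuperOp D) : Mat D :=
  if h : cnum ψ < 1 ∧ ∃ L : Mat D, IsState L ∧ adj ψ L = (specRad ψ : ℂ) • L
  then h.2.choose else (D : ℂ)⁻¹ • (1 : Mat D)

/-- The rank-one super-operator `X ↦ tr(Z' X) Z`. -/
noncomputable def rankOne {D : ℕ} (Z' Z : Mat D) : SuperOp D where
  toFun X := (Z' * X).trace • Z
  map_add' X Y := by simp [Matrix.mul_add, add_smul]
  map_smul' c X := by simp [mul_smul]

/-- The operator-norm distance between the normalized super-operator `ψ / tr(ψ†(I))` and the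
rank-one super-operator `X ↦ tr(Z' X) Z`. -/
noncomputable def rankOneError {D : ℕ} (ψ : SuperOp D) (Z' Z : Mat D) : ℝ :=
  opNorm (((adj ψ 1).trace)⁻¹ • ψ - rankOne Z' Z)

/-- A one-parameter group of measure-preserving transformations. -/
structure IsFlow {Ω : Type*} [MeasurableSpace Ω] (P : Measure Ω) (θ : ℝ → Ω → Ω) : Prop where
  measurePreserving : ∀ h, MeasurePreserving (θ h) P P
  zero : θ 0 = id
  add : ∀ h k, θ (h + k) = θ h ∘ θ k

/-- A dynamical propagator in a stationary environment: random positive super-operators `φ s t`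
(used for `s < t` only) that compose as a propagator and satisfy
`φ s t (θ h ω) = φ (s + h) (t + h) ω`. -/
structure IsStationaryPropagator {D : ℕ} {Ω : Type*} [MeasurableSpace Ω] (P : Measure Ω)
    (θ : ℝ → Ω → Ω) (φ : ℝ → ℝ → Ω → SuperOp D) : Prop where
  measurable : ∀ s t, s < t → ∀ (X : Mat D) (i j : Fin D), Measurable fun ω => φ s t ω X i j
  positive : ∀ᵐ ω ∂P, ∀ s t, s < t → IsPositive (φ s t ω)
  comp : ∀ᵐ ω ∂P, ∀ r s t, r < s → s < t → φ s t ω ∘ₗ φ r s ω = φ r t ω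
  stationary : ∀ h, ∀ᵐ ω ∂P, ∀ s t, s < t → φ s t (θ h ω) = φ (s + h) (t + h) ω

/-- Almost surely, no `φ s t` and no adjoint of it annihilates a state. -/
def Nondegenerate {D : ℕ} {Ω : Type*} [MeasurableSpace Ω] (P : Measure Ω)
    (φ : ℝ → ℝ → Ω → SuperOp D) : Prop :=
  ∀ᵐ ω ∂P, ∀ s t, s < t → ∀ ρ : Mat D, IsState ρ → φ s t ω ρ ≠ 0 ∧ adj (φ s t ω) ρ ≠ 0

/-- Almost surely, some `φ s t` is strictly positive. -/
def EventuallyStrictlyPositive {D : ℕ} {Ω : Type*} [MeasurableSpace Ω] (P : Measure Ω)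
    (φ : ℝ → ℝ → Ω → SuperOp D) : Prop :=
  ∀ᵐ ω ∂P, ∃ s t, s < t ∧ IsStrictlyPositive (φ s t ω)

/-- `κ` is a `[0, 1)`-valued random variable giving the exponential decay rate of `c(φ s t)`:
`c(φ 0 t) ^ (1 / t) → κ` as `t → ∞` and `c(φ s 0) ^ (1 / |s|) → κ` as `s → -∞`. -/
structure IsDecayRate {D : ℕ} {Ω : Type*} [MeasurableSpace Ω] (P : Measure Ω)
    (φ : ℝ → ℝ → Ω → SuperOp D) (κ : Ω → ℝ) : Prop where
  measurable : Measurable κ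
  mem_Ico : ∀ᵐ ω ∂P, κ ω ∈ Set.Ico (0 : ℝ) 1
  forward : ∀ᵐ ω ∂P, Tendsto (fun t : ℝ => cnum (φ 0 t ω) ^ (1 / t)) atTop (𝓝 (κ ω))
  backward : ∀ᵐ ω ∂P, Tendsto (fun s : ℝ => cnum (φ s 0 ω) ^ (1 / |s|)) atBot (𝓝 (κ ω))

/-- `Z t` is the limit as `s → -∞` of the right Perron–Frobenius eigenmatrices of `φ s t`, and of
`φ s t · ρ` for every state `ρ`; it is a random full-rank state. -/
structure IsPastLimit {D : ℕ} {Ω : Type*} [MeasurableSpace Ω] (P : Measure Ω)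
    (φ : ℝ → ℝ → Ω → SuperOp D) (Z : ℝ → Ω → Mat D) : Prop where
  measurable : ∀ (t : ℝ) (i j : Fin D), Measurable fun ω => Z t ω i j
  interior : ∀ᵐ ω ∂P, ∀ t, IsInteriorState (Z t ω)
  tendsto_rightPF : ∀ᵐ ω ∂P, ∀ t, Tendsto (fun s => rightPF (φ s t ω)) atBot (𝓝 (Z t ω))
  tendsto_proj : ∀ᵐ ω ∂P, ∀ t, ∀ ρ : Mat D, IsState ρ →
    Tendsto (fun s => proj (φ s t ω) ρ) atBot (𝓝 (Z t ω))

/-- `Z' s` is the limit as `t → ∞` of the left Perron–Frobenius eigenmatrices of `φ s t`, and of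
`(φ s t)† · ρ` for every state `ρ`; it is a random full-rank state. -/
structure IsFutureLimit {D : ℕ} {Ω : Type*} [MeasurableSpace Ω] (P : Measure Ω)
    (φ : ℝ → ℝ → Ω → SuperOp D) (Z' : ℝ → Ω → Mat D) : Prop where
  measurable : ∀ (s : ℝ) (i j : Fin D), Measurable fun ω => Z' s ω i j
  interior : ∀ᵐ ω ∂P, ∀ s, IsInteriorState (Z' s ω)
  tendsto_leftPF : ∀ᵐ ω ∂P, ∀ s, Tendsto (fun t => leftPF (φ s t ω)) atTop (𝓝 (Z' s ω))
  tendsto_proj : ∀ᵐ ω ∂P, ∀ s, ∀ ρ : Mat D, IsState ρ →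
    Tendsto (fun t => proj (adj (φ s t ω)) ρ) atTop (𝓝 (Z' s ω))

end QDyn

namespace QDyn

/-! ### Matrices: spectral decompositions and trace pairings -/

/-! The distance `dist` equals tanh(h/2), where h = -log (m(A,B) m(B,A)) is Hilbert's projective
distance. Positive maps contract it by the factor c(ψ) (`dist_proj_le`, a Birkhoff contraction
theorem), so c is submultiplicative under composition (`cnum_comp_le`). The inequality c(ψ) ≤ y
amounts to cross-ratio inequalities between the numbers tr(ψ(ρ)X) (`cnum_le_iff`). These are
symmetric under exchanging inputs ρ and tests X, so c(ψ*) = c(ψ). By continuity they need only be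
tested on a countable dense set of states, so c is measurable.

Over integer times the coefficients form a stationary submultiplicative process with values in [0,
1]. A subadditive ergodic theorem for bounded superadditive processes (`IsSuperadditive.ae_tendsto`,
by a covering argument) is applied to -log c. Since c may vanish, the logarithm is first truncated
at every slope. The resulting rate κ is invariant along the integer flow and the same in both time
directions. On the invariant set where the rate is 1, almost surely all coefficients along the
backward orbit equal 1. This is incompatible with a strictly positive φ inside some integer
interval, whose coefficient is below 1 by compactness; hence κ < 1
(`IsSubmultiplicative.ae_rate_lt_one`).

The rest is deterministic. As κ < 1, c tends to 0 in both directions, so images of states are Cauchy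
and their limits are carried into each other: φ_{s,t}·Z_s = Z_t. Perron–Frobenius states are fixed
by φ_{s,t}·, so they too lie within c(φ_{s,t}) of Z_t. Applying all this to adjoints in reversed
time gives Z'. Because `dist` dominates half the trace norm distance, the normalised map differs
from the rank-one map by at most 4c on states, and by 8c in operator norm (`rankOneError_le`). For
exponential bounds, [s,t] is shrunk to [⌈s⌉,⌊t⌋], which costs the 2 in the exponent, and only
finitely many integer endpoints matter in a bounded window. -/

theorem exists_unitary_diagonalization {D : ℕ} {H : Mat D} (hH : H.IsHermitian) :
    ∃ U : Mat D, Uᴴ * U = 1 ∧ U * Uᴴ = 1 ∧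
      H = U * Matrix.diagonal (fun i => (hH.eigenvalues i : ℂ)) * Uᴴ := by
  refine ⟨hH.eigenvectorUnitary, ?_, ?_, ?_⟩
  · exact Unitary.coe_star_mul_self hH.eigenvectorUnitary
  · exact Unitary.coe_mul_star_self hH.eigenvectorUnitary
  · conv_lhs => rw [hH.spectral_theorem]
    rfl

/-- The rank-one projection onto the `i`-th column of `U`. -/
noncomputable def colProj {D : ℕ} (U : Mat D) (i : Fin D) : Mat D :=
  Matrix.vecMulVec (fun k => U k i) (star fun k => U k i)

theorem conj_diagonal_eq_sum {D : ℕ} (U : Mat D) (f : Fin D → ℂ) :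
    U * Matrix.diagonal f * Uᴴ = ∑ i, f i • colProj U i := by
  ext a b
  rw [Matrix.mul_apply, Matrix.sum_apply]
  simp only [Matrix.mul_diagonal, Matrix.conjTranspose_apply,
    Matrix.smul_apply, colProj, Matrix.vecMulVec_apply, smul_eq_mul, Pi.star_apply]
  exact Finset.sum_congr rfl fun i _ => by ring

theorem isState_vecMulVec {D : ℕ} {v : Fin D → ℂ} (hv : star v ⬝ᵥ v = 1) :
    IsState (Matrix.vecMulVec v (star v)) :=
  ⟨Matrix.posSemidef_vecMulVec_self_star v, by
    rw [Matrix.trace_vecMulVec, dotProduct_comm, hv]⟩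

theorem isState_colProj {D : ℕ} {U : Mat D} (hU : Uᴴ * U = 1) (i : Fin D) :
    IsState (colProj U i) := by
  apply isState_vecMulVec
  have := congrFun (congrFun hU i) i
  simpa [Matrix.mul_apply, dotProduct] using this

theorem exists_eq_conjTranspose_mul_self {D : ℕ} {A : Mat D} (hA : A.PosSemidef) :
    ∃ C : Mat D, A = Cᴴ * C := by
  obtain ⟨U, -, -, h⟩ := exists_unitary_diagonalization hA.1
  set S : Mat D := Matrix.diagonal (fun i => ((√(hA.1.eigenvalues i) : ℝ) : ℂ)) with hS
  have h2 : Sᴴ * S = Matrix.diagonal (fun i => (hA.1.eigenvalues i : ℂ)) := by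
    rw [hS, Matrix.diagonal_conjTranspose, Matrix.diagonal_mul_diagonal]
    congr 1
    funext i
    simp only [Pi.star_apply, Complex.star_def, Complex.conj_ofReal]
    rw [← Complex.ofReal_mul, Real.mul_self_sqrt (hA.eigenvalues_nonneg i)]
  refine ⟨S * Uᴴ, ?_⟩
  rw [← h2] at h
  rw [Matrix.conjTranspose_mul, Matrix.conjTranspose_conjTranspose]
  simpa only [Matrix.mul_assoc] using h

theorem trace_mul_nonneg {D : ℕ} {A B : Mat D} (hA : A.PosSemidef) (hB : B.PosSemidef) :
    0 ≤ (A * B).trace := by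
  obtain ⟨C, rfl⟩ := exists_eq_conjTranspose_mul_self hA
  rw [Matrix.mul_assoc, Matrix.trace_mul_comm]
  exact (hB.mul_mul_conjTranspose_same C).trace_nonneg

/-- The real trace pairing `Re tr (A B)`. -/
noncomputable def pairing {D : ℕ} (A B : Mat D) : ℝ := ((A * B).trace).re

theorem pairing_comm {D : ℕ} (A B : Mat D) : pairing A B = pairing B A := by
  rw [pairing, Matrix.trace_mul_comm, pairing]

theorem pairing_sub_left {D : ℕ} (A B C : Mat D) :
    pairing (A - B) C = pairing A C - pairing B C := by
  simp [pairing, Matrix.sub_mul]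

theorem pairing_smul_left {D : ℕ} (x : ℝ) (A C : Mat D) :
    pairing ((x : ℂ) • A) C = x * pairing A C := by
  simp [pairing]

theorem pairing_sub_right {D : ℕ} (A B C : Mat D) :
    pairing C (A - B) = pairing C A - pairing C B := by
  simp [pairing, Matrix.mul_sub]

theorem pairing_smul_right {D : ℕ} (x : ℝ) (A C : Mat D) :
    pairing C ((x : ℂ) • A) = x * pairing C A := by
  simp [pairing]

theorem pairing_one_left {D : ℕ} (A : Mat D) : pairing 1 A = A.trace.re := by
  simp [pairing]

theorem pairing_nonneg {D : ℕ} {A B : Mat D} (hA : A.PosSemidef) (hB : B.PosSemidef) :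
    0 ≤ pairing A B :=
  (Complex.le_def.1 (trace_mul_nonneg hA hB)).1

theorem trace_mul_eq_pairing {D : ℕ} {A B : Mat D} (hA : A.IsHermitian) (hB : B.IsHermitian) :
    (A * B).trace = (pairing A B : ℂ) := by
  symm
  rw [pairing, ← Complex.conj_eq_iff_re]
  change star ((A * B).trace) = _
  rw [← Matrix.trace_conjTranspose, Matrix.conjTranspose_mul, hA.eq, hB.eq, Matrix.trace_mul_comm]

theorem trace_eq_re {D : ℕ} {A : Mat D} (hA : A.IsHermitian) :
    A.trace = (A.trace.re : ℂ) := by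
  have := trace_mul_eq_pairing Matrix.isHermitian_one hA
  simpa [pairing_one_left] using this

/-- With B = Cᴴ C the trace is that of the semidefinite matrix C A Cᴴ; if it vanishes so does that
matrix, and definiteness of A kills every column of Cᴴ. -/
theorem pairing_pos {D : ℕ} {A B : Mat D} (hA : A.PosDef) (hB : B.PosSemidef) (hB0 : B ≠ 0) :
    0 < pairing A B := by
  refine lt_of_le_of_ne (pairing_nonneg hA.posSemidef hB) fun h => hB0 ?_
  have h0 : (A * B).trace = 0 := by
    rw [trace_mul_eq_pairing hA.1 hB.1, ← h]; simp
  obtain ⟨C, rfl⟩ := exists_eq_conjTranspose_mul_self hB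
  rw [← Matrix.mul_assoc, Matrix.trace_mul_comm, ← Matrix.mul_assoc] at h0
  have h1 := ((hA.posSemidef.mul_mul_conjTranspose_same C).trace_eq_zero_iff).1 h0
  have h2 : Cᴴ = 0 := by
    ext i j
    by_contra hne
    have hx : (fun k => Cᴴ k j) ≠ 0 := fun h => hne (congrFun h i)
    have h3 := hA.dotProduct_mulVec_pos hx
    have h4 := congrFun (congrFun h1 j) j
    have h5 : star (fun k => Cᴴ k j) ⬝ᵥ (A *ᵥ fun k => Cᴴ k j) = (C * A * Cᴴ) j j := by
      rw [Matrix.mul_assoc]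
      simp only [Matrix.mul_apply, dotProduct, Matrix.mulVec, Pi.star_apply,
        Matrix.conjTranspose_apply, star_star]
    rw [h5, h4] at h3
    exact lt_irrefl _ h3
  rw [h2, Matrix.zero_mul]

theorem trace_mul_vecMulVec {D : ℕ} (A : Mat D) (v w : Fin D → ℂ) :
    (A * Matrix.vecMulVec v (star w)).trace = star w ⬝ᵥ (A *ᵥ v) := by
  rw [Matrix.mul_vecMulVec, Matrix.trace_vecMulVec, dotProduct_comm]

theorem exists_state_smul_eq_vecMulVec {D : ℕ} {v : Fin D → ℂ} (hv : v ≠ 0) :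
    ∃ c : ℝ, 0 < c ∧ ∃ σ : Mat D, IsState σ ∧ Matrix.vecMulVec v (star v) = (c : ℂ) • σ := by
  have hp : (0 : ℂ) < star v ⬝ᵥ v := by
    have := (Matrix.PosDef.one (n := Fin D) (R := ℂ)).dotProduct_mulVec_pos hv
    simpa using this
  obtain ⟨h1, h2⟩ := Complex.lt_def.1 hp
  have hc : star v ⬝ᵥ v = ((star v ⬝ᵥ v).re : ℂ) := by
    apply Complex.ext <;> simp [← h2]
  set c := (star v ⬝ᵥ v).re with hcdef
  have hc0 : (c : ℂ) ≠ 0 := by exact_mod_cast h1.ne'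
  refine ⟨c, h1, ((c : ℂ)⁻¹) • Matrix.vecMulVec v (star v), ⟨?_, ?_⟩, ?_⟩
  · apply (Matrix.posSemidef_vecMulVec_self_star v).smul
    rw [← Complex.ofReal_inv]
    exact Complex.zero_le_real.2 (inv_nonneg.2 h1.le)
  · rw [Matrix.trace_smul, Matrix.trace_vecMulVec, dotProduct_comm, hc, smul_eq_mul,
      inv_mul_cancel₀ hc0]
  · rw [smul_smul, mul_inv_cancel₀ hc0, one_smul]

/-- Multiples of pure states recover the quadratic form. The matrix order thus becomes a family of
linear inequalities indexed by states, the form used throughout. -/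
theorem posSemidef_of_pairing {D : ℕ} {A : Mat D} (hA : A.IsHermitian)
    (h : ∀ σ, IsState σ → 0 ≤ pairing A σ) : A.PosSemidef := by
  refine Matrix.PosSemidef.of_dotProduct_mulVec_nonneg hA fun v => ?_
  rcases eq_or_ne v 0 with rfl | hv
  · simp
  obtain ⟨c, hc, σ, hσ, he⟩ := exists_state_smul_eq_vecMulVec hv
  rw [← trace_mul_vecMulVec, trace_mul_eq_pairing hA
    (Matrix.posSemidef_vecMulVec_self_star v).1, he, pairing_smul_right]
  exact Complex.zero_le_real.2 (mul_nonneg hc.le (h σ hσ))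

theorem posDef_of_pairing {D : ℕ} {A : Mat D} (hA : A.IsHermitian)
    (h : ∀ σ, IsState σ → 0 < pairing A σ) : A.PosDef := by
  refine Matrix.PosDef.of_dotProduct_mulVec_pos hA fun v hv => ?_
  obtain ⟨c, hc, σ, hσ, he⟩ := exists_state_smul_eq_vecMulVec hv
  rw [← trace_mul_vecMulVec, trace_mul_eq_pairing hA
    (Matrix.posSemidef_vecMulVec_self_star v).1, he, pairing_smul_right]
  exact Complex.zero_lt_real.2 (mul_pos hc (h σ hσ))

/-! ### States -/

theorem IsState.ne_zero {D : ℕ} {ρ : Mat D} (h : IsState ρ) : ρ ≠ 0 := by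
  rintro rfl
  simpa using h.2

theorem IsInteriorState.isState {D : ℕ} {ρ : Mat D} (h : IsInteriorState ρ) : IsState ρ :=
  ⟨h.1.posSemidef, h.2⟩

theorem trace_re_pos {D : ℕ} {A : Mat D} (hA : A.PosSemidef) (h0 : A ≠ 0) : 0 < A.trace.re := by
  rw [← pairing_one_left]
  exact pairing_pos Matrix.PosDef.one hA h0

/-- Rescaling a matrix to trace one. -/
noncomputable def normalize {D : ℕ} (A : Mat D) : Mat D := (A.trace)⁻¹ • A

theorem proj_eq_normalize {D : ℕ} (ψ : SuperOp D) (ρ : Mat D) :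
    proj ψ ρ = normalize (ψ ρ) := rfl

theorem normalize_eq {D : ℕ} {A : Mat D} (hA : A.PosSemidef) :
    normalize A = (((A.trace.re)⁻¹ : ℝ) : ℂ) • A := by
  rw [normalize, trace_eq_re hA.1]
  simp

theorem isState_normalize {D : ℕ} {A : Mat D} (hA : A.PosSemidef) (h0 : A ≠ 0) :
    IsState (normalize A) := by
  have hp := trace_re_pos hA h0
  constructor
  · rw [normalize_eq hA]
    exact hA.smul (Complex.zero_le_real.2 (inv_nonneg.2 hp.le))
  · rw [normalize, Matrix.trace_smul, smul_eq_mul, inv_mul_cancel₀]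
    rw [trace_eq_re hA.1]
    exact_mod_cast hp.ne'

theorem isState_maxMixed {D : ℕ} (hD : 1 ≤ D) : IsState ((D : ℂ)⁻¹ • (1 : Mat D)) := by
  have hD0 : (D : ℂ) ≠ 0 := by exact_mod_cast (by omega : D ≠ 0)
  constructor
  · apply Matrix.PosSemidef.one.smul
    rw [← Complex.ofReal_natCast, ← Complex.ofReal_inv]
    exact Complex.zero_le_real.2 (by positivity)
  · simp [hD0]

theorem IsState.trace_re {D : ℕ} {ρ : Mat D} (h : IsState ρ) : ρ.trace.re = 1 := by
  rw [h.2]; rfl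

theorem normalize_smul {D : ℕ} {c : ℂ} (hc : c ≠ 0) (A : Mat D) :
    normalize (c • A) = normalize A := by
  rw [normalize, normalize, Matrix.trace_smul, smul_eq_mul, smul_smul, mul_inv]
  congr 1
  field_simp

theorem normalize_of_isState {D : ℕ} {A : Mat D} (h : IsState A) : normalize A = A := by
  rw [normalize, h.2]; simp

/-! ### The quantities `m(A, B)` and `d(A, B)` -/

theorem posSemidef_sub_smul_iff {D : ℕ} {A B : Mat D} (hA : A.IsHermitian) (hB : B.IsHermitian)
    (x : ℝ) : (A - (x : ℂ) • B).PosSemidef ↔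
      ∀ σ, IsState σ → x * pairing B σ ≤ pairing A σ := by
  have hh : (A - (x : ℂ) • B).IsHermitian := by
    refine hA.sub ?_
    rw [Matrix.IsHermitian, Matrix.conjTranspose_smul, hB.eq]
    simp
  constructor
  · intro h σ hσ
    have := pairing_nonneg h hσ.1
    rw [pairing_sub_left, pairing_smul_left] at this
    linarith
  · intro h
    refine posSemidef_of_pairing hh fun σ hσ => ?_
    rw [pairing_sub_left, pairing_smul_left]
    linarith [h σ hσ]

theorem le_trace_of_posSemidef_sub {D : ℕ} {A B : Mat D} (hB : IsState B) {x : ℝ}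
    (h : (A - (x : ℂ) • B).PosSemidef) : x ≤ A.trace.re := by
  have := (Complex.le_def.1 h.trace_nonneg).1
  simp [hB.2] at this
  linarith

theorem le_mconst {D : ℕ} {A B : Mat D} (hA : A.IsHermitian) (hB : IsState B) {x : ℝ}
    (h : ∀ σ, IsState σ → x * pairing B σ ≤ pairing A σ) : x ≤ mconst A B :=
  le_csSup ⟨A.trace.re, fun _ hy => le_trace_of_posSemidef_sub hB hy⟩
    ((posSemidef_sub_smul_iff hA hB.1.1 x).2 h)

theorem mconst_nonneg {D : ℕ} {A B : Mat D} (hA : A.PosSemidef) (hB : IsState B) :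
    0 ≤ mconst A B :=
  le_mconst hA.1 hB fun σ hσ => by simpa using pairing_nonneg hA hσ.1

theorem mconst_mul_pairing_le {D : ℕ} {A B : Mat D} (hA : A.PosSemidef) (hB : IsState B)
    {σ : Mat D} (hσ : IsState σ) : mconst A B * pairing B σ ≤ pairing A σ := by
  rcases (pairing_nonneg hB.1 hσ.1).eq_or_lt with h | h
  · rw [← h, mul_zero]; exact pairing_nonneg hA hσ.1
  rw [← le_div_iff₀ h]
  refine csSup_le ⟨0, by simpa using hA⟩ fun x hx => ?_
  rw [le_div_iff₀ h]
  exact (posSemidef_sub_smul_iff hA.1 hB.1.1 x).1 hx σ hσ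

theorem posSemidef_sub_mconst_smul {D : ℕ} {A B : Mat D} (hA : A.PosSemidef) (hB : IsState B) :
    (A - (mconst A B : ℂ) • B).PosSemidef :=
  (posSemidef_sub_smul_iff hA.1 hB.1.1 _).2 fun _ hσ => mconst_mul_pairing_le hA hB hσ

theorem mconst_le_one {D : ℕ} {A B : Mat D} (hA : IsState A) (hB : IsState B) :
    mconst A B ≤ 1 := by
  rw [← hA.trace_re]
  exact le_trace_of_posSemidef_sub hB (posSemidef_sub_mconst_smul hA.1 hB)

/-- The product `m(A, B) m(B, A)`. -/
noncomputable def cross {D : ℕ} (A B : Mat D) : ℝ := mconst A B * mconst B A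

theorem dist_eq {D : ℕ} (A B : Mat D) : dist A B = (1 - cross A B) / (1 + cross A B) := rfl

theorem cross_nonneg {D : ℕ} {A B : Mat D} (hA : IsState A) (hB : IsState B) :
    0 ≤ cross A B := mul_nonneg (mconst_nonneg hA.1 hB) (mconst_nonneg hB.1 hA)

theorem cross_le_one {D : ℕ} {A B : Mat D} (hA : IsState A) (hB : IsState B) :
    cross A B ≤ 1 :=
  mul_le_one₀ (mconst_le_one hA hB) (mconst_nonneg hB.1 hA) (mconst_le_one hB hA)

/-- The traces cancel in the product m(A,B) m(B,A), so it can be bounded from comparisons of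
unnormalised matrices. -/
theorem le_cross_normalize {D : ℕ} {A B : Mat D} (hA : A.PosSemidef) (hA0 : A ≠ 0)
    (hB : B.PosSemidef) (hB0 : B ≠ 0) {x y : ℝ} (hy : 0 ≤ y)
    (h1 : ∀ σ, IsState σ → x * pairing B σ ≤ pairing A σ)
    (h2 : ∀ σ, IsState σ → y * pairing A σ ≤ pairing B σ) :
    x * y ≤ cross (normalize A) (normalize B) := by
  have ha := trace_re_pos hA hA0
  have hb := trace_re_pos hB hB0
  have e1 : x * B.trace.re / A.trace.re ≤ mconst (normalize A) (normalize B) := by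
    refine le_mconst (isState_normalize hA hA0).1.1 (isState_normalize hB hB0) fun σ hσ => ?_
    rw [normalize_eq hA, normalize_eq hB, pairing_smul_left, pairing_smul_left]
    calc x * B.trace.re / A.trace.re * ((B.trace.re)⁻¹ * pairing B σ)
        = (A.trace.re)⁻¹ * (x * pairing B σ) := by field_simp
      _ ≤ _ := by gcongr; exact h1 σ hσ
  have e2 : y * A.trace.re / B.trace.re ≤ mconst (normalize B) (normalize A) := by
    refine le_mconst (isState_normalize hB hB0).1.1 (isState_normalize hA hA0) fun σ hσ => ?_
    rw [normalize_eq hA, normalize_eq hB, pairing_smul_left, pairing_smul_left]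
    calc y * A.trace.re / B.trace.re * ((A.trace.re)⁻¹ * pairing A σ)
        = (B.trace.re)⁻¹ * (y * pairing A σ) := by field_simp
      _ ≤ _ := by gcongr; exact h2 σ hσ
  calc x * y = (x * B.trace.re / A.trace.re) * (y * A.trace.re / B.trace.re) := by field_simp
    _ ≤ _ := mul_le_mul e1 e2 (by positivity)
      (mconst_nonneg (isState_normalize hA hA0).1 (isState_normalize hB hB0))

theorem exists_mul_eq_cross_normalize {D : ℕ} {A B : Mat D} (hA : A.PosSemidef) (hA0 : A ≠ 0)
    (hB : B.PosSemidef) (hB0 : B ≠ 0) :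
    ∃ x y : ℝ, 0 ≤ x ∧ 0 ≤ y ∧ x * y = cross (normalize A) (normalize B) ∧
      (∀ σ, IsState σ → x * pairing B σ ≤ pairing A σ) ∧
      (∀ σ, IsState σ → y * pairing A σ ≤ pairing B σ) := by
  have ha := trace_re_pos hA hA0
  have hb := trace_re_pos hB hB0
  have sA := isState_normalize hA hA0
  have sB := isState_normalize hB hB0
  refine ⟨mconst (normalize A) (normalize B) * A.trace.re / B.trace.re,
    mconst (normalize B) (normalize A) * B.trace.re / A.trace.re, ?_, ?_, ?_, ?_, ?_⟩
  · have := mconst_nonneg sA.1 sB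
    positivity
  · have := mconst_nonneg sB.1 sA
    positivity
  · rw [cross]; field_simp
  · intro σ hσ
    have := mconst_mul_pairing_le sA.1 sB hσ
    nth_rw 2 [normalize_eq hB] at this
    nth_rw 2 [normalize_eq hA] at this
    rw [pairing_smul_left, pairing_smul_left, ← mul_le_mul_iff_right₀ ha] at this
    calc _ = A.trace.re * (mconst (normalize A) (normalize B) * ((B.trace.re)⁻¹ * pairing B σ)) := by
          field_simp
      _ ≤ _ := this
      _ = _ := by field_simp
  · intro σ hσ
    have := mconst_mul_pairing_le sB.1 sA hσ
    nth_rw 2 [normalize_eq hA] at this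
    nth_rw 2 [normalize_eq hB] at this
    rw [pairing_smul_left, pairing_smul_left, ← mul_le_mul_iff_right₀ hb] at this
    calc _ = B.trace.re * (mconst (normalize B) (normalize A) * ((A.trace.re)⁻¹ * pairing A σ)) := by
          field_simp
      _ ≤ _ := this
      _ = _ := by field_simp

theorem dist_nonneg {D : ℕ} {A B : Mat D} (hA : IsState A) (hB : IsState B) : 0 ≤ dist A B := by
  have h0 := cross_nonneg hA hB
  have h1 := cross_le_one hA hB
  rw [dist_eq]
  exact div_nonneg (by linarith) (by linarith)

theorem dist_le_one {D : ℕ} {A B : Mat D} (hA : IsState A) (hB : IsState B) : dist A B ≤ 1 := by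
  have h0 := cross_nonneg hA hB
  rw [dist_eq, div_le_one (by linarith)]
  linarith

theorem dist_le_iff {D : ℕ} {A B : Mat D} (hA : IsState A) (hB : IsState B) {y : ℝ} (hy : 0 ≤ y) :
    dist A B ≤ y ↔ (1 - y) / (1 + y) ≤ cross A B := by
  have h0 := cross_nonneg hA hB
  rw [dist_eq, div_le_iff₀ (by linarith), div_le_iff₀ (by linarith)]
  constructor <;> intro h <;> linarith

theorem eq_of_mconst_eq_one {D : ℕ} {A B : Mat D} (hA : IsState A) (hB : IsState B)
    (h : A = (mconst A B : ℂ) • B) : A = B := by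
  have ht := congrArg Matrix.trace h
  rw [Matrix.trace_smul, hA.2, hB.2, smul_eq_mul, mul_one] at ht
  rw [h, ← ht, one_smul]

theorem dist_self {D : ℕ} {A : Mat D} (hA : IsState A) : dist A A = 0 := by
  have h : mconst A A = 1 :=
    le_antisymm (mconst_le_one hA hA) (le_mconst hA.1.1 hA fun σ _ => by rw [one_mul])
  rw [dist_eq, cross, h]; simp

/-- On states, every effect separates two states by at most their projective distance. -/
theorem pairing_sub_le_dist {D : ℕ} {A B Q : Mat D} (hA : IsState A) (hB : IsState B)
    (hQ : Q.PosSemidef) (hQ1 : (1 - Q).PosSemidef) :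
    pairing Q (A - B) ≤ dist A B := by
  have hx0 := mconst_nonneg hA.1 hB
  have hy0 := mconst_nonneg hB.1 hA
  have hx1 := mconst_le_one hA hB
  have hy1 := mconst_le_one hB hA
  have h1 := pairing_nonneg hQ (posSemidef_sub_mconst_smul hB.1 hA)
  have h2 := pairing_nonneg hQ1 (posSemidef_sub_mconst_smul hA.1 hB)
  have hb0 := pairing_nonneg hQ hB.1
  have ha1 := pairing_nonneg hQ1 hA.1
  rw [pairing_sub_right, pairing_smul_right] at h1 h2
  simp only [pairing_sub_left, pairing_one_left, hA.trace_re, hB.trace_re] at h2 ha1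
  rw [pairing_sub_right, dist_eq, cross]
  set x := mconst A B
  set y := mconst B A
  set a := pairing Q A
  set b := pairing Q B
  have hxy : 0 ≤ x * y := mul_nonneg hx0 hy0
  rw [le_div_iff₀ (by linarith)]
  -- Add (1 - x) times B ≥ yA tested on Q and (1 - y) times A ≥ xB tested on 1 - Q.
  have e1 : (a - b) * (1 - x * y) ≤ (1 - x) * (1 - y) := by
    nlinarith [mul_nonneg (sub_nonneg.2 hx1) h1, mul_nonneg (sub_nonneg.2 hy1) h2]
  -- Equivalent to (1 - x)(1 - y)(1 + xy) ≤ (1 - xy)², which turns `e1` into the claim after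
  -- cancelling 1 - xy.
  have e2 : 4 * (x * y) ≤ (x + y) * (1 + x * y) := by
    nlinarith [mul_nonneg hx0 (sq_nonneg (1 - y)), mul_nonneg hy0 (sq_nonneg (1 - x))]
  rcases (mul_le_one₀ hx1 hy0 hy1).lt_or_eq with hp | hp
  · have e3 : (a - b) * (1 + x * y) * (1 - x * y) ≤ (1 - x * y) * (1 - x * y) := by
      nlinarith [mul_le_mul_of_nonneg_right e1 (by linarith : 0 ≤ 1 + x * y)]
    exact le_of_mul_le_mul_right e3 (by linarith)
  -- Nothing can be cancelled when xy = 1, but then B ≥ A gives the bound directly.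
  · have hy : y = 1 := by nlinarith
    rw [hp]
    rw [hy] at h1
    linarith


/-! ### Positive maps and their adjoints -/

theorem eq_of_trace_conjTranspose_mul {D : ℕ} {X Y : Mat D}
    (h : ∀ B : Mat D, (Bᴴ * X).trace = (Bᴴ * Y).trace) : X = Y := by
  have h1 := h (X - Y)
  rw [← sub_eq_zero, ← Matrix.trace_sub, ← Matrix.mul_sub,
    Matrix.trace_conjTranspose_mul_self_eq_zero_iff] at h1
  exact sub_eq_zero.1 h1

theorem adj_adj {D : ℕ} (ψ : SuperOp D) : adj (adj ψ) = ψ := by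
  ext1 A
  refine eq_of_trace_conjTranspose_mul fun B => ?_
  rw [trace_adj]
  have := congrArg star (trace_adj ψ B A)
  rw [← Matrix.trace_conjTranspose, ← Matrix.trace_conjTranspose, Matrix.conjTranspose_mul,
    Matrix.conjTranspose_mul, Matrix.conjTranspose_conjTranspose,
    Matrix.conjTranspose_conjTranspose] at this
  exact this

theorem adj_comp {D : ℕ} (ψ χ : SuperOp D) : adj (ψ ∘ₗ χ) = adj χ ∘ₗ adj ψ := by
  ext1 A
  refine eq_of_trace_conjTranspose_mul fun B => ?_
  rw [LinearMap.comp_apply, trace_adj, trace_adj, trace_adj, LinearMap.comp_apply]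

/-- Over ℂ a matrix is Hermitian as soon as its quadratic form is real, and rank-one tests B see
exactly this form. -/
theorem isHermitian_of_trace_mul_real {D : ℕ} {M : Mat D}
    (h : ∀ B : Mat D, B.PosSemidef → 0 ≤ (B * M).trace) : M.IsHermitian := by
  rw [← Matrix.isSymmetric_toEuclideanLin_iff, LinearMap.isSymmetric_iff_inner_map_self_real]
  intro v
  have h1 := h _ (Matrix.posSemidef_vecMulVec_self_star (v : Fin D → ℂ))
  rw [Matrix.trace_mul_comm, trace_mul_vecMulVec] at h1
  have h2 : inner ℂ (Matrix.toEuclideanLin M v) v =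
      star (star (v : Fin D → ℂ) ⬝ᵥ (M *ᵥ (v : Fin D → ℂ))) := by
    rw [EuclideanSpace.inner_eq_star_dotProduct, Matrix.star_dotProduct, star_star,
      dotProduct_comm]
    rfl
  have h3 := (Complex.le_def.1 h1).2
  rw [h2]
  apply Complex.ext <;> simp at h3 ⊢
  rw [← h3]; simp

theorem IsPositive.adj {D : ℕ} {ψ : SuperOp D} (h : IsPositive ψ) : IsPositive (adj ψ) := by
  intro A hA
  have key : ∀ B : Mat D, B.PosSemidef → 0 ≤ (B * QDyn.adj ψ A).trace := by
    intro B hB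
    have := trace_adj ψ A B
    rw [hB.1.eq, (h B hB).1.eq] at this
    rw [this]
    exact trace_mul_nonneg (h B hB) hA
  refine posSemidef_of_pairing (isHermitian_of_trace_mul_real key) fun σ hσ => ?_
  rw [pairing_comm]
  exact (Complex.le_def.1 (key σ hσ.1)).1

/-- Positive maps such that neither the map nor its adjoint annihilates a state. -/
structure Regular {D : ℕ} (ψ : SuperOp D) : Prop where
  pos : IsPositive ψ
  ne_zero : ∀ ρ, IsState ρ → ψ ρ ≠ 0
  adj_ne_zero : ∀ ρ, IsState ρ → adj ψ ρ ≠ 0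

theorem Regular.adj {D : ℕ} {ψ : SuperOp D} (h : Regular ψ) : Regular (adj ψ) :=
  ⟨h.pos.adj, h.adj_ne_zero, by rw [adj_adj]; exact h.ne_zero⟩

theorem pairing_map {D : ℕ} {ψ : SuperOp D} (h : IsPositive ψ) {A B : Mat D}
    (hB : B.PosSemidef) : pairing (ψ B) A = pairing B (adj ψ A) := by
  have := trace_adj ψ A B
  rw [hB.1.eq, (h B hB).1.eq] at this
  rw [pairing, pairing, this]

theorem Regular.isState_proj {D : ℕ} {ψ : SuperOp D} (h : Regular ψ) {ρ : Mat D}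
    (hρ : IsState ρ) : IsState (proj ψ ρ) :=
  isState_normalize (h.pos ρ hρ.1) (h.ne_zero ρ hρ)

theorem Regular.map_ne_zero {D : ℕ} {ψ : SuperOp D} (h : Regular ψ) {A : Mat D}
    (hA : A.PosSemidef) (h0 : A ≠ 0) : ψ A ≠ 0 := by
  intro he
  apply h.ne_zero _ (isState_normalize hA h0)
  rw [normalize, map_smul, he, smul_zero]

/-- tr(ψ(A)σ) = tr(A ψ*(σ)) is positive because ψ* annihilates no state σ. -/
theorem Regular.map_posDef {D : ℕ} {ψ : SuperOp D} (h : Regular ψ) {A : Mat D}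
    (hA : A.PosDef) : (ψ A).PosDef := by
  refine posDef_of_pairing (h.pos A hA.posSemidef).1 fun σ hσ => ?_
  rw [pairing_map h.pos hA.posSemidef]
  exact pairing_pos hA (h.pos.adj σ hσ.1) (h.adj_ne_zero σ hσ)

theorem Regular.comp {D : ℕ} {ψ χ : SuperOp D} (h : Regular ψ) (h' : Regular χ) :
    Regular (ψ ∘ₗ χ) where
  pos A hA := h.pos _ (h'.pos A hA)
  ne_zero ρ hρ := h.map_ne_zero (h'.pos ρ hρ.1) (h'.ne_zero ρ hρ)
  adj_ne_zero ρ hρ := by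
    rw [adj_comp]
    exact h'.adj.map_ne_zero (h.adj.pos ρ hρ.1) (h.adj.ne_zero ρ hρ)

theorem Regular.proj_comp {D : ℕ} {ψ χ : SuperOp D} (h' : Regular χ) {ρ : Mat D}
    (hρ : IsState ρ) : proj (ψ ∘ₗ χ) ρ = proj ψ (proj χ ρ) := by
  have hne : ((χ ρ).trace)⁻¹ ≠ 0 := by
    rw [ne_eq, inv_eq_zero, (h'.pos ρ hρ.1).trace_eq_zero_iff]
    exact h'.ne_zero ρ hρ
  rw [proj_eq_normalize, proj_eq_normalize, proj, map_smul, normalize_smul hne]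
  rfl

/-! ### The contraction coefficient -/

theorem bddAbove_dist {D : ℕ} {ψ : SuperOp D} (h : Regular ψ) :
    BddAbove {x : ℝ | ∃ ρ σ : Mat D, IsState ρ ∧ IsState σ ∧ x = dist (proj ψ ρ) (proj ψ σ)} :=
  ⟨1, by rintro _ ⟨ρ, σ, hρ, hσ, rfl⟩; exact dist_le_one (h.isState_proj hρ) (h.isState_proj hσ)⟩

theorem dist_le_cnum {D : ℕ} {ψ : SuperOp D} (h : Regular ψ) {ρ σ : Mat D} (hρ : IsState ρ)
    (hσ : IsState σ) : dist (proj ψ ρ) (proj ψ σ) ≤ cnum ψ :=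
  le_csSup (bddAbove_dist h) ⟨ρ, σ, hρ, hσ, rfl⟩

theorem cnum_nonneg {D : ℕ} (hD : 1 ≤ D) {ψ : SuperOp D} (h : Regular ψ) : 0 ≤ cnum ψ :=
  (dist_nonneg (h.isState_proj (isState_maxMixed hD)) (h.isState_proj (isState_maxMixed hD))).trans
    (dist_le_cnum h (isState_maxMixed hD) (isState_maxMixed hD))

theorem cnum_le_iff_dist {D : ℕ} (hD : 1 ≤ D) {ψ : SuperOp D} (h : Regular ψ) {y : ℝ} :
    cnum ψ ≤ y ↔ ∀ ρ σ, IsState ρ → IsState σ → dist (proj ψ ρ) (proj ψ σ) ≤ y := by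
  constructor
  · exact fun hy ρ σ hρ hσ => (dist_le_cnum h hρ hσ).trans hy
  · intro hy
    refine csSup_le ⟨_, _, _, isState_maxMixed hD, isState_maxMixed hD, rfl⟩ ?_
    rintro _ ⟨ρ, σ, hρ, hσ, rfl⟩
    exact hy ρ σ hρ hσ

theorem cnum_le_one {D : ℕ} (hD : 1 ≤ D) {ψ : SuperOp D} (h : Regular ψ) : cnum ψ ≤ 1 :=
  (cnum_le_iff_dist hD h).2 fun _ _ hρ hσ => dist_le_one (h.isState_proj hρ) (h.isState_proj hσ)

/-- A lower bound on `m(ψ·ρ, ψ·σ) m(ψ·σ, ψ·ρ)` amounts to a bound on cross ratios. -/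
theorem le_cross_iff {D : ℕ} {ψ : SuperOp D} (h : Regular ψ) {q : ℝ}
    {ρ σ : Mat D} (hρ : IsState ρ) (hσ : IsState σ) :
    q ≤ cross (proj ψ ρ) (proj ψ σ) ↔ ∀ X Y, IsState X → IsState Y →
      q * (pairing (ψ σ) X * pairing (ψ ρ) Y) ≤ pairing (ψ ρ) X * pairing (ψ σ) Y := by
  have pρ := h.pos ρ hρ.1
  have pσ := h.pos σ hσ.1
  constructor
  · intro hq X Y hX hY
    obtain ⟨x, y, hx, hy, hxy, h1, h2⟩ := exists_mul_eq_cross_normalize pρ (h.ne_zero ρ hρ)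
      pσ (h.ne_zero σ hσ)
    rw [proj_eq_normalize, proj_eq_normalize, ← hxy] at hq
    have n1 := pairing_nonneg pσ hX.1
    have n2 := pairing_nonneg pρ hY.1
    calc q * (pairing (ψ σ) X * pairing (ψ ρ) Y)
        ≤ (x * y) * (pairing (ψ σ) X * pairing (ψ ρ) Y) := by gcongr
      _ = (x * pairing (ψ σ) X) * (y * pairing (ψ ρ) Y) := by ring
      _ ≤ _ := mul_le_mul (h1 X hX) (h2 Y hY) (mul_nonneg hy n2) (pairing_nonneg pρ hX.1)
  · intro hq
    by_contra! hlt
    have sρ := h.isState_proj hρ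
    have sσ := h.isState_proj hσ
    set x := mconst (proj ψ ρ) (proj ψ σ) with hx
    set y := mconst (proj ψ σ) (proj ψ ρ) with hy
    have hlt' : x * y < q := hlt
    have x0 : 0 ≤ x := mconst_nonneg sρ.1 sσ
    have y0 : 0 ≤ y := mconst_nonneg sσ.1 sρ
    have x1 : x ≤ 1 := mconst_le_one sρ sσ
    have y1 : y ≤ 1 := mconst_le_one sσ sρ
    -- Raising both optimal constants by e makes each comparison fail at some test state. As x, y, e
    -- ≤ 1, the product grows by at most 3e, whence the division by 3.
    obtain ⟨e, he, he1, hq'⟩ : ∃ e, 0 < e ∧ e ≤ 1 ∧ (x + e) * (y + e) ≤ q := by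
      refine ⟨min 1 ((q - x * y) / 3), lt_min one_pos (by linarith), min_le_left _ _, ?_⟩
      have h1 := min_le_left 1 ((q - x * y) / 3)
      have h2 := min_le_right 1 ((q - x * y) / 3)
      have h3 : 0 ≤ min 1 ((q - x * y) / 3) := le_min zero_le_one (by linarith)
      nlinarith
    have f1 : ∃ X, IsState X ∧ pairing (proj ψ ρ) X < (x + e) * pairing (proj ψ σ) X := by
      by_contra! hc
      have := le_mconst sρ.1.1 sσ hc
      linarith
    have f2 : ∃ Y, IsState Y ∧ pairing (proj ψ σ) Y < (y + e) * pairing (proj ψ ρ) Y := by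
      by_contra! hc
      have := le_mconst sσ.1.1 sρ hc
      linarith
    obtain ⟨X, hX, hX'⟩ := f1
    obtain ⟨Y, hY, hY'⟩ := f2
    have h3 := mul_lt_mul'' hX' hY' (pairing_nonneg sρ.1 hX.1) (pairing_nonneg sσ.1 hY.1)
    have h4 := hq X Y hX hY
    have a0 := trace_re_pos pρ (h.ne_zero ρ hρ)
    have b0 := trace_re_pos pσ (h.ne_zero σ hσ)
    rw [proj_eq_normalize, proj_eq_normalize, normalize_eq pρ, normalize_eq pσ] at h3
    simp only [pairing_smul_left] at h3
    have k0 : 0 < ((ψ ρ).trace.re)⁻¹ * ((ψ σ).trace.re)⁻¹ := by positivity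
    have n0 : 0 ≤ pairing (ψ σ) X * pairing (ψ ρ) Y :=
      mul_nonneg (pairing_nonneg pσ hX.1) (pairing_nonneg pρ hY.1)
    have h5 : ((ψ ρ).trace.re)⁻¹ * ((ψ σ).trace.re)⁻¹ * (pairing (ψ ρ) X * pairing (ψ σ) Y) <
      ((ψ ρ).trace.re)⁻¹ * ((ψ σ).trace.re)⁻¹ *
        ((x + e) * (y + e) * (pairing (ψ σ) X * pairing (ψ ρ) Y)) := by
      calc _ = _ := by ring
        _ < _ := h3
        _ = _ := by ring
    have h6 := lt_of_mul_lt_mul_left h5 k0.le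
    have h7 := mul_le_mul_of_nonneg_right hq' n0
    linarith

/-- The contraction coefficient in terms of cross ratios. -/
theorem cnum_le_iff {D : ℕ} (hD : 1 ≤ D) {ψ : SuperOp D} (h : Regular ψ) {y : ℝ} (hy0 : 0 ≤ y) :
    cnum ψ ≤ y ↔
      ∀ ρ σ X Y, IsState ρ → IsState σ → IsState X → IsState Y →
        (1 - y) / (1 + y) * (pairing (ψ σ) X * pairing (ψ ρ) Y) ≤
          pairing (ψ ρ) X * pairing (ψ σ) Y := by
  rw [cnum_le_iff_dist hD h]
  constructor
  · intro H ρ σ X Y hρ hσ hX hY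
    exact (le_cross_iff h hρ hσ).1
      ((dist_le_iff (h.isState_proj hρ) (h.isState_proj hσ) hy0).1 (H ρ σ hρ hσ)) X Y hX hY
  · intro H ρ σ hρ hσ
    exact (dist_le_iff (h.isState_proj hρ) (h.isState_proj hσ) hy0).2
      ((le_cross_iff h hρ hσ).2 fun X Y hX hY => H ρ σ X Y hρ hσ hX hY)

/-- Moving ψ across the pairing exchanges inputs with test states, and the cross-ratio inequalities
are symmetric under this exchange. -/
theorem cnum_adj_le {D : ℕ} (hD : 1 ≤ D) {ψ : SuperOp D} (h : Regular ψ) :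
    cnum (adj ψ) ≤ cnum ψ := by
  have H := (cnum_le_iff hD h (cnum_nonneg hD h)).1 le_rfl
  rw [cnum_le_iff hD h.adj (cnum_nonneg hD h)]
  intro ρ σ X Y hρ hσ hX hY
  have := H X Y ρ σ hX hY hρ hσ
  simp only [pairing_map h.pos hX.1, pairing_map h.pos hY.1] at this
  simp only [pairing_comm (adj ψ _)]
  linarith [mul_comm (pairing Y (adj ψ ρ)) (pairing X (adj ψ σ))]

theorem cnum_adj {D : ℕ} (hD : 1 ≤ D) {ψ : SuperOp D} (h : Regular ψ) :
    cnum (adj ψ) = cnum ψ := by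
  refine le_antisymm (cnum_adj_le hD h) ?_
  conv_lhs => rw [← adj_adj ψ]
  exact cnum_adj_le hD h.adj

/-- The projective distance contracts by the factor `c(ψ)`. -/
theorem dist_proj_le {D : ℕ} {ψ : SuperOp D} (h : Regular ψ) {A B : Mat D}
    (hA : IsState A) (hB : IsState B) :
    dist (proj ψ A) (proj ψ B) ≤ cnum ψ * dist A B := by
  set l := mconst A B with hl
  set m := mconst B A with hm
  have hA' : (A - (l : ℂ) • B).PosSemidef := posSemidef_sub_mconst_smul hA.1 hB
  have hB' : (B - (m : ℂ) • A).PosSemidef := posSemidef_sub_mconst_smul hB.1 hA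
  have l0 : 0 ≤ l := mconst_nonneg hA.1 hB
  have m0 : 0 ≤ m := mconst_nonneg hB.1 hA
  -- A vanishing remainder forces A = B by comparing traces; otherwise both remainders can be
  -- normalised to states.
  by_cases hA0 : A - (l : ℂ) • B = 0
  · obtain rfl := eq_of_mconst_eq_one hA hB (sub_eq_zero.1 hA0)
    rw [dist_self hA, dist_self (h.isState_proj hA), mul_zero]
  by_cases hB0 : B - (m : ℂ) • A = 0
  · obtain rfl := eq_of_mconst_eq_one hB hA (sub_eq_zero.1 hB0)
    rw [dist_self hA, dist_self (h.isState_proj hA), mul_zero]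
  have l1 : l < 1 := by
    have := trace_re_pos hA' hA0
    simp [hA.2, hB.2] at this
    exact this
  have m1 : m ≤ 1 := mconst_le_one hB hA
  -- Apply the definition of c(ψ) to the normalised remainders A - lB and B - mA instead of A and B.
  obtain ⟨x, y, x0, y0, hxy, h1, h2⟩ := exists_mul_eq_cross_normalize (h.pos _ hA')
    (h.map_ne_zero hA' hA0) (h.pos _ hB') (h.map_ne_zero hB' hB0)
  have hproj : ∀ M : Mat D, M.PosSemidef → M ≠ 0 → normalize (ψ M) = proj ψ (normalize M) := by
    intro M hM hM0
    have : (M.trace)⁻¹ ≠ 0 := by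
      rw [ne_eq, inv_eq_zero, hM.trace_eq_zero_iff]
      exact hM0
    rw [proj_eq_normalize, normalize.eq_1 M, map_smul, normalize_smul this]
  rw [hproj _ hA' hA0, hproj _ hB' hB0] at hxy
  have sA' := isState_normalize hA' hA0
  have sB' := isState_normalize hB' hB0
  have hc := dist_le_cnum h sA' sB'
  have q1 := cross_le_one (h.isState_proj sA') (h.isState_proj sB')
  rw [dist_eq, ← hxy] at hc
  rw [← hxy] at q1
  simp only [map_sub, map_smul, pairing_sub_left, pairing_smul_left] at h1 h2
  have hd := dist_eq A B
  have hp : cross A B = l * m := rfl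
  have q0 : 0 ≤ x * y := mul_nonneg x0 y0
  have p0 : 0 ≤ l * m := mul_nonneg l0 m0
  have p1 : l * m ≤ 1 := mul_le_one₀ l1.le m0 m1
  have w0 : 0 ≤ x * m := mul_nonneg x0 m0
  have w1 : 0 ≤ l * y := mul_nonneg l0 y0
  -- Expanding ψ(A - lB) ≥ x ψ(B - mA) gives (1 + xm) ψ(A) ≥ (x + l) ψ(B), and symmetrically for y.
  have hP := le_cross_normalize (h.pos A hA.1) (h.ne_zero A hA) (h.pos B hB.1) (h.ne_zero B hB)
    (x := (x + l) / (1 + x * m)) (y := (y + m) / (1 + l * y)) (by positivity)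
    (fun σ hσ => by
      rw [div_mul_eq_mul_div, div_le_iff₀ (by positivity)]
      linarith [h1 σ hσ])
    (fun σ hσ => by
      rw [div_mul_eq_mul_div, div_le_iff₀ (by positivity)]
      linarith [h2 σ hσ])
  rw [← proj_eq_normalize, ← proj_eq_normalize] at hP
  -- With p = lm and q = xy, the product of the two constants is (p + q + w)/(1 + pq + w) for some w
  -- ≥ 0, and dropping w decreases it because (1 - p)(1 - q) ≥ 0.
  have hP' : (l * m + x * y) / (1 + (l * m) * (x * y)) ≤ cross (proj ψ A) (proj ψ B) := by
    refine le_trans ?_ hP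
    rw [div_mul_div_comm, div_le_div_iff₀ (by positivity) (by positivity)]
    nlinarith [mul_nonneg (add_nonneg w0 w1) (mul_nonneg (sub_nonneg.2 p1) (sub_nonneg.2 q1))]
  have P0 := cross_nonneg (h.isState_proj hA) (h.isState_proj hB)
  rw [div_le_iff₀ (by positivity)] at hP'
  -- The map u ↦ (1 - u)/(1 + u) sends (p + q)/(1 + pq) to the product of the images of p and q.
  have hfin : dist (proj ψ A) (proj ψ B) ≤
      (1 - x * y) / (1 + x * y) * ((1 - l * m) / (1 + l * m)) := by
    rw [dist_eq, div_mul_div_comm, div_le_div_iff₀ (by positivity) (by positivity)]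
    nlinarith
  rw [hd, hp]
  exact hfin.trans (mul_le_mul_of_nonneg_right hc (div_nonneg (by linarith) (by linarith)))

theorem cnum_comp_le {D : ℕ} (hD : 1 ≤ D) {ψ χ : SuperOp D} (h : Regular ψ) (h' : Regular χ) :
    cnum (ψ ∘ₗ χ) ≤ cnum ψ * cnum χ := by
  rw [cnum_le_iff_dist hD (h.comp h')]
  intro ρ σ hρ hσ
  rw [h'.proj_comp hρ, h'.proj_comp hσ]
  exact (dist_proj_le h (h'.isState_proj hρ) (h'.isState_proj hσ)).trans
    (mul_le_mul_of_nonneg_left (dist_le_cnum h' hρ hσ) (cnum_nonneg hD h))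


/-! ### Contractions and the trace norm -/

/-- Contractions, in the form `U Uᴴ ≤ 1`. -/
def IsContraction {D : ℕ} (U : Mat D) : Prop := (1 - U * Uᴴ).PosSemidef

theorem dotProduct_mul_conjTranspose {D : ℕ} (U : Mat D) (v : Fin D → ℂ) :
    star v ⬝ᵥ ((U * Uᴴ) *ᵥ v) = star (Uᴴ *ᵥ v) ⬝ᵥ (Uᴴ *ᵥ v) := by
  rw [Matrix.star_mulVec, Matrix.conjTranspose_conjTranspose, Matrix.dotProduct_mulVec,
    Matrix.dotProduct_mulVec, Matrix.vecMul_vecMul]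

theorem re_star_dotProduct_self {D : ℕ} (v : Fin D → ℂ) :
    (star v ⬝ᵥ v).re = ‖WithLp.toLp 2 v‖ ^ 2 := by
  rw [EuclideanSpace.norm_sq_eq]
  simp [dotProduct, Complex.mul_re, ← Complex.normSq_eq_norm_sq, Complex.normSq_apply]

theorem norm_star_dotProduct_le {D : ℕ} (v w : Fin D → ℂ) :
    ‖star v ⬝ᵥ w‖ ≤ ‖WithLp.toLp 2 v‖ * ‖WithLp.toLp 2 w‖ := by
  have := norm_inner_le_norm (𝕜 := ℂ) (WithLp.toLp 2 v) (WithLp.toLp 2 w)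
  rwa [EuclideanSpace.inner_eq_star_dotProduct, dotProduct_comm] at this

theorem IsContraction.norm_mulVec_le {D : ℕ} {U : Mat D} (hU : IsContraction U)
    (v : Fin D → ℂ) : ‖WithLp.toLp 2 (Uᴴ *ᵥ v)‖ ≤ ‖WithLp.toLp 2 v‖ := by
  have h := (Complex.le_def.1 (hU.dotProduct_mulVec_nonneg v)).1
  rw [Matrix.sub_mulVec, dotProduct_sub, dotProduct_mul_conjTranspose, Matrix.one_mulVec,
    Complex.sub_re, re_star_dotProduct_self, re_star_dotProduct_self] at h
  have h' : ‖WithLp.toLp 2 (Uᴴ *ᵥ v)‖ ^ 2 ≤ ‖WithLp.toLp 2 v‖ ^ 2 := by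
    simpa using h
  exact le_of_sq_le_sq h' (norm_nonneg _)

theorem IsContraction.norm_dotProduct_le {D : ℕ} {U : Mat D} (hU : IsContraction U)
    (v w : Fin D → ℂ) :
    ‖star v ⬝ᵥ (U *ᵥ w)‖ ≤ ‖WithLp.toLp 2 v‖ * ‖WithLp.toLp 2 w‖ := by
  have : star v ⬝ᵥ (U *ᵥ w) = star (Uᴴ *ᵥ v) ⬝ᵥ w := by
    rw [Matrix.star_mulVec, Matrix.conjTranspose_conjTranspose, Matrix.dotProduct_mulVec]
  rw [this]
  exact (norm_star_dotProduct_le _ _).trans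
    (mul_le_mul_of_nonneg_right (hU.norm_mulVec_le v) (norm_nonneg _))

theorem norm_col_eq_one {D : ℕ} {U : Mat D} (hU : Uᴴ * U = 1) (i : Fin D) :
    ‖WithLp.toLp 2 (fun k => U k i)‖ = 1 := by
  have h1 : (star (fun k => U k i) ⬝ᵥ fun k => U k i) = 1 := by
    have := congrFun (congrFun hU i) i
    simpa [Matrix.mul_apply, dotProduct] using this
  have h2 := re_star_dotProduct_self (fun k => U k i)
  rw [h1, Complex.one_re] at h2
  nlinarith [norm_nonneg (WithLp.toLp 2 (fun k => U k i))]

theorem IsContraction.norm_trace_mul_colProj_le {D : ℕ} {V : Mat D} (hV : IsContraction V)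
    {U : Mat D} (hU : Uᴴ * U = 1) (i : Fin D) : ‖(V * colProj U i).trace‖ ≤ 1 := by
  rw [colProj, trace_mul_vecMulVec]
  refine (hV.norm_dotProduct_le _ _).trans ?_
  rw [norm_col_eq_one hU]; norm_num

theorem isContraction_conj_diagonal {D : ℕ} {U : Mat D} (hU : Uᴴ * U = 1) (hU' : U * Uᴴ = 1)
    {f : Fin D → ℂ} (hf : ∀ i, ‖f i‖ ≤ 1) :
    IsContraction (U * Matrix.diagonal f * Uᴴ) := by
  have h1 : (1 : Mat D) - (U * Matrix.diagonal f * Uᴴ) * (U * Matrix.diagonal f * Uᴴ)ᴴ =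
      U * Matrix.diagonal (fun i => 1 - f i * star (f i)) * Uᴴ := by
    have h2 : Matrix.diagonal (fun i => 1 - f i * star (f i)) =
        (1 : Mat D) - Matrix.diagonal f * Matrix.diagonal (star f) := by
      rw [Matrix.diagonal_mul_diagonal, ← Matrix.diagonal_one, Matrix.diagonal_sub]
      rfl
    rw [h2, Matrix.mul_sub, Matrix.sub_mul, Matrix.mul_one, hU', Matrix.conjTranspose_mul,
      Matrix.conjTranspose_mul, Matrix.conjTranspose_conjTranspose, Matrix.diagonal_conjTranspose]
    congr 1
    calc _ = U * Matrix.diagonal f * (Uᴴ * U) * (Matrix.diagonal (star f) * Uᴴ) := by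
          simp only [Matrix.mul_assoc]
      _ = _ := by rw [hU, Matrix.mul_one]; simp only [Matrix.mul_assoc]
  rw [IsContraction, h1]
  refine Matrix.PosSemidef.mul_mul_conjTranspose_same (Matrix.PosSemidef.diagonal fun i => ?_) U
  have h3 : f i * star (f i) = ((‖f i‖ ^ 2 : ℝ) : ℂ) := by
    rw [Complex.star_def, Complex.mul_conj, Complex.normSq_eq_norm_sq]
  simp only [Pi.zero_apply]
  rw [h3, ← Complex.ofReal_one, ← Complex.ofReal_sub]
  exact Complex.zero_le_real.2 (by nlinarith [hf i, norm_nonneg (f i)])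

theorem trace_mul_conj_diagonal {D : ℕ} (V U : Mat D) (f : Fin D → ℂ) :
    (V * (U * Matrix.diagonal f * Uᴴ)).trace = ∑ i, f i * (V * colProj U i).trace := by
  rw [conj_diagonal_eq_sum, Matrix.mul_sum, Matrix.trace_sum]
  simp

/-- Take the trace in an eigenbasis u_i of Xᴴ X: each term ⟨u_i, V X u_i⟩ is at most ‖X u_i‖, the
i-th singular value. -/
theorem norm_trace_mul_le_traceNorm {D : ℕ} {V : Mat D} (hV : IsContraction V) (X : Mat D) :
    ‖(V * X).trace‖ ≤ traceNorm X := by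
  obtain ⟨U, hU, hU', h⟩ := exists_unitary_diagonalization (Matrix.isHermitian_conjTranspose_mul_self X)
  have h1 : (V * X).trace = ∑ i, star (fun k => U k i) ⬝ᵥ (V *ᵥ (X *ᵥ fun k => U k i)) := by
    have : (V * X).trace = (V * X * (U * Matrix.diagonal (fun _ => 1) * Uᴴ)).trace := by
      rw [Matrix.diagonal_one, Matrix.mul_one, hU', Matrix.mul_one]
    rw [this, trace_mul_conj_diagonal]
    refine Finset.sum_congr rfl fun i _ => ?_
    rw [one_mul, colProj, trace_mul_vecMulVec, Matrix.mulVec_mulVec]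
  rw [h1, traceNorm]
  refine (norm_sum_le _ _).trans (Finset.sum_le_sum fun i _ => ?_)
  refine (hV.norm_dotProduct_le _ _).trans ?_
  rw [norm_col_eq_one hU, one_mul]
  apply Real.le_sqrt_of_sq_le
  rw [← re_star_dotProduct_self]
  have h2 : star (X *ᵥ fun k => U k i) ⬝ᵥ (X *ᵥ fun k => U k i) = (Uᴴ * (Xᴴ * X) * U) i i := by
    rw [Matrix.star_mulVec, ← Matrix.dotProduct_mulVec, Matrix.mulVec_mulVec, Matrix.mul_assoc]
    rfl
  have h3 : Uᴴ * (Xᴴ * X) * U = Matrix.diagonal (fun i =>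
      ((Matrix.isHermitian_conjTranspose_mul_self X).eigenvalues i : ℂ)) := by
    have h4 := congrArg (fun M => Uᴴ * M * U) h
    simp only [Matrix.mul_assoc, hU, Matrix.mul_one] at h4
    rw [← Matrix.mul_assoc Uᴴ U, hU, Matrix.one_mul] at h4
    simpa only [Matrix.mul_assoc] using h4
  rw [h2, h3]; simp

/-- The optimal contraction is |X|⁻¹ Xᴴ from the polar decomposition. The convention 0⁻¹ = 0 makes
it a partial isometry when X is singular. -/
theorem exists_contraction_traceNorm {D : ℕ} (X : Mat D) :
    ∃ V : Mat D, IsContraction V ∧ (V * X).trace = (traceNorm X : ℂ) := by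
  set hH := Matrix.isHermitian_conjTranspose_mul_self X
  obtain ⟨U, hU, hU', h⟩ := exists_unitary_diagonalization hH
  have h0 : ∀ i, 0 ≤ hH.eigenvalues i := Matrix.eigenvalues_conjTranspose_mul_self_nonneg X
  set g : Fin D → ℂ := fun i => (((√(hH.eigenvalues i))⁻¹ : ℝ) : ℂ) with hg
  set e : Fin D → ℂ := fun i => (hH.eigenvalues i : ℂ) with he
  have hstar : star g = g := by
    funext i; simp [hg]
  refine ⟨U * Matrix.diagonal g * Uᴴ * Xᴴ, ?_, ?_⟩
  · have h1 : (U * Matrix.diagonal g * Uᴴ * Xᴴ) * (U * Matrix.diagonal g * Uᴴ * Xᴴ)ᴴ =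
        U * Matrix.diagonal (fun i => g i * e i * g i) * Uᴴ := by
      have h2 : Matrix.diagonal (fun i => g i * e i * g i) =
          Matrix.diagonal g * Matrix.diagonal e * Matrix.diagonal g := by
        rw [Matrix.diagonal_mul_diagonal, Matrix.diagonal_mul_diagonal]
      have h3 : (U * Matrix.diagonal g * Uᴴ * Xᴴ)ᴴ = X * (U * Matrix.diagonal g * Uᴴ) := by
        simp only [Matrix.conjTranspose_mul, Matrix.conjTranspose_conjTranspose,
          Matrix.diagonal_conjTranspose, hstar, Matrix.mul_assoc]
      rw [h3, h2]
      calc _ = U * Matrix.diagonal g * Uᴴ * (Xᴴ * X) * (U * Matrix.diagonal g * Uᴴ) := by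
            simp only [Matrix.mul_assoc]
        _ = U * Matrix.diagonal g * (Uᴴ * U) * Matrix.diagonal e * (Uᴴ * U) *
            Matrix.diagonal g * Uᴴ := by rw [h]; simp only [Matrix.mul_assoc]
        _ = _ := by rw [hU, Matrix.mul_one, Matrix.mul_one]; simp only [Matrix.mul_assoc]
    have h4 : (1 : Mat D) - U * Matrix.diagonal (fun i => g i * e i * g i) * Uᴴ =
        U * Matrix.diagonal (fun i => 1 - g i * e i * g i) * Uᴴ := by
      have : Matrix.diagonal (fun i => 1 - g i * e i * g i) =
        (1 : Mat D) - Matrix.diagonal (fun i => g i * e i * g i) := by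
        rw [← Matrix.diagonal_one, Matrix.diagonal_sub]
      rw [this, Matrix.mul_sub, Matrix.sub_mul, Matrix.mul_one, hU']
    rw [IsContraction, h1, h4]
    refine Matrix.PosSemidef.mul_mul_conjTranspose_same (Matrix.PosSemidef.diagonal fun i => ?_) U
    simp only [Pi.zero_apply, hg, he]
    rw [← Complex.ofReal_mul, ← Complex.ofReal_mul, ← Complex.ofReal_one, ← Complex.ofReal_sub]
    refine Complex.zero_le_real.2 (sub_nonneg.2 ?_)
    rcases (h0 i).eq_or_lt with hz | hz
    · rw [← hz]; simp
    · have h5 := Real.mul_self_sqrt (h0 i)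
      have h6 := Real.sqrt_pos.2 hz
      rw [← h5, Real.sqrt_mul_self h6.le]
      field_simp
      exact le_rfl
  · have h1 : (U * Matrix.diagonal g * Uᴴ * Xᴴ * X).trace = ∑ i, g i * e i := by
      calc _ = (U * Matrix.diagonal g * (Uᴴ * U) * Matrix.diagonal e * Uᴴ).trace := by
            rw [Matrix.mul_assoc _ Xᴴ, h]; simp only [Matrix.mul_assoc]
        _ = (Matrix.diagonal g * Matrix.diagonal e * (Uᴴ * U)).trace := by
            rw [hU, Matrix.mul_one, Matrix.mul_assoc, Matrix.mul_assoc, Matrix.trace_mul_comm]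
            simp only [Matrix.mul_assoc, hU, Matrix.mul_one]
        _ = _ := by
            rw [hU, Matrix.mul_one, Matrix.diagonal_mul_diagonal, Matrix.trace_diagonal]
    rw [h1, traceNorm, Complex.ofReal_sum]
    refine Finset.sum_congr rfl fun i _ => ?_
    simp only [hg, he]
    rw [← Complex.ofReal_mul]
    congr 1
    rcases (h0 i).eq_or_lt with hz | hz
    · rw [← hz]; simp
    · have h6 := Real.sqrt_pos.2 hz
      rw [inv_mul_eq_iff_eq_mul₀ h6.ne', Real.mul_self_sqrt (h0 i)]

theorem traceNorm_nonneg {D : ℕ} (X : Mat D) : 0 ≤ traceNorm X :=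
  Finset.sum_nonneg fun _ _ => Real.sqrt_nonneg _

/-- The absolute eigenvalues of the Hermitian part of `X` are summed up by the trace norm. -/
theorem sum_abs_eigenvalues_le {D : ℕ} {X H : Mat D} (hH : H.IsHermitian) {z : ℂ} (hz : ‖z‖ = 1)
    (hX : H = (2⁻¹ : ℂ) • (z • X + (z • X)ᴴ)) : ∑ i, |hH.eigenvalues i| ≤ traceNorm X := by
  obtain ⟨U, hU, hU', h⟩ := exists_unitary_diagonalization hH
  -- The sign of H is a Hermitian contraction attaining the sum of absolute eigenvalues, and it sees
  -- only the real part of its trace against z X.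
  set s : Fin D → ℂ := fun i => ((SignType.sign (hH.eigenvalues i) : ℝ) : ℂ) with hs
  have hV : IsContraction (U * Matrix.diagonal s * Uᴴ) := by
    refine isContraction_conj_diagonal hU hU' fun i => ?_
    simp only [hs]
    rcases lt_trichotomy (hH.eigenvalues i) 0 with h | h | h <;> simp [h]
  set V := U * Matrix.diagonal s * Uᴴ with hVdef
  have hVh : Vᴴ = V := by
    have : star s = s := by funext i; simp [hs]
    simp only [hVdef, Matrix.conjTranspose_mul, Matrix.conjTranspose_conjTranspose,
          Matrix.diagonal_conjTranspose, this, Matrix.mul_assoc]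
  have h1 : (V * H).trace = ((∑ i, |hH.eigenvalues i| : ℝ) : ℂ) := by
    calc _ = (V * (U * Matrix.diagonal (fun i => (hH.eigenvalues i : ℂ)) * Uᴴ)).trace := by
            rw [← h]
      _ = (U * Matrix.diagonal s * (Uᴴ * U) *
            Matrix.diagonal (fun i => (hH.eigenvalues i : ℂ)) * Uᴴ).trace := by
            rw [hVdef]; simp only [Matrix.mul_assoc]
      _ = (Matrix.diagonal s * Matrix.diagonal (fun i => (hH.eigenvalues i : ℂ)) *
            (Uᴴ * U)).trace := by
            rw [hU, Matrix.mul_one, Matrix.mul_assoc, Matrix.mul_assoc, Matrix.trace_mul_comm]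
            simp only [Matrix.mul_assoc, hU, Matrix.mul_one]
      _ = _ := by
            rw [hU, Matrix.mul_one, Matrix.diagonal_mul_diagonal, Matrix.trace_diagonal,
              Complex.ofReal_sum]
            refine Finset.sum_congr rfl fun i _ => ?_
            simp only [hs]
            rw [← Complex.ofReal_mul, sign_mul_self]
  have h2 : ∑ i, |hH.eigenvalues i| = (z * (V * X).trace).re := by
    have h3 : (V * (z • X)ᴴ).trace = star ((V * (z • X)).trace) := by
      rw [← Matrix.trace_conjTranspose, Matrix.conjTranspose_mul, hVh, Matrix.trace_mul_comm]
    have h4 := congrArg Complex.re h1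
    rw [Complex.ofReal_re] at h4
    rw [← h4, hX, Matrix.mul_smul, Matrix.mul_add, Matrix.trace_smul, Matrix.trace_add, h3,
      Matrix.mul_smul, Matrix.trace_smul, smul_eq_mul, smul_eq_mul, Complex.star_def,
      Complex.add_conj]
    rw [← Complex.ofReal_ofNat, ← Complex.ofReal_inv, ← Complex.ofReal_mul, Complex.ofReal_re]
    ring
  rw [h2]
  refine (Complex.re_le_norm _).trans ?_
  rw [norm_mul, hz, one_mul]
  exact norm_trace_mul_le_traceNorm hV X

theorem IsContraction.norm_trace_mul_le {D : ℕ} {V H : Mat D} (hV : IsContraction V)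
    (hH : H.IsHermitian) : ‖(V * H).trace‖ ≤ ∑ i, |hH.eigenvalues i| := by
  obtain ⟨U, hU, -, h⟩ := exists_unitary_diagonalization hH
  conv_lhs => rw [h, trace_mul_conj_diagonal]
  refine (norm_sum_le _ _).trans (Finset.sum_le_sum fun i _ => ?_)
  rw [norm_mul, Complex.norm_real, Real.norm_eq_abs]
  exact mul_le_of_le_one_right (abs_nonneg _) (hV.norm_trace_mul_colProj_le hU i)

/-- States are separated by contractions by at most twice the projective distance. -/
theorem norm_trace_mul_sub_le {D : ℕ} {A B V : Mat D} (hA : IsState A) (hB : IsState B)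
    (hV : IsContraction V) : ‖(V * (A - B)).trace‖ ≤ 2 * dist A B := by
  have hH : (A - B).IsHermitian := hA.1.1.sub hB.1.1
  obtain ⟨U, hU, hU', h⟩ := exists_unitary_diagonalization hH
  have h1 := hV.norm_trace_mul_le hH
  -- The spectral projection onto the positive part of A - B. As A - B has trace zero, its absolute
  -- eigenvalues sum to twice the positive part, hence the factor 2.
  set f : Fin D → ℂ := fun i => if 0 < hH.eigenvalues i then 1 else 0 with hf
  set Q := U * Matrix.diagonal f * Uᴴ with hQ
  have hQp : Q.PosSemidef := by
    refine Matrix.PosSemidef.mul_mul_conjTranspose_same (Matrix.PosSemidef.diagonal fun i => ?_) U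
    simp only [hf, Pi.zero_apply]
    split_ifs <;> simp
  have hQ1 : (1 - Q).PosSemidef := by
    have : (1 : Mat D) - Q = U * Matrix.diagonal (fun i => 1 - f i) * Uᴴ := by
      have : Matrix.diagonal (fun i => 1 - f i) = (1 : Mat D) - Matrix.diagonal f := by
        rw [← Matrix.diagonal_one, Matrix.diagonal_sub]
      rw [this, Matrix.mul_sub, Matrix.sub_mul, Matrix.mul_one, hU']
    rw [this]
    refine Matrix.PosSemidef.mul_mul_conjTranspose_same (Matrix.PosSemidef.diagonal fun i => ?_) U
    simp only [hf, Pi.zero_apply]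
    split_ifs <;> simp
  have h2 : pairing Q (A - B) = ∑ i, max (hH.eigenvalues i) 0 := by
    have : (Q * (A - B)).trace = ((∑ i, max (hH.eigenvalues i) 0 : ℝ) : ℂ) := by
      calc _ = (Q * (U * Matrix.diagonal (fun i => (hH.eigenvalues i : ℂ)) * Uᴴ)).trace := by
            rw [← h]
      _ = (U * Matrix.diagonal f * (Uᴴ * U) *
            Matrix.diagonal (fun i => (hH.eigenvalues i : ℂ)) * Uᴴ).trace := by
            rw [hQ]; simp only [Matrix.mul_assoc]
      _ = (Matrix.diagonal f * Matrix.diagonal (fun i => (hH.eigenvalues i : ℂ)) *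
            (Uᴴ * U)).trace := by
            rw [hU, Matrix.mul_one, Matrix.mul_assoc, Matrix.mul_assoc, Matrix.trace_mul_comm]
            simp only [Matrix.mul_assoc, hU, Matrix.mul_one]
      _ = _ := by
            rw [hU, Matrix.mul_one, Matrix.diagonal_mul_diagonal, Matrix.trace_diagonal,
              Complex.ofReal_sum]
            refine Finset.sum_congr rfl fun i _ => ?_
            simp only [hf]
            split_ifs with hi
            · rw [max_eq_left hi.le, one_mul]
            · rw [max_eq_right (not_lt.1 hi), zero_mul, Complex.ofReal_zero]
    rw [pairing, this, Complex.ofReal_re]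
  have h3 : ∑ i, hH.eigenvalues i = 0 := by
    have := hH.trace_eq_sum_eigenvalues
    rw [Matrix.trace_sub, hA.2, hB.2, sub_self] at this
    have h4 := congrArg Complex.re this
    simpa using h4.symm
  have h5 : ∑ i, |hH.eigenvalues i| = 2 * pairing Q (A - B) := by
    have h6 : ∑ i, |hH.eigenvalues i| =
        ∑ i, 2 * max (hH.eigenvalues i) 0 - ∑ i, hH.eigenvalues i := by
      rw [← Finset.sum_sub_distrib]
      refine Finset.sum_congr rfl fun i _ => ?_
      rcases le_total 0 (hH.eigenvalues i) with hi | hi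
      · rw [abs_of_nonneg hi, max_eq_left hi]; ring
      · rw [abs_of_nonpos hi, max_eq_right hi]; ring
    rw [h6, h3, h2, Finset.mul_sum, sub_zero]
  have h6 := pairing_sub_le_dist hA hB hQp hQ1
  linarith

theorem isContraction_single {D : ℕ} (i j : Fin D) : IsContraction (Matrix.single i j (1 : ℂ)) := by
  rw [IsContraction, Matrix.conjTranspose_single, Matrix.single_mul_single_same, star_one, one_mul,
    ← Matrix.diagonal_single, ← Matrix.diagonal_one, Matrix.diagonal_sub]
  refine Matrix.PosSemidef.diagonal fun k => ?_
  rcases eq_or_ne k i with rfl | h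
  · simp
  · simp [h]

/-- Matrix units are contractions, so smallness in `dist` controls entries. All convergence is
proved through this, and no metric property of `dist` is needed. -/
theorem norm_entry_sub_le {D : ℕ} {A B : Mat D} (hA : IsState A) (hB : IsState B) (i j : Fin D) :
    ‖A i j - B i j‖ ≤ 2 * dist A B := by
  have := norm_trace_mul_sub_le hA hB (isContraction_single j i)
  rwa [Matrix.trace_single_mul, one_smul] at this


theorem IsState.sum_eigenvalues {D : ℕ} {ρ : Mat D} (h : IsState ρ) :
    ∑ i, h.1.1.eigenvalues i = 1 := by
  have h4 := congrArg Complex.re h.1.1.trace_eq_sum_eigenvalues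
  rw [h.trace_re] at h4
  simpa using h4.symm

theorem IsState.eigenvalues_le_one {D : ℕ} {ρ : Mat D} (h : IsState ρ) (i : Fin D) :
    h.1.1.eigenvalues i ≤ 1 := by
  rw [← h.sum_eigenvalues]
  exact Finset.single_le_sum (fun j _ => h.1.eigenvalues_nonneg j) (Finset.mem_univ i)

theorem IsState.isContraction {D : ℕ} {ρ : Mat D} (h : IsState ρ) : IsContraction ρ := by
  obtain ⟨U, hU, hU', he⟩ := exists_unitary_diagonalization h.1.1
  have : IsContraction (U * Matrix.diagonal (fun i => (h.1.1.eigenvalues i : ℂ)) * Uᴴ) := by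
    refine isContraction_conj_diagonal hU hU' fun i => ?_
    rw [Complex.norm_real, Real.norm_eq_abs, abs_of_nonneg (h.1.eigenvalues_nonneg i)]
    exact h.eigenvalues_le_one i
  rwa [← he] at this

theorem IsState.norm_trace_mul_le_one {D : ℕ} {ρ V : Mat D} (h : IsState ρ)
    (hV : IsContraction V) : ‖(V * ρ).trace‖ ≤ 1 := by
  refine (hV.norm_trace_mul_le h.1.1).trans ?_
  simp only [abs_of_nonneg (h.1.eigenvalues_nonneg _)]
  exact h.sum_eigenvalues.le

theorem IsState.norm_entry_le_one {D : ℕ} {ρ : Mat D} (h : IsState ρ) (i j : Fin D) :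
    ‖ρ i j‖ ≤ 1 := by
  have := h.norm_trace_mul_le_one (isContraction_single j i)
  rwa [Matrix.trace_single_mul, one_smul] at this

/-! ### Approximation by rank-one maps -/

theorem norm_trace_mul_map_le {D : ℕ} {V : Mat D} (Δ : SuperOp D) {C : ℝ}
    (hC : ∀ ρ, IsState ρ → ‖(V * Δ ρ).trace‖ ≤ C) {H : Mat D} (hH : H.IsHermitian) :
    ‖(V * Δ H).trace‖ ≤ C * ∑ i, |hH.eigenvalues i| := by
  obtain ⟨U, hU, -, h⟩ := exists_unitary_diagonalization hH
  have h1 : (V * Δ H).trace = ∑ i, (hH.eigenvalues i : ℂ) * (V * Δ (colProj U i)).trace := by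
    conv_lhs => rw [h, conj_diagonal_eq_sum, map_sum, Matrix.mul_sum, Matrix.trace_sum]
    simp
  rw [h1, Finset.mul_sum]
  refine (norm_sum_le _ _).trans (Finset.sum_le_sum fun i _ => ?_)
  rw [norm_mul, Complex.norm_real, Real.norm_eq_abs, mul_comm]
  exact mul_le_mul_of_nonneg_right (hC _ (isState_colProj hU i)) (abs_nonneg _)

/-- Spectral decomposition extends a bound on states to Hermitian matrices. The factor 2 comes from
splitting X into its Hermitian and skew-Hermitian parts. -/
theorem traceNorm_map_le {D : ℕ} (Δ : SuperOp D) {C : ℝ} (hC0 : 0 ≤ C)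
    (hC : ∀ V ρ, IsContraction V → IsState ρ → ‖(V * Δ ρ).trace‖ ≤ C) (X : Mat D) :
    traceNorm (Δ X) ≤ 2 * C * traceNorm X := by
  obtain ⟨V, hV, hVX⟩ := exists_contraction_traceNorm (Δ X)
  have hherm : ∀ z : ℂ, ((2⁻¹ : ℂ) • (z • X + (z • X)ᴴ)).IsHermitian := by
    intro z
    rw [Matrix.IsHermitian, Matrix.conjTranspose_smul, Matrix.conjTranspose_add,
      Matrix.conjTranspose_conjTranspose, add_comm]
    simp
  have hdec : X = (2⁻¹ : ℂ) • ((1 : ℂ) • X + ((1 : ℂ) • X)ᴴ) +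
      Complex.I • ((2⁻¹ : ℂ) • ((-Complex.I) • X + ((-Complex.I) • X)ᴴ)) := by
    ext i j
    simp
    ring_nf
    simp
    ring
  have hb : ∀ z : ℂ, ‖z‖ = 1 →
      ‖(V * Δ ((2⁻¹ : ℂ) • (z • X + (z • X)ᴴ))).trace‖ ≤ C * traceNorm X := by
    intro z hz
    exact (norm_trace_mul_map_le Δ (fun ρ hρ => hC V ρ hV hρ) (hherm z)).trans
      (mul_le_mul_of_nonneg_left (sum_abs_eigenvalues_le (hherm z) hz rfl) hC0)
  have h1 : traceNorm (Δ X) = ‖(V * Δ X).trace‖ := by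
    rw [hVX, Complex.norm_real, Real.norm_eq_abs, abs_of_nonneg (traceNorm_nonneg _)]
  rw [h1]
  conv_lhs => rw [hdec, map_add, map_smul _ Complex.I, Matrix.mul_add, Matrix.trace_add,
    Matrix.mul_smul, Matrix.trace_smul]
  refine (norm_add_le _ _).trans ?_
  rw [norm_smul, Complex.norm_I, one_mul]
  linarith [hb 1 (by simp), hb (-Complex.I) (by simp)]

theorem opNorm_le {D : ℕ} {Δ : SuperOp D} {C : ℝ} (hC : 0 ≤ C)
    (h : ∀ X, traceNorm (Δ X) ≤ C * traceNorm X) : opNorm Δ ≤ C :=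
  csInf_le ⟨0, fun _ hx => hx.1⟩ ⟨hC, h⟩

theorem opNorm_nonneg {D : ℕ} (Δ : SuperOp D) : 0 ≤ opNorm Δ :=
  Real.sInf_nonneg fun _ hx => hx.1

theorem rankOneError_le {D : ℕ} (hD : 1 ≤ D) {ψ : SuperOp D} (h : Regular ψ) {A B : Mat D}
    (hA : IsState A) (hB : IsState B) :
    rankOneError ψ (proj (adj ψ) B) (proj ψ A) ≤ 8 * cnum ψ := by
  have c0 := cnum_nonneg hD h
  set Z := proj ψ A with hZ
  set Z' := proj (adj ψ) B with hZ'
  have sZ : IsState Z := h.isState_proj hA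
  have sZ' : IsState Z' := h.adj.isState_proj hB
  have hone : (adj ψ 1).PosDef := h.adj.map_posDef Matrix.PosDef.one
  have : Nonempty (Fin D) := ⟨⟨0, hD⟩⟩
  have hone0 : adj ψ 1 ≠ 0 := by
    intro h0
    have := hone.trace_pos
    rw [h0] at this
    simp at this
  set W := normalize (adj ψ 1) with hW
  have hWproj : W = proj (adj ψ) ((D : ℂ)⁻¹ • (1 : Mat D)) := by
    rw [proj_eq_normalize, map_smul, normalize_smul]
    have : (D : ℂ) ≠ 0 := by exact_mod_cast (by omega : D ≠ 0)
    exact inv_ne_zero this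
  have sW : IsState W := isState_normalize hone.posSemidef hone0
  refine opNorm_le (by positivity) fun X => ?_
  have h8 : 8 * cnum ψ = 2 * (4 * cnum ψ) := by ring
  rw [h8]
  refine traceNorm_map_le _ (by positivity) (fun V ρ hV hρ => ?_) X
  have pρ := h.pos ρ hρ.1
  -- Since tr ψ(ρ) = tr(ρ ψ*(1)), the normalisation by tr ψ*(1) produces the weight tr(ρW) for W =
  -- ψ*·(1/D).
  have hmap : ((adj ψ 1).trace)⁻¹ • ψ ρ = (pairing ρ W : ℂ) • proj ψ ρ := by
    have h1 : (ψ ρ).trace.re = pairing ρ (adj ψ 1) := by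
      rw [← pairing_map h.pos hρ.1, pairing_comm, pairing_one_left]
    rw [hW, normalize_eq hone.posSemidef, pairing_smul_right, ← h1, proj_eq_normalize,
      normalize_eq pρ, smul_smul, trace_eq_re hone.1]
    have := (trace_re_pos pρ (h.ne_zero ρ hρ)).ne'
    congr 1
    rw [← Complex.ofReal_mul, ← Complex.ofReal_inv]
    congr 1
    rw [Complex.ofReal_re]
    field_simp
  -- Each summand is at most 2c: ψ·ρ and Z both lie in the image of ψ, while W and Z' both lie in
  -- the image of ψ*, and c(ψ*) = c(ψ).
  have hΔ : (((adj ψ 1).trace)⁻¹ • ψ - rankOne Z' Z) ρ =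
      (pairing ρ W : ℂ) • (proj ψ ρ - Z) + ((pairing ρ (W - Z') : ℝ) : ℂ) • Z := by
    rw [LinearMap.sub_apply, LinearMap.smul_apply, hmap, pairing_sub_right, Complex.ofReal_sub,
      sub_smul, smul_sub]
    have : rankOne Z' Z ρ = (pairing ρ Z' : ℂ) • Z := by
      change (Z' * ρ).trace • Z = _
      rw [trace_mul_eq_pairing sZ'.1.1 hρ.1.1, pairing_comm]
    rw [this]
    abel
  rw [hΔ, Matrix.mul_add, Matrix.mul_smul, Matrix.mul_smul, Matrix.trace_add, Matrix.trace_smul,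
    Matrix.trace_smul]
  refine (norm_add_le _ _).trans ?_
  rw [norm_smul, norm_smul]
  have e1 : ‖(pairing ρ W : ℂ)‖ ≤ 1 := by
    rw [← trace_mul_eq_pairing hρ.1.1 sW.1.1]
    exact sW.norm_trace_mul_le_one hρ.isContraction
  have e2 : ‖((pairing ρ (W - Z') : ℝ) : ℂ)‖ ≤ 2 * cnum ψ := by
    rw [← trace_mul_eq_pairing hρ.1.1 (sW.1.1.sub sZ'.1.1)]
    refine (norm_trace_mul_sub_le sW sZ' hρ.isContraction).trans ?_
    rw [← cnum_adj hD h, hWproj]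
    linarith [dist_le_cnum h.adj (isState_maxMixed hD) hB]
  have e3 : ‖(V * (proj ψ ρ - Z)).trace‖ ≤ 2 * cnum ψ :=
    (norm_trace_mul_sub_le (h.isState_proj hρ) sZ hV).trans
      (by linarith [dist_le_cnum h hρ hA])
  have e4 : ‖(V * Z).trace‖ ≤ 1 := sZ.norm_trace_mul_le_one hV
  have m1 := mul_le_mul e1 e3 (norm_nonneg _) zero_le_one
  have m2 := mul_le_mul e2 e4 (norm_nonneg _) (by positivity)
  linarith

/-! ### Topology of the set of states -/

theorem continuous_pairing_left {D : ℕ} (B : Mat D) : Continuous fun A : Mat D => pairing A B :=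
  Complex.continuous_re.comp (continuous_id.matrix_mul continuous_const).matrix_trace

/-- Semidefiniteness is an intersection of closed half-spaces given by pairings with states. -/
theorem isClosed_setOf_isState (D : ℕ) : IsClosed {ρ : Mat D | IsState ρ} := by
  have : {ρ : Mat D | IsState ρ} = ({ρ | ρᴴ = ρ} ∩
      ⋂ σ : Mat D, ⋂ _ : IsState σ, {ρ | 0 ≤ pairing ρ σ}) ∩ {ρ | ρ.trace = 1} := by
    ext ρ
    simp only [Set.mem_ofPred_eq, Set.mem_inter_iff, Set.mem_iInter]
    constructor
    · exact fun h => ⟨⟨h.1.1, fun σ hσ => pairing_nonneg h.1 hσ.1⟩, h.2⟩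
    · exact fun h => ⟨posSemidef_of_pairing h.1.1 h.1.2, h.2⟩
  rw [this]
  refine IsClosed.inter (IsClosed.inter ?_ ?_) ?_
  · exact isClosed_eq continuous_id.matrix_conjTranspose continuous_id
  · exact isClosed_iInter fun σ => isClosed_iInter fun _ =>
      isClosed_le continuous_const (continuous_pairing_left σ)
  · exact isClosed_eq continuous_id.matrix_trace continuous_const

theorem isCompact_setOf_isState (D : ℕ) : IsCompact {ρ : Mat D | IsState ρ} := by
  have h : IsCompact (Set.univ.pi fun _ : Fin D => Set.univ.pi fun _ : Fin D =>
      Metric.closedBall (0 : ℂ) 1) :=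
    isCompact_univ_pi fun _ => isCompact_univ_pi fun _ => isCompact_closedBall 0 1
  refine IsCompact.of_isClosed_subset (X := Mat D) h (isClosed_setOf_isState D) ?_
  intro ρ hρ i _ j _
  rw [mem_closedBall_zero_iff]
  exact IsState.norm_entry_le_one hρ i j

theorem continuous_superOp {D : ℕ} (ψ : SuperOp D) : Continuous ψ :=
  LinearMap.continuous_of_finiteDimensional ψ

theorem Regular.continuousAt_proj {D : ℕ} {ψ : SuperOp D} (h : Regular ψ) {A : Mat D}
    (hA : IsState A) : ContinuousAt (proj ψ) A := by
  have h1 : ContinuousAt (fun ρ => (ψ ρ).trace) A :=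
    (continuous_superOp ψ).matrix_trace.continuousAt
  have h2 : (ψ A).trace ≠ 0 := by
    rw [ne_eq, (h.pos A hA.1).trace_eq_zero_iff]
    exact h.ne_zero A hA
  exact (h1.inv₀ h2).smul (continuous_superOp ψ).continuousAt

theorem one_sub_div_one_add_involutive {q : ℝ} (hq : 0 ≤ q) :
    (1 - (1 - q) / (1 + q)) / (1 + (1 - q) / (1 + q)) = q := by
  have : 1 + q ≠ 0 := by positivity
  have h2 : 1 + (1 - q) / (1 + q) ≠ 0 := by
    rw [one_add_div this, show 1 + q + (1 - q) = 2 by ring]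
    positivity
  rw [div_eq_iff h2]
  field_simp
  ring

/-- Uniform two-sided bounds on the matrix elements of a map bound its contraction coefficient
away from one. -/
theorem cnum_lt_one_of_bounds {D : ℕ} (hD : 1 ≤ D) {ψ : SuperOp D} (h : Regular ψ) {δ M : ℝ}
    (hδ : 0 < δ) (hl : ∀ ρ X, IsState ρ → IsState X → δ ≤ pairing (ψ ρ) X)
    (hu : ∀ ρ X, IsState ρ → IsState X → pairing (ψ ρ) X ≤ M) : cnum ψ < 1 := by
  have hM : 0 < M := hδ.trans_le ((hl _ _ (isState_maxMixed hD) (isState_maxMixed hD)).trans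
    (hu _ _ (isState_maxMixed hD) (isState_maxMixed hD)))
  -- Every cross ratio is at least δ²/M²; the cap at 1 keeps (1 - q)/(1 + q) nonnegative.
  obtain ⟨q, hq⟩ : ∃ q, q = min 1 (δ ^ 2 / M ^ 2) := ⟨_, rfl⟩
  have q0 : 0 < q := by rw [hq]; positivity
  have q1 : q ≤ 1 := by rw [hq]; exact min_le_left _ _
  have q2 : q * (M * M) ≤ δ * δ := by
    rw [← pow_two, ← pow_two, ← le_div_iff₀ (by positivity), hq]
    exact min_le_right _ _
  have hy : cnum ψ ≤ (1 - q) / (1 + q) := by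
    rw [cnum_le_iff hD h (div_nonneg (by linarith) (by linarith))]
    intro ρ σ X Y hρ hσ hX hY
    rw [one_sub_div_one_add_involutive q0.le]
    calc q * (pairing (ψ σ) X * pairing (ψ ρ) Y) ≤ q * (M * M) :=
          mul_le_mul_of_nonneg_left (mul_le_mul (hu σ X hσ hX) (hu ρ Y hρ hY)
            (pairing_nonneg (h.pos _ hρ.1) hY.1) hM.le) q0.le
      _ ≤ δ * δ := q2
      _ ≤ _ := mul_le_mul (hl ρ X hρ hX) (hl σ Y hσ hY) hδ.le
          (hδ.le.trans (hl ρ X hρ hX))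
  refine hy.trans_lt ?_
  rw [div_lt_one (by linarith)]
  linarith

theorem continuous_pairing_map {D : ℕ} (ψ : SuperOp D) :
    Continuous fun p : Mat D × Mat D => pairing (ψ p.1) p.2 :=
  Complex.continuous_re.comp
    ((((continuous_superOp ψ).comp continuous_fst).matrix_mul continuous_snd).matrix_trace)

/-- Compactness of the state space. The minimum is recorded with its minimiser, at which strict
positivity can then be invoked. -/
theorem exists_pairing_bounds {D : ℕ} (hD : 1 ≤ D) (ψ : SuperOp D) :
    (∃ ρ X, IsState ρ ∧ IsState X ∧
      ∀ σ Y, IsState σ → IsState Y → pairing (ψ ρ) X ≤ pairing (ψ σ) Y) ∧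
    ∃ M, ∀ σ Y, IsState σ → IsState Y → pairing (ψ σ) Y ≤ M := by
  have hKc := (isCompact_setOf_isState D).prod (isCompact_setOf_isState D)
  have hKn : ({ρ : Mat D | IsState ρ} ×ˢ {ρ : Mat D | IsState ρ}).Nonempty :=
    ⟨(_, _), isState_maxMixed hD, isState_maxMixed hD⟩
  obtain ⟨⟨ρ, X⟩, ⟨hρ, hX⟩, hmin⟩ :=
    hKc.exists_isMinOn hKn (continuous_pairing_map ψ).continuousOn
  obtain ⟨b, -, hmax⟩ := hKc.exists_isMaxOn hKn (continuous_pairing_map ψ).continuousOn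
  exact ⟨⟨ρ, X, hρ, hX, fun σ Y hσ hY => isMinOn_iff.1 hmin (σ, Y) ⟨hσ, hY⟩⟩,
    ⟨pairing (ψ b.1) b.2, fun σ Y hσ hY => isMaxOn_iff.1 hmax (σ, Y) ⟨hσ, hY⟩⟩⟩

theorem cnum_lt_one {D : ℕ} (hD : 1 ≤ D) {ψ : SuperOp D} (h : Regular ψ)
    (hs : IsStrictlyPositive ψ) : cnum ψ < 1 := by
  obtain ⟨⟨ρ, X, hρ, hX, hl⟩, M, hu⟩ := exists_pairing_bounds hD ψ
  exact cnum_lt_one_of_bounds hD h (pairing_pos (hs ρ hρ.1 hρ.ne_zero) hX.1 hX.ne_zero) hl hu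

/-- The image of the maximally mixed state is definite, and c(ψ) < 1 makes every other image
dominate a positive multiple of it. -/
theorem isInteriorState_proj {D : ℕ} (hD : 1 ≤ D) {ψ : SuperOp D} (h : Regular ψ)
    (hc : cnum ψ < 1) {ρ : Mat D} (hρ : IsState ρ) : IsInteriorState (proj ψ ρ) := by
  have sI := isState_maxMixed hD
  set σ := (D : ℂ)⁻¹ • (1 : Mat D)
  have sρ := h.isState_proj hρ
  have sσ := h.isState_proj sI
  have c0 := cnum_nonneg hD h
  have h1 := (dist_le_iff sρ sσ c0).1 (dist_le_cnum h hρ sI)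
  have h2 : 0 < (1 - cnum ψ) / (1 + cnum ψ) := div_pos (by linarith) (by linarith)
  have h3 : 0 < mconst (proj ψ ρ) (proj ψ σ) :=
    pos_of_mul_pos_left (h2.trans_le h1) (mconst_nonneg sσ.1 sρ)
  have hσd : (proj ψ σ).PosDef := by
    have h4 : (ψ σ).PosDef := by
      apply h.map_posDef
      apply Matrix.PosDef.one.smul
      rw [← Complex.ofReal_natCast, ← Complex.ofReal_inv]
      exact Complex.zero_lt_real.2 (inv_pos.2 (by exact_mod_cast hD))
    refine posDef_of_pairing sσ.1.1 fun τ hτ => ?_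
    rw [proj_eq_normalize, normalize_eq h4.posSemidef, pairing_smul_left]
    exact mul_pos (inv_pos.2 (trace_re_pos h4.posSemidef (h.ne_zero _ sI)))
      (pairing_pos h4 hτ.1 hτ.ne_zero)
  refine ⟨posDef_of_pairing sρ.1.1 fun τ hτ => ?_, sρ.2⟩
  exact (mul_pos h3 (pairing_pos hσd hτ.1 hτ.ne_zero)).trans_le (mconst_mul_pairing_le sρ.1 sσ hτ)

/-- Entrywise Cauchy nets of matrices converge. -/
theorem exists_tendsto_of_entry {D : ℕ} {ι : Type*} {l : Filter ι} [l.NeBot] {f : ι → Mat D}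
    (hf : ∀ ε > 0, ∃ S ∈ l, ∀ i ∈ S, ∀ j ∈ S, ∀ a b, ‖f i a b - f j a b‖ < ε) :
    ∃ L, Tendsto f l (𝓝 L) := by
  have h : ∀ a b, ∃ z, Tendsto (fun i => f i a b) l (𝓝 z) := by
    intro a b
    apply CompleteSpace.complete
    rw [Metric.cauchy_iff]
    refine ⟨inferInstance, fun ε hε => ?_⟩
    obtain ⟨S, hS, h⟩ := hf ε hε
    refine ⟨_, image_mem_map hS, ?_⟩
    rintro _ ⟨i, hi, rfl⟩ _ ⟨j, hj, rfl⟩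
    rw [dist_eq_norm]
    exact h i hi j hj a b
  choose z hz using h
  exact ⟨Matrix.of z, tendsto_pi_nhds.2 fun a => tendsto_pi_nhds.2 fun b => hz a b⟩

theorem tendsto_of_dist {D : ℕ} {ι : Type*} {l : Filter ι} {f : ι → Mat D} {L : Mat D}
    (hf : ∀ᶠ i in l, IsState (f i)) (hL : IsState L) {e : ι → ℝ} (he : Tendsto e l (𝓝 0))
    (h : ∀ᶠ i in l, dist (f i) L ≤ e i) : Tendsto f l (𝓝 L) := by
  refine tendsto_pi_nhds.2 fun a => tendsto_pi_nhds.2 fun b => ?_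
  rw [tendsto_iff_norm_sub_tendsto_zero]
  refine squeeze_zero' (Eventually.of_forall fun _ => norm_nonneg _) ?_
    (by simpa using he.const_mul 2)
  filter_upwards [hf, h] with i h1 h2
  exact (norm_entry_sub_le h1 hL a b).trans (by linarith)


/-! ### Perron–Frobenius eigenmatrices -/

theorem isState_of_tendsto {D : ℕ} {ι : Type*} {l : Filter ι} [l.NeBot] {f : ι → Mat D}
    {L : Mat D} (h : Tendsto f l (𝓝 L)) (hf : ∀ᶠ i in l, IsState (f i)) : IsState L :=
  (isClosed_setOf_isState D).mem_of_tendsto h hf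

theorem Regular.isState_iterate {D : ℕ} {ψ : SuperOp D} (h : Regular ψ) {A : Mat D}
    (hA : IsState A) (n : ℕ) : IsState ((proj ψ)^[n] A) := by
  induction n with
  | zero => exact hA
  | succ n ih => rw [Function.iterate_succ_apply']; exact h.isState_proj ih

theorem dist_iterate_le {D : ℕ} (hD : 1 ≤ D) {ψ : SuperOp D} (h : Regular ψ) {A B : Mat D}
    (hA : IsState A) (hB : IsState B) (n : ℕ) :
    dist ((proj ψ)^[n] A) ((proj ψ)^[n] B) ≤ cnum ψ ^ n := by
  induction n with
  | zero => simpa using dist_le_one hA hB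
  | succ n ih =>
    rw [Function.iterate_succ_apply', Function.iterate_succ_apply', pow_succ']
    exact (dist_proj_le h (h.isState_iterate hA n) (h.isState_iterate hB n)).trans
      (mul_le_mul_of_nonneg_left ih (cnum_nonneg hD h))

/-- Banach iteration: the iterates of one state are entrywise Cauchy at rate c(ψ)^n, and continuity
of the projective action fixes their limit. -/
theorem exists_proj_eq_self {D : ℕ} (hD : 1 ≤ D) {ψ : SuperOp D} (h : Regular ψ)
    (hc : cnum ψ < 1) : ∃ R, IsState R ∧ proj ψ R = R := by
  have c0 := cnum_nonneg hD h
  have sI := isState_maxMixed hD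
  set x : ℕ → Mat D := fun n => (proj ψ)^[n] ((D : ℂ)⁻¹ • (1 : Mat D)) with hx
  have hpow : Tendsto (fun n => 2 * cnum ψ ^ n) atTop (𝓝 0) := by
    simpa using (tendsto_pow_atTop_nhds_zero_of_lt_one c0 hc).const_mul 2
  obtain ⟨R, hR⟩ : ∃ R, Tendsto x atTop (𝓝 R) := by
    refine exists_tendsto_of_entry fun ε hε => ?_
    obtain ⟨n, hn⟩ := (hpow.eventually_lt_const hε).exists
    refine ⟨Set.Ici n, Ici_mem_atTop n, fun i hi j hj a b => lt_of_le_of_lt ?_ hn⟩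
    have key : ∀ i ∈ Set.Ici n, x i = (proj ψ)^[n] (x (i - n)) := by
      intro i hi
      simp only [hx]
      rw [← Function.iterate_add_apply, Nat.add_sub_cancel' hi]
    refine (norm_entry_sub_le (h.isState_iterate sI i) (h.isState_iterate sI j) a b).trans ?_
    refine mul_le_mul_of_nonneg_left ?_ two_pos.le
    have := dist_iterate_le hD h (h.isState_iterate sI (i - n)) (h.isState_iterate sI (j - n)) n
    rwa [← key i hi, ← key j hj] at this
  have sR : IsState R := isState_of_tendsto hR (Eventually.of_forall (h.isState_iterate sI))
  refine ⟨R, sR, ?_⟩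
  have h1 : Tendsto (fun n => x (n + 1)) atTop (𝓝 R) := (tendsto_add_atTop_iff_nat 1).2 hR
  have h2 : Tendsto (fun n => proj ψ (x n)) atTop (𝓝 (proj ψ R)) :=
    (h.continuousAt_proj sR).tendsto.comp hR
  refine tendsto_nhds_unique h2 ?_
  simpa only [hx, Function.iterate_succ_apply'] using h1

theorem map_eq_of_proj_eq_self {D : ℕ} {ψ : SuperOp D} (h : Regular ψ) {R : Mat D}
    (hR : IsState R) (he : proj ψ R = R) : ∃ r : ℝ, 0 < r ∧ ψ R = (r : ℂ) • R := by
  have pR := h.pos R hR.1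
  have ht := trace_re_pos pR (h.ne_zero R hR)
  refine ⟨(ψ R).trace.re, ht, ?_⟩
  have h1 : ψ R = ((ψ R).trace.re : ℂ) • proj ψ R := by
    rw [proj_eq_normalize, normalize_eq pR, smul_smul, ← Complex.ofReal_mul,
      mul_inv_cancel₀ ht.ne', Complex.ofReal_one, one_smul]
  rwa [he] at h1

theorem proj_eq_self_of_map_eq {D : ℕ} {ψ : SuperOp D} {R : Mat D} (hR : IsState R) {r : ℝ}
    (hr : r ≠ 0) (he : ψ R = (r : ℂ) • R) : proj ψ R = R := by
  rw [proj_eq_normalize, he, normalize_smul (by exact_mod_cast hr), normalize_of_isState hR]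

theorem norm_trace_mul_le_trace {D : ℕ} {A V : Mat D} (hA : A.PosSemidef)
    (hV : IsContraction V) : ‖(V * A).trace‖ ≤ A.trace.re := by
  rcases eq_or_ne A 0 with rfl | h0
  · simp
  have h := (isState_normalize hA h0).norm_trace_mul_le_one hV
  have ht := trace_re_pos hA h0
  rw [normalize_eq hA, Matrix.mul_smul, Matrix.trace_smul, norm_smul, Complex.norm_real,
    Real.norm_eq_abs, abs_of_pos (inv_pos.2 ht), inv_mul_le_iff₀ ht, mul_one] at h
  exact h

theorem exists_smul_sub_posSemidef {D : ℕ} (hD : 1 ≤ D) {R : Mat D} (hR : R.PosDef) :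
    ∃ C : ℝ, ∀ ρ, IsState ρ → ((C : ℂ) • R - ρ).PosSemidef := by
  -- This rank-one map sends every state to R, so the general compactness statement gives the
  -- minimum of tr(RX) over states X; its inverse serves as C.
  obtain ⟨⟨ρ₀, X, hρ₀, hX, hmin⟩, -⟩ := exists_pairing_bounds hD (rankOne 1 R)
  have hmap : ∀ ρ, IsState ρ → rankOne 1 R ρ = R := by
    intro ρ hρ
    change ((1 : Mat D) * ρ).trace • R = R
    rw [Matrix.one_mul, hρ.2, one_smul]
  have hp := pairing_pos hR hX.1 hX.ne_zero
  refine ⟨(pairing R X)⁻¹, fun ρ hρ => posSemidef_of_pairing ?_ fun σ hσ => ?_⟩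
  · refine Matrix.IsHermitian.sub ?_ hρ.1.1
    rw [Matrix.IsHermitian, Matrix.conjTranspose_smul, hR.1.eq]
    simp
  · have h1 := hmin ρ σ hρ hσ
    rw [hmap ρ hρ, hmap ρ₀ hρ₀] at h1
    have h2 : pairing ρ σ ≤ 1 :=
      (Complex.re_le_norm _).trans (hσ.norm_trace_mul_le_one hρ.isContraction)
    rw [pairing_sub_left, pairing_smul_left]
    have h3 : 1 ≤ (pairing R X)⁻¹ * pairing R σ := by
      rw [inv_mul_eq_div, le_div_iff₀ hp, one_mul]
      exact h1
    linarith

/-- A definite eigenmatrix dominates all states, ρ ≤ CR, so tr ψ^n(ρ) ≤ C r^n tr R. Hence ψ^n X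
grows at most like r^n in trace norm, whereas an eigenvector X grows like |k|^n. -/
theorem norm_eigenvalue_le {D : ℕ} (hD : 1 ≤ D) {ψ : SuperOp D} (h : IsPositive ψ) {R : Mat D}
    (hR : R.PosDef) {r : ℝ} (hr : 0 < r) (he : ψ R = (r : ℂ) • R) {k : ℂ} {X : Mat D}
    (hX : X ≠ 0) (hk : ψ X = k • X) : ‖k‖ ≤ r := by
  obtain ⟨C, hC⟩ := exists_smul_sub_posSemidef hD hR
  have hpos : ∀ n : ℕ, IsPositive (ψ ^ n) := by
    intro n
    induction n with
    | zero => intro A hA; simpa using hA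
    | succ n ih => intro A hA; rw [pow_succ']; exact h _ (ih A hA)
  have hpow : ∀ (n : ℕ) (c : ℂ) (A : Mat D), ψ A = c • A → (ψ ^ n) A = c ^ n • A := by
    intro n c A hA
    induction n with
    | zero => simp
    | succ n ih => rw [pow_succ', Module.End.mul_apply, ih, map_smul, hA, smul_smul, pow_succ]
  have hbound : ∀ n : ℕ, traceNorm ((ψ ^ n) X) ≤ 2 * (C * r ^ n * R.trace.re) * traceNorm X := by
    intro n
    have htr : ∀ ρ, IsState ρ → ((ψ ^ n) ρ).trace.re ≤ C * r ^ n * R.trace.re := by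
      intro ρ hρ
      have h1 := (Complex.le_def.1 (hpos n _ (hC ρ hρ)).trace_nonneg).1
      rw [map_sub, map_smul, hpow n r R he, Matrix.trace_sub, smul_smul, ← Complex.ofReal_pow,
        ← Complex.ofReal_mul, Matrix.trace_smul, smul_eq_mul, Complex.sub_re,
        Complex.re_ofReal_mul, Complex.zero_re] at h1
      linarith
    refine traceNorm_map_le (ψ ^ n) ?_ (fun V ρ hV hρ => ?_) X
    · have h2 := isState_maxMixed hD
      exact (Complex.le_def.1 (hpos n _ h2.1).trace_nonneg).1.trans (htr _ h2)
    · exact (norm_trace_mul_le_trace (hpos n ρ hρ.1) hV).trans (htr ρ hρ)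
  obtain ⟨i, j, hij⟩ : ∃ i j, X i j ≠ 0 := by
    by_contra! hz
    exact hX (by ext i j; exact hz i j)
  have hlow : ∀ n : ℕ, ‖k‖ ^ n * ‖X i j‖ ≤ (2 * C * R.trace.re * traceNorm X) * r ^ n := by
    intro n
    have h1 := (norm_trace_mul_le_traceNorm (isContraction_single j i) ((ψ ^ n) X)).trans (hbound n)
    rw [Matrix.trace_single_mul, one_smul, hpow n k X hk, Matrix.smul_apply, norm_smul,
      norm_pow] at h1
    linarith
  by_contra! hlt
  have h1 : 1 < ‖k‖ / r := by rwa [one_lt_div hr]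
  have h2 := (tendsto_pow_atTop_atTop_of_one_lt h1).eventually_gt_atTop
    ((2 * C * R.trace.re * traceNorm X) / ‖X i j‖)
  obtain ⟨n, hn⟩ := h2.exists
  have hxp : 0 < ‖X i j‖ := norm_pos_iff.2 hij
  rw [div_pow, div_lt_div_iff₀ hxp (by positivity)] at hn
  linarith [hlow n]

theorem specRad_eq {D : ℕ} (hD : 1 ≤ D) {ψ : SuperOp D} (h : IsPositive ψ) {R : Mat D}
    (hR : R.PosDef) {r : ℝ} (hr : 0 < r) (he : ψ R = (r : ℂ) • R) : specRad ψ = r := by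
  have hR0 : R ≠ 0 := by
    rintro rfl
    have : Nonempty (Fin D) := ⟨⟨0, hD⟩⟩
    simpa using hR.trace_pos
  have key : spectralRadius ℂ (ψ : Module.End ℂ (Mat D)) = ENNReal.ofReal r := by
    rw [spectralRadius]
    refine le_antisymm (iSup₂_le fun k hk => ?_) ?_
    · obtain ⟨X, hX⟩ := (Module.End.hasEigenvalue_iff_mem_spectrum.2 hk).exists_hasEigenvector
      have := norm_eigenvalue_le hD h hR hr he hX.2 hX.apply_eq_smul
      rw [ENNReal.ofReal, ENNReal.coe_le_coe]
      exact NNReal.le_toNNReal_of_coe_le this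
    · have hmem : (r : ℂ) ∈ spectrum ℂ (ψ : Module.End ℂ (Mat D)) := by
        rw [← Module.End.hasEigenvalue_iff_mem_spectrum]
        exact Module.End.hasEigenvalue_of_hasEigenvector
          ⟨Module.End.mem_eigenspace_iff.2 he, hR0⟩
      refine le_trans ?_ (le_iSup₂ (f := fun k (_ : k ∈ spectrum ℂ (ψ : Module.End ℂ (Mat D))) =>
        ((‖k‖₊ : NNReal) : ENNReal)) (r : ℂ) hmem)
      rw [ENNReal.ofReal, ENNReal.coe_le_coe]
      apply Real.toNNReal_le_iff_le_coe.2
      simpa using le_abs_self r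
  rw [specRad, key, ENNReal.toReal_ofReal hr.le]

theorem exists_perronFrobenius {D : ℕ} (hD : 1 ≤ D) {ψ : SuperOp D} (h : Regular ψ)
    (hc : cnum ψ < 1) :
    0 < specRad ψ ∧ ∃ R, IsInteriorState R ∧ ψ R = (specRad ψ : ℂ) • R := by
  obtain ⟨R, hR, he⟩ := exists_proj_eq_self hD h hc
  obtain ⟨r, hr, her⟩ := map_eq_of_proj_eq_self h hR he
  have iR : IsInteriorState R := he ▸ isInteriorState_proj hD h hc hR
  have hs := specRad_eq hD h.pos iR.1 hr her
  exact ⟨hs ▸ hr, R, iR, hs ▸ her⟩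

/-- Evaluate tr(ψ(R) L) = tr(R ψ*(L)) at both eigenmatrices and cancel tr(RL) > 0. -/
theorem specRad_adj {D : ℕ} (hD : 1 ≤ D) {ψ : SuperOp D} (h : Regular ψ) (hc : cnum ψ < 1) :
    specRad (adj ψ) = specRad ψ := by
  obtain ⟨-, R, iR, hR⟩ := exists_perronFrobenius hD h hc
  obtain ⟨-, L, iL, hL⟩ := exists_perronFrobenius hD h.adj (by rwa [cnum_adj hD h])
  have h1 := pairing_map h.pos (A := L) iR.1.posSemidef
  rw [hR, hL, pairing_smul_left, pairing_smul_right] at h1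
  exact (mul_right_cancel₀ (pairing_pos iR.1 iL.1.posSemidef iL.isState.ne_zero).ne' h1).symm

theorem isState_rightPF {D : ℕ} (hD : 1 ≤ D) {ψ : SuperOp D} (h : Regular ψ)
    (hc : cnum ψ < 1) : IsState (rightPF ψ) ∧ proj ψ (rightPF ψ) = rightPF ψ := by
  obtain ⟨hs, R, iR, hR⟩ := exists_perronFrobenius hD h hc
  have hex : cnum ψ < 1 ∧ ∃ R : Mat D, IsState R ∧ ψ R = (specRad ψ : ℂ) • R :=
    ⟨hc, R, iR.isState, hR⟩
  rw [rightPF, dif_pos hex]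
  exact ⟨hex.2.choose_spec.1, proj_eq_self_of_map_eq hex.2.choose_spec.1 hs.ne'
    hex.2.choose_spec.2⟩

open Classical in
/-- A state `R` with `χ R = r R` if `c < 1` and there is one, the maximally mixed state
otherwise. -/
noncomputable def eigenstate {D : ℕ} (c r : ℝ) (χ : SuperOp D) : Mat D :=
  if h : c < 1 ∧ ∃ R : Mat D, IsState R ∧ χ R = (r : ℂ) • R
  then h.2.choose else (D : ℂ)⁻¹ • (1 : Mat D)

/-- With c and the spectral radius as free parameters they can be rewritten despite the choice
inside; this identifies left eigenmatrices of ψ with right ones of ψ*. -/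
theorem rightPF_eq_eigenstate {D : ℕ} (ψ : SuperOp D) :
    rightPF ψ = eigenstate (cnum ψ) (specRad ψ) ψ := rfl

theorem leftPF_eq_eigenstate {D : ℕ} (ψ : SuperOp D) :
    leftPF ψ = eigenstate (cnum ψ) (specRad ψ) (adj ψ) := rfl

theorem leftPF_eq_rightPF_adj {D : ℕ} (hD : 1 ≤ D) {ψ : SuperOp D} (h : Regular ψ) :
    leftPF ψ = rightPF (adj ψ) := by
  rw [rightPF_eq_eigenstate, leftPF_eq_eigenstate, cnum_adj hD h]
  by_cases hc : cnum ψ < 1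
  · rw [specRad_adj hD h hc]
  · rw [eigenstate, eigenstate, dif_neg fun hh => hc hh.1, dif_neg fun hh => hc hh.1]

/-! ### Propagators with vanishing contraction coefficients -/

/-- A propagator of regular positive maps. -/
structure IsPropagator {D : ℕ} (F : ℝ → ℝ → SuperOp D) : Prop where
  regular : ∀ s t, s < t → Regular (F s t)
  comp : ∀ r s t, r < s → s < t → F s t ∘ₗ F r s = F r t

/-- Taking adjoints reverses composition and negating times reverses it again; future limits thereby
become past limits. -/
theorem IsPropagator.reverse {D : ℕ} {F : ℝ → ℝ → SuperOp D} (h : IsPropagator F) :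
    IsPropagator fun s t => adj (F (-t) (-s)) where
  regular s t hst := (h.regular _ _ (by linarith)).adj
  comp r s t hrs hst := by
    rw [← adj_comp, h.comp _ _ _ (by linarith) (by linarith)]

theorem IsPropagator.proj_proj {D : ℕ} {F : ℝ → ℝ → SuperOp D} (h : IsPropagator F) {r s t : ℝ}
    (hrs : r < s) (hst : s < t) {ρ : Mat D} (hρ : IsState ρ) :
    proj (F s t) (proj (F r s) ρ) = proj (F r t) ρ := by
  rw [← h.comp r s t hrs hst, (h.regular r s hrs).proj_comp hρ]

theorem IsPropagator.cnum_le_mul {D : ℕ} (hD : 1 ≤ D) {F : ℝ → ℝ → SuperOp D}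
    (h : IsPropagator F) {r s t : ℝ} (hrs : r < s) (hst : s < t) :
    cnum (F r t) ≤ cnum (F s t) * cnum (F r s) := by
  rw [← h.comp r s t hrs hst]
  exact cnum_comp_le hD (h.regular s t hst) (h.regular r s hrs)

theorem IsPropagator.cnum_anti {D : ℕ} (hD : 1 ≤ D) {F : ℝ → ℝ → SuperOp D}
    (h : IsPropagator F) {r s t u : ℝ} (hrs : r ≤ s) (hst : s < t) (htu : t ≤ u) :
    cnum (F r u) ≤ cnum (F s t) := by
  have h1 : cnum (F r t) ≤ cnum (F s t) := by
    rcases hrs.eq_or_lt with rfl | hrs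
    · exact le_rfl
    · refine (h.cnum_le_mul hD hrs hst).trans (mul_le_of_le_one_right
        (cnum_nonneg hD (h.regular s t hst)) (cnum_le_one hD (h.regular r s hrs)))
  refine le_trans ?_ h1
  rcases htu.eq_or_lt with rfl | htu
  · exact le_rfl
  · have hrt := hrs.trans_lt hst
    exact (h.cnum_le_mul hD hrt htu).trans (mul_le_of_le_one_left
        (cnum_nonneg hD (h.regular r t hrt)) (cnum_le_one hD (h.regular t u htu)))

/-- If the contraction coefficients vanish in the remote past, all initial states and all right
Perron–Frobenius eigenmatrices converge to the same interior states. -/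
theorem IsPropagator.exists_pastLimit {D : ℕ} (hD : 1 ≤ D) {F : ℝ → ℝ → SuperOp D}
    (h : IsPropagator F) (hc : ∀ t, Tendsto (fun s => cnum (F s t)) atBot (𝓝 0)) :
    ∃ Z : ℝ → Mat D, (∀ t, IsInteriorState (Z t)) ∧
      (∀ s t, s < t → proj (F s t) (Z s) = Z t) ∧
      (∀ t ρ, IsState ρ → Tendsto (fun s => proj (F s t) ρ) atBot (𝓝 (Z t))) ∧
      ∀ t, Tendsto (fun s => rightPF (F s t)) atBot (𝓝 (Z t)) := by
  have sI := isState_maxMixed hD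
  set I := (D : ℂ)⁻¹ • (1 : Mat D)
  have hex : ∀ t, ∃ Z, Tendsto (fun s => proj (F s t) I) atBot (𝓝 Z) := by
    intro t
    refine exists_tendsto_of_entry fun ε hε => ?_
    obtain ⟨s, hs, hst⟩ := (((hc t).eventually_lt_const (half_pos hε)).and
      (eventually_lt_atBot t)).exists
    have hreg := h.regular s t hst
    refine ⟨Set.Iio s, Iio_mem_atBot s, fun i hi j hj a b => ?_⟩
    have si := (h.regular i s hi).isState_proj sI
    have sj := (h.regular j s hj).isState_proj sI
    rw [← h.proj_proj hi hst sI, ← h.proj_proj hj hst sI]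
    refine (norm_entry_sub_le (hreg.isState_proj si) (hreg.isState_proj sj) a b).trans_lt ?_
    linarith [dist_le_cnum hreg si sj]
  choose Z hZ using hex
  have sZ : ∀ t, IsState (Z t) := fun t => isState_of_tendsto (hZ t) (by
    filter_upwards [eventually_lt_atBot t] with s hs
    exact (h.regular s t hs).isState_proj sI)
  have hcov : ∀ s t, s < t → proj (F s t) (Z s) = Z t := by
    intro s t hst
    have h1 : Tendsto (fun r => proj (F s t) (proj (F r s) I)) atBot (𝓝 (proj (F s t) (Z s))) :=
      ((h.regular s t hst).continuousAt_proj (sZ s)).tendsto.comp (hZ s)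
    refine tendsto_nhds_unique h1 ((hZ t).congr' ?_)
    filter_upwards [eventually_lt_atBot s] with r hr
    rw [h.proj_proj hr hst sI]
  refine ⟨Z, fun t => ?_, hcov, fun t ρ hρ => ?_, fun t => ?_⟩
  · obtain ⟨s, hs, hst⟩ := (((hc t).eventually_lt_const one_pos).and
      (eventually_lt_atBot t)).exists
    rw [← hcov s t hst]
    exact isInteriorState_proj hD (h.regular s t hst) hs (sZ s)
  · refine tendsto_of_dist ?_ (sZ t) (hc t) ?_
    · filter_upwards [eventually_lt_atBot t] with s hs
      exact (h.regular s t hs).isState_proj hρ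
    · filter_upwards [eventually_lt_atBot t] with s hs
      rw [← hcov s t hs]
      exact dist_le_cnum (h.regular s t hs) hρ (sZ s)
  · refine tendsto_of_dist ?_ (sZ t) (hc t) ?_
    · filter_upwards [eventually_lt_atBot t, (hc t).eventually_lt_const one_pos] with s hs h1
      exact (isState_rightPF hD (h.regular s t hs) h1).1
    · filter_upwards [eventually_lt_atBot t, (hc t).eventually_lt_const one_pos] with s hs h1
      -- Any eigenstate is fixed by the projective action, so it and Z t are both images under F s
      -- t; uniqueness of the eigenstate is not needed.
      obtain ⟨h2, h3⟩ := isState_rightPF hD (h.regular s t hs) h1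
      rw [← hcov s t hs]
      conv_lhs => rw [← h3]
      exact dist_le_cnum (h.regular s t hs) h2 (sZ s)

theorem IsPropagator.exists_futureLimit {D : ℕ} (hD : 1 ≤ D) {F : ℝ → ℝ → SuperOp D}
    (h : IsPropagator F) (hc : ∀ s, Tendsto (fun t => cnum (F s t)) atTop (𝓝 0)) :
    ∃ Z : ℝ → Mat D, (∀ s, IsInteriorState (Z s)) ∧
      (∀ s t, s < t → proj (adj (F s t)) (Z t) = Z s) ∧
      (∀ s ρ, IsState ρ → Tendsto (fun t => proj (adj (F s t)) ρ) atTop (𝓝 (Z s))) ∧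
      ∀ s, Tendsto (fun t => leftPF (F s t)) atTop (𝓝 (Z s)) := by
  obtain ⟨Z, h1, h2, h3, h4⟩ := h.reverse.exists_pastLimit hD (by
    intro t
    have := (hc (-t)).comp tendsto_neg_atBot_atTop
    refine this.congr' ?_
    filter_upwards [eventually_lt_atBot t] with s hs
    rw [cnum_adj hD (h.regular _ _ (by linarith))]
    rfl)
  refine ⟨fun s => Z (-s), fun s => h1 _, fun s t hst => ?_, fun s ρ hρ => ?_, fun s => ?_⟩
  · simpa using h2 (-t) (-s) (by linarith)
  · simpa [Function.comp_def] using (h3 (-s) ρ hρ).comp tendsto_neg_atTop_atBot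
  · refine ((h4 (-s)).comp tendsto_neg_atTop_atBot).congr' ?_
    filter_upwards [eventually_gt_atTop s] with t ht
    rw [leftPF_eq_rightPF_adj hD (h.regular s t ht)]
    simp


/-! ### The subadditive ergodic theorem for bounded processes -/

/-- A superadditive process over `T` with `0 ≤ h n ≤ K n`. -/
structure IsSuperadditive {Ω : Type*} [MeasurableSpace Ω] (μ : Measure Ω) (T : Ω → Ω) (K : ℝ)
    (h : ℕ → Ω → ℝ) : Prop where
  measurePreserving : MeasurePreserving T μ μ
  measurable : ∀ n, Measurable (h n)
  nonneg : ∀ n x, 0 ≤ h n x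
  le : ∀ n x, h n x ≤ K * n
  add_le : ∀ᵐ x ∂μ, ∀ m n, h m x + h n (T^[m] x) ≤ h (m + n) x

/-- The upper growth rate of a process. -/
noncomputable def upperRate {Ω : Type*} (h : ℕ → Ω → ℝ) (x : Ω) : ℝ :=
  limsup (fun n : ℕ => h n x / n) atTop

/-- The lower growth rate of a process. -/
noncomputable def lowerRate {Ω : Type*} (h : ℕ → Ω → ℝ) (x : Ω) : ℝ :=
  liminf (fun n : ℕ => h n x / n) atTop

theorem integral_comp_measurePreserving {Ω : Type*} [MeasurableSpace Ω] {μ : Measure Ω}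
    {T : Ω → Ω} (hT : MeasurePreserving T μ μ) {f : Ω → ℝ} (hf : Measurable f) :
    ∫ x, f (T x) ∂μ = ∫ x, f x ∂μ := by
  conv_rhs => rw [← hT.map_eq]
  exact (integral_map hT.measurable.aemeasurable hf.aestronglyMeasurable).symm

/-- The covering argument behind the ergodic theorem, along one orbit. -/
theorem le_of_superadditive_cover {a : ℕ → ℕ → ℝ} {b : ℕ → ℝ} {v K : ℝ} {L : ℕ}
    (ha : ∀ n k, 0 ≤ a n k) (hadd : ∀ m n k, a m k + a n (k + m) ≤ a (m + n) k)
    (hb : ∀ k, 0 ≤ b k) (hv : v ≤ K) (hK : 0 ≤ K)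
    (hcov : ∀ k, b k = 1 ∨ ∃ l, 1 ≤ l ∧ l ≤ L ∧ l * v ≤ a l k) (n k : ℕ) :
    n * v - K * ∑ i ∈ Finset.range n, b (k + i) - K * L ≤ a n k := by
  induction n using Nat.strong_induction_on generalizing k with
  | _ n ih =>
    have hS : 0 ≤ ∑ i ∈ Finset.range n, b (k + i) := Finset.sum_nonneg fun i _ => hb _
    -- A final stretch of length at most L is abandoned, which accounts for the loss K L.
    rcases le_or_gt n L with hn | hn
    · have h1 : (n : ℝ) * v ≤ K * L := by
        have : (n : ℝ) ≤ L := by exact_mod_cast hn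
        calc (n : ℝ) * v ≤ n * K := by gcongr
          _ ≤ L * K := by gcongr
          _ = K * L := mul_comm _ _
      have h2 := mul_nonneg hK hS
      linarith [ha n k]
    -- At a bad time advance by one step, paying at most K; at a good time jump by l and gain l v.
    rcases hcov k with hk | ⟨l, hl1, hlL, hl⟩
    · obtain ⟨m, rfl⟩ : ∃ m, n = 1 + m := ⟨n - 1, by omega⟩
      have h1 := ih m (by omega) (k + 1)
      have h2 := hadd 1 m k
      rw [add_comm 1 m, Finset.sum_range_succ', add_zero, hk]
      have h3 : ∑ i ∈ Finset.range m, b (k + (i + 1)) = ∑ i ∈ Finset.range m, b (k + 1 + i) :=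
        Finset.sum_congr rfl fun i _ => by rw [add_assoc, add_comm 1 i]
      rw [h3]
      rw [add_comm 1 m] at h2
      push_cast
      linarith [ha 1 k]
    · obtain ⟨m, rfl⟩ : ∃ m, n = l + m := ⟨n - l, by omega⟩
      have h1 := ih m (by omega) (k + l)
      have h2 := hadd l m k
      have h3 : ∑ i ∈ Finset.range m, b (k + l + i) ≤ ∑ i ∈ Finset.range (l + m), b (k + i) := by
        rw [Finset.sum_range_add]
        have : ∑ i ∈ Finset.range m, b (k + (l + i)) = ∑ i ∈ Finset.range m, b (k + l + i) :=
          Finset.sum_congr rfl fun i _ => by rw [add_assoc]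
        rw [this]
        linarith [Finset.sum_nonneg fun i (_ : i ∈ Finset.range l) => hb (k + i)]
      have h4 := mul_le_mul_of_nonneg_left h3 hK
      push_cast
      linarith

theorem indicator_one_nonneg {Ω : Type*} (B : Set Ω) (x : Ω) : (0 : ℝ) ≤ B.indicator 1 x :=
  Set.indicator_nonneg (fun _ _ => zero_le_one) x

namespace IsSuperadditive

variable {Ω : Type*} [MeasurableSpace Ω] {μ : Measure Ω} {T : Ω → Ω} {K : ℝ} {h : ℕ → Ω → ℝ}

theorem bound_nonneg (H : IsSuperadditive μ T K h) (x : Ω) : 0 ≤ K := by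
  have := (H.nonneg 1 x).trans (H.le 1 x)
  simpa using this

theorem rate_nonneg (H : IsSuperadditive μ T K h) (n : ℕ) (x : Ω) : 0 ≤ h n x / n :=
  div_nonneg (H.nonneg n x) n.cast_nonneg

theorem rate_le (H : IsSuperadditive μ T K h) (n : ℕ) (x : Ω) : h n x / n ≤ K :=
  div_le_of_le_mul₀ n.cast_nonneg (H.bound_nonneg x) (H.le n x)

theorem isBoundedUnder_le (H : IsSuperadditive μ T K h) (x : Ω) :
    IsBoundedUnder (· ≤ ·) atTop fun n : ℕ => h n x / n :=
  isBoundedUnder_of ⟨K, fun n => H.rate_le n x⟩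

theorem isBoundedUnder_ge (H : IsSuperadditive μ T K h) (x : Ω) :
    IsBoundedUnder (· ≥ ·) atTop fun n : ℕ => h n x / n :=
  isBoundedUnder_of ⟨0, fun n => H.rate_nonneg n x⟩

theorem measurable_upperRate (H : IsSuperadditive μ T K h) : Measurable (upperRate h) :=
  Measurable.limsup fun n => (H.measurable n).div_const _

theorem measurable_lowerRate (H : IsSuperadditive μ T K h) : Measurable (lowerRate h) :=
  Measurable.liminf fun n => (H.measurable n).div_const _

theorem lowerRate_nonneg (H : IsSuperadditive μ T K h) (x : Ω) : 0 ≤ lowerRate h x :=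
  le_liminf_of_le (H.isBoundedUnder_le x).isCoboundedUnder_ge
    (Eventually.of_forall fun n => H.rate_nonneg n x)

theorem upperRate_le (H : IsSuperadditive μ T K h) (x : Ω) : upperRate h x ≤ K :=
  limsup_le_of_le (H.isBoundedUnder_ge x).isCoboundedUnder_le
    (Eventually.of_forall fun n => H.rate_le n x)

theorem lowerRate_le_upperRate (H : IsSuperadditive μ T K h) (x : Ω) :
    lowerRate h x ≤ upperRate h x :=
  liminf_le_limsup (H.isBoundedUnder_le x) (H.isBoundedUnder_ge x)

theorem upperRate_nonneg (H : IsSuperadditive μ T K h) (x : Ω) : 0 ≤ upperRate h x :=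
  (H.lowerRate_nonneg x).trans (H.lowerRate_le_upperRate x)

theorem lowerRate_le (H : IsSuperadditive μ T K h) (x : Ω) : lowerRate h x ≤ K :=
  (H.lowerRate_le_upperRate x).trans (H.upperRate_le x)

theorem integrable_of_bounds [IsFiniteMeasure μ] {f : Ω → ℝ} {C : ℝ} (hf : Measurable f)
    (h0 : ∀ x, 0 ≤ f x) (h1 : ∀ x, f x ≤ C) : Integrable f μ :=
  Integrable.of_bound hf.aestronglyMeasurable C (Eventually.of_forall fun x => by
    rw [Real.norm_eq_abs, abs_of_nonneg (h0 x)]; exact h1 x)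

theorem integrable [IsFiniteMeasure μ] (H : IsSuperadditive μ T K h) (n : ℕ) :
    Integrable (h n) μ := integrable_of_bounds (H.measurable n) (H.nonneg n) (H.le n)

theorem integrable_upperRate [IsFiniteMeasure μ] (H : IsSuperadditive μ T K h) :
    Integrable (upperRate h) μ :=
  integrable_of_bounds H.measurable_upperRate H.upperRate_nonneg H.upperRate_le

theorem integrable_lowerRate [IsFiniteMeasure μ] (H : IsSuperadditive μ T K h) :
    Integrable (lowerRate h) μ :=
  integrable_of_bounds H.measurable_lowerRate H.lowerRate_nonneg H.lowerRate_le

theorem ae_orbit (hT : MeasurePreserving T μ μ) {p : Ω → Prop} (hp : ∀ᵐ x ∂μ, p x) :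
    ∀ᵐ x ∂μ, ∀ k, p (T^[k] x) :=
  ae_all_iff.2 fun k => (hT.iterate k).quasiMeasurePreserving.ae hp

/-- Superadditivity gives h n (T x) ≤ h (n+1) x, and replacing n + 1 by n in the denominator is
asymptotically harmless. -/
theorem upperRate_comp_le (H : IsSuperadditive μ T K h) :
    ∀ᵐ x ∂μ, upperRate h (T x) ≤ upperRate h x := by
  filter_upwards [H.add_le] with x hx
  refine le_of_forall_gt_imp_ge_of_dense fun c hc => ?_
  obtain ⟨c', hc1, hc2⟩ := exists_between hc
  have h1 : ∀ᶠ n : ℕ in atTop, h n x / n < c' :=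
    eventually_lt_of_limsup_lt hc1 (H.isBoundedUnder_le x)
  have h2 : ∀ᶠ n : ℕ in atTop, K / n < c - c' :=
    (tendsto_const_div_atTop_nhds_zero_nat K).eventually_lt_const (by linarith)
  refine limsup_le_of_le (H.isBoundedUnder_ge _).isCoboundedUnder_le ?_
  filter_upwards [(tendsto_add_atTop_nat 1).eventually h1, h2, eventually_gt_atTop 0]
    with n hn1 hn2 hn0
  have hnpos : (0 : ℝ) < n := by exact_mod_cast hn0
  have h3 := hx 1 n
  rw [Function.iterate_one, add_comm 1 n] at h3
  have h4 := H.nonneg 1 x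
  have h5 : h n (T x) / n ≤ h (n + 1) x / n := by
    gcongr
    linarith
  have h6 : h (n + 1) x / n = h (n + 1) x / ((n + 1 : ℕ) : ℝ) * (1 + 1 / n) := by
    push_cast
    field_simp
  have h7 := H.rate_le (n + 1) x
  have h8 := mul_le_mul_of_nonneg_right h7 (by positivity : (0 : ℝ) ≤ 1 / n)
  have h9 : K * (1 / n) = K / n := by ring
  rw [h6] at h5
  linarith

/-- Both functions have the same integral, so the inequality cannot be strict on a set of positive
measure. -/
theorem ae_eq_of_comp_le [IsFiniteMeasure μ] (hT : MeasurePreserving T μ μ) {f : Ω → ℝ}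
    (hf : Measurable f) (hi : Integrable f μ) (hle : ∀ᵐ x ∂μ, f (T x) ≤ f x) :
    ∀ᵐ x ∂μ, f (T x) = f x :=
  (integral_eq_iff_of_ae_le ((hT.integrable_comp hf.aestronglyMeasurable).2 hi) hi hle).1
    (integral_comp_measurePreserving hT hf)

theorem upperRate_comp [IsFiniteMeasure μ] (H : IsSuperadditive μ T K h) :
    ∀ᵐ x ∂μ, upperRate h (T x) = upperRate h x :=
  ae_eq_of_comp_le H.measurePreserving H.measurable_upperRate H.integrable_upperRate
    H.upperRate_comp_le

theorem upperRate_iterate [IsFiniteMeasure μ] (H : IsSuperadditive μ T K h) :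
    ∀ᵐ x ∂μ, ∀ k, upperRate h (T^[k] x) = upperRate h x := by
  filter_upwards [ae_orbit H.measurePreserving H.upperRate_comp] with x hx k
  induction k with
  | zero => rfl
  | succ k ih => rw [Function.iterate_succ_apply', hx k, ih]

/-- The points where the upper rate is not nearly attained up to time `L`. -/
def lateSet (h : ℕ → Ω → ℝ) (ε : ℝ) (L : ℕ) : Set Ω :=
  {x | ∀ l : ℕ, 1 ≤ l → l ≤ L → h l x < l * (upperRate h x - ε)}

theorem measurableSet_lateSet (H : IsSuperadditive μ T K h) (ε : ℝ) (L : ℕ) :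
    MeasurableSet (lateSet h ε L) := by
  have : lateSet h ε L = ⋂ l : ℕ, ⋂ _ : 1 ≤ l, ⋂ _ : l ≤ L,
      {x | h l x < l * (upperRate h x - ε)} := by
    ext x; simp [lateSet]
  rw [this]
  exact MeasurableSet.iInter fun l => MeasurableSet.iInter fun _ => MeasurableSet.iInter fun _ =>
    measurableSet_lt (H.measurable l) ((H.measurable_upperRate.sub_const ε).const_mul _)

/-- The sets decrease with L to the empty set, since a limsup is nearly attained at some finite
time. -/
theorem exists_measure_lateSet_lt [IsFiniteMeasure μ] (H : IsSuperadditive μ T K h) {ε δ : ℝ}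
    (hε : 0 < ε) (hδ : 0 < δ) : ∃ L, μ.real (lateSet h ε L) < δ := by
  have hempty : ⋂ L, lateSet h ε L = ∅ := by
    rw [Set.eq_empty_iff_forall_notMem]
    intro x hx
    have h1 : ∃ᶠ n : ℕ in atTop, upperRate h x - ε < h n x / n :=
      frequently_lt_of_lt_limsup (H.isBoundedUnder_ge x).isCoboundedUnder_le
        (show upperRate h x - ε < upperRate h x by linarith)
    obtain ⟨n, hn, hn1⟩ := (h1.and_eventually (eventually_ge_atTop 1)).exists
    have hnpos : (0 : ℝ) < n := by exact_mod_cast hn1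
    have h2 := Set.mem_iInter.1 hx n n hn1 le_rfl
    rw [lt_div_iff₀ hnpos] at hn
    linarith
  have hlim := tendsto_measure_iInter_atTop (μ := μ) (s := lateSet h ε)
    (fun L => (H.measurableSet_lateSet ε L).nullMeasurableSet)
    (fun L L' hL x hx l h1 h2 => hx l h1 (h2.trans hL)) ⟨0, measure_ne_top _ _⟩
  rw [hempty, measure_empty] at hlim
  obtain ⟨L, hL⟩ := (hlim.eventually_lt_const (ENNReal.ofReal_pos.2 hδ)).exists
  refine ⟨L, ?_⟩
  rw [Measure.real]
  exact (ENNReal.lt_ofReal_iff_toReal_lt (measure_ne_top _ _)).1 hL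

/-- The number of visits to `B` before time `n`. -/
noncomputable def visits (T : Ω → Ω) (B : Set Ω) (n : ℕ) (x : Ω) : ℝ :=
  ∑ i ∈ Finset.range n, B.indicator 1 (T^[i] x)

theorem isSuperadditive_visits (hT : MeasurePreserving T μ μ) {B : Set Ω}
    (hB : MeasurableSet B) : IsSuperadditive μ T 1 (visits T B) where
  measurePreserving := hT
  measurable n := Finset.measurable_sum _ fun i _ =>
    (measurable_one.indicator hB).comp (hT.measurable.iterate i)
  nonneg n x := Finset.sum_nonneg fun i _ => indicator_one_nonneg B _
  le n x := by
    have h1 : ∀ i ∈ Finset.range n, B.indicator (1 : Ω → ℝ) (T^[i] x) ≤ 1 := fun i _ =>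
      Set.indicator_le_self' (fun _ _ => zero_le_one) _
    simpa [visits] using Finset.sum_le_card_nsmul _ _ _ h1
  add_le := Eventually.of_forall fun x m n => by
    rw [visits, visits, visits, Finset.sum_range_add]
    refine le_of_eq ?_
    congr 1
    refine Finset.sum_congr rfl fun i _ => ?_
    rw [← Function.iterate_add_apply, add_comm i m]

theorem integral_visits [IsFiniteMeasure μ] (hT : MeasurePreserving T μ μ) {B : Set Ω}
    (hB : MeasurableSet B) (n : ℕ) : ∫ x, visits T B n x ∂μ = n * μ.real B := by
  have h1 : ∀ i, Measurable fun x => B.indicator (1 : Ω → ℝ) (T^[i] x) := fun i =>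
    (measurable_one.indicator hB).comp (hT.measurable.iterate i)
  have h2 : ∀ i, ∫ x, B.indicator (1 : Ω → ℝ) (T^[i] x) ∂μ = μ.real B := fun i => by
    rw [integral_comp_measurePreserving (hT.iterate i) (measurable_one.indicator hB),
      integral_indicator_one hB]
  simp only [visits]
  rw [integral_finsetSum]
  · simp [h2]
  · intro i _
    exact integrable_of_bounds (h1 i) (fun x => indicator_one_nonneg B _)
      (fun x => Set.indicator_le_self' (fun _ _ => zero_le_one) _)

theorem ae_le_process [IsFiniteMeasure μ] (H : IsSuperadditive μ T K h) {ε : ℝ} (hε : 0 < ε)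
    (L : ℕ) : ∀ᵐ x ∂μ, ∀ n : ℕ, n * (upperRate h x - ε) - K * visits T (lateSet h ε L) n x - K * L
      ≤ h n x := by
  filter_upwards [ae_orbit H.measurePreserving H.add_le, H.upperRate_iterate] with x hx hU n
  have := le_of_superadditive_cover (a := fun n k => h n (T^[k] x))
    (b := fun k => (lateSet h ε L).indicator 1 (T^[k] x)) (v := upperRate h x - ε) (K := K) (L := L)
    (fun n k => H.nonneg _ _) (fun m n k => by
      have := hx k m n
      rwa [← Function.iterate_add_apply, add_comm m k] at this)
    (fun k => indicator_one_nonneg _ _) (by linarith [H.upperRate_le x]) (H.bound_nonneg x)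
    (fun k => by
      by_cases hk : T^[k] x ∈ lateSet h ε L
      · left; simp [hk]
      · right
        simp only [lateSet, Set.mem_ofPred_eq, not_forall, not_lt] at hk
        obtain ⟨l, h1, h2, h3⟩ := hk
        refine ⟨l, h1, h2, ?_⟩
        rwa [hU k] at h3) n 0
  simpa [visits] using this

/-- Integrating the covering bound needs only the mean number of visits, not their asymptotics.
Applied to the visits themselves, it later replaces Birkhoff's theorem. -/
theorem integral_upperRate_le [IsFiniteMeasure μ] (H : IsSuperadditive μ T K h) (hK : 0 ≤ K)
    {γ : ℝ} (hγ : ∀ n : ℕ, ∫ x, h n x ∂μ ≤ n * γ) : ∫ x, upperRate h x ∂μ ≤ γ := by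
  have key : ∀ ε > 0, ∫ x, upperRate h x ∂μ ≤ γ + ε * (μ.real Set.univ + K) := by
    intro ε hε
    obtain ⟨L, hL⟩ := H.exists_measure_lateSet_lt hε hε
    have hB := H.measurableSet_lateSet ε L
    have hV := isSuperadditive_visits H.measurePreserving hB
    have h1 : ∀ n : ℕ, n * (∫ x, upperRate h x ∂μ - ε * μ.real Set.univ) -
        K * (n * μ.real (lateSet h ε L)) - K * L * μ.real Set.univ ≤ n * γ := by
      intro n
      refine le_trans (le_of_eq ?_) ((integral_mono_ae ?_ (H.integrable n) (by
        filter_upwards [H.ae_le_process hε L] with x hx using hx n)).trans (hγ n))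
      · rw [integral_sub, integral_sub, integral_const_mul, integral_const_mul,
          integral_visits H.measurePreserving hB, integral_sub H.integrable_upperRate
          (integrable_const _)]
        · simp [mul_comm]
        · exact (H.integrable_upperRate.sub (integrable_const _)).const_mul _
        · exact (hV.integrable n).const_mul _
        · exact ((H.integrable_upperRate.sub (integrable_const _)).const_mul _).sub
            ((hV.integrable n).const_mul _)
        · exact integrable_const _
      · exact (((H.integrable_upperRate.sub (integrable_const _)).const_mul _).sub
            ((hV.integrable n).const_mul _)).sub (integrable_const _)
    have h2 : ∀ᶠ n : ℕ in atTop, (∫ x, upperRate h x ∂μ - ε * μ.real Set.univ) -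
        K * μ.real (lateSet h ε L) - K * L * μ.real Set.univ / n ≤ γ := by
      filter_upwards [eventually_gt_atTop 0] with n hn
      have hnpos : (0 : ℝ) < n := by exact_mod_cast hn
      have := h1 n
      rw [← mul_le_mul_iff_right₀ hnpos]
      refine le_trans (le_of_eq ?_) this
      field_simp
    have h3 := le_of_tendsto (tendsto_const_nhds.sub
      (tendsto_const_div_atTop_nhds_zero_nat (K * L * μ.real Set.univ))) h2
    have h4 := mul_le_mul_of_nonneg_left hL.le hK
    linarith
  refine le_of_forall_pos_le_add fun ε hε => ?_
  have hM : 0 < μ.real Set.univ + K + 1 := by positivity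
  refine (key (ε / (μ.real Set.univ + K + 1)) (by positivity)).trans ?_
  have : ε / (μ.real Set.univ + K + 1) * (μ.real Set.univ + K) ≤ ε := by
    rw [div_mul_eq_mul_div, div_le_iff₀ hM]
    nlinarith
  linarith

theorem ae_sub_le_lowerRate [IsFiniteMeasure μ] (H : IsSuperadditive μ T K h) {ε : ℝ}
    (hε : 0 < ε) (L : ℕ) : ∀ᵐ x ∂μ,
      upperRate h x - ε - K * upperRate (visits T (lateSet h ε L)) x ≤ lowerRate h x := by
  have hB := H.measurableSet_lateSet ε L
  have hV := isSuperadditive_visits H.measurePreserving hB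
  filter_upwards [H.ae_le_process hε L] with x hx
  have hK := H.bound_nonneg x
  refine le_of_forall_pos_le_add fun δ hδ => ?_
  rw [← sub_le_iff_le_add]
  refine le_liminf_of_le (H.isBoundedUnder_le x).isCoboundedUnder_ge ?_
  have h1 : ∀ᶠ n : ℕ in atTop, visits T (lateSet h ε L) n x / n <
      upperRate (visits T (lateSet h ε L)) x + δ / (2 * (K + 1)) :=
    eventually_lt_of_limsup_lt (lt_add_of_pos_right _ (by positivity)) (hV.isBoundedUnder_le x)
  have h2 : ∀ᶠ n : ℕ in atTop, K * L / n < δ / 2 :=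
    (tendsto_const_div_atTop_nhds_zero_nat (K * L)).eventually_lt_const (by linarith)
  filter_upwards [h1, h2, eventually_gt_atTop 0] with n hn1 hn2 hn0
  have hnpos : (0 : ℝ) < n := by exact_mod_cast hn0
  have h3 := div_le_div_of_nonneg_right (hx n) hnpos.le
  have h4 : (n * (upperRate h x - ε) - K * visits T (lateSet h ε L) n x - K * L) / n =
      upperRate h x - ε - K * (visits T (lateSet h ε L) n x / n) - K * L / n := by
    field_simp
  rw [h4] at h3
  have h5 := mul_le_mul_of_nonneg_left hn1.le hK
  have h6 : K * (δ / (2 * (K + 1))) ≤ δ / 2 := by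
    rw [mul_div_assoc', div_le_div_iff₀ (by positivity) two_pos]
    nlinarith
  linarith

/-- **Subadditive ergodic theorem** for bounded superadditive processes. -/
theorem ae_tendsto [IsFiniteMeasure μ] (H : IsSuperadditive μ T K h) (hK : 0 ≤ K) :
    ∀ᵐ x ∂μ, Tendsto (fun n : ℕ => h n x / n) atTop (𝓝 (upperRate h x)) := by
  have key : ∀ ε > 0, ∫ x, upperRate h x ∂μ ≤
      ∫ x, lowerRate h x ∂μ + ε * (μ.real Set.univ + K) := by
    intro ε hε
    obtain ⟨L, hL⟩ := H.exists_measure_lateSet_lt hε hε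
    have hB := H.measurableSet_lateSet ε L
    have hV := isSuperadditive_visits H.measurePreserving hB
    have h1 : ∫ x, (upperRate h x - ε - K * upperRate (visits T (lateSet h ε L)) x) ∂μ ≤
        ∫ x, lowerRate h x ∂μ := integral_mono_ae
      ((H.integrable_upperRate.sub (integrable_const ε)).sub
      (hV.integrable_upperRate.const_mul K)) H.integrable_lowerRate (H.ae_sub_le_lowerRate hε L)
    -- The error term is itself the upper rate of an additive process, with mean at most the small
    -- measure of the late set.
    have h2 := hV.integral_upperRate_le zero_le_one (γ := μ.real (lateSet h ε L))
      (fun n => (integral_visits H.measurePreserving hB n).le)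
    have h3 : ∫ x, (upperRate h x - ε - K * upperRate (visits T (lateSet h ε L)) x) ∂μ =
        ∫ x, upperRate h x ∂μ -
        ε * μ.real Set.univ - K * ∫ x, upperRate (visits T (lateSet h ε L)) x ∂μ := by
      rw [integral_sub (f := fun x => upperRate h x - ε)
        (H.integrable_upperRate.sub (integrable_const ε))
        (hV.integrable_upperRate.const_mul K), integral_sub H.integrable_upperRate
        (integrable_const ε), integral_const_mul]
      simp [mul_comm]
    have h4 := mul_le_mul_of_nonneg_left (h2.trans hL.le) hK
    have h5 := h3.symm.le.trans h1
    linarith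
  have hle : ∫ x, upperRate h x ∂μ ≤ ∫ x, lowerRate h x ∂μ := by
    refine le_of_forall_pos_le_add fun ε hε => ?_
    have hM : 0 < μ.real Set.univ + K + 1 := by positivity
    refine (key (ε / (μ.real Set.univ + K + 1)) (by positivity)).trans ?_
    have : ε / (μ.real Set.univ + K + 1) * (μ.real Set.univ + K) ≤ ε := by
      rw [div_mul_eq_mul_div, div_le_iff₀ hM]
      nlinarith
    linarith
  have heq := (integral_eq_iff_of_ae_le H.integrable_lowerRate H.integrable_upperRate
    (Eventually.of_forall H.lowerRate_le_upperRate)).1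
    (le_antisymm (integral_mono H.integrable_lowerRate H.integrable_upperRate
      H.lowerRate_le_upperRate) hle)
  filter_upwards [heq] with x hx
  exact tendsto_of_liminf_eq_limsup hx rfl (H.isBoundedUnder_le x) (H.isBoundedUnder_ge x)

theorem tendsto_integral_sub [IsFiniteMeasure μ] (H : IsSuperadditive μ T K h) (hK : 0 ≤ K) :
    Tendsto (fun n : ℕ => ∫ x, |h n x / n - upperRate h x| ∂μ) atTop (𝓝 0) := by
  have := tendsto_integral_of_dominated_convergence (μ := μ)
    (F := fun (n : ℕ) x => |h n x / n - upperRate h x|) (f := fun _ => (0 : ℝ)) (fun _ => K)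
    (fun n => (((H.measurable n).div_const _).sub H.measurable_upperRate).abs.aestronglyMeasurable)
    (integrable_const K) (fun n => Eventually.of_forall fun x => by
      rw [Real.norm_eq_abs, abs_abs, abs_le]
      constructor <;> linarith [H.rate_nonneg n x, H.rate_le n x, H.upperRate_nonneg x,
        H.upperRate_le x]) (by
      filter_upwards [H.ae_tendsto hK] with x hx
      have := (hx.sub_const (upperRate h x)).abs
      simpa using this)
  simpa using this

/-- Along multiples of k the mean is superadditive, and the bounded convergence theorem identifies
its limit slope. -/
theorem integral_le_integral_upperRate [IsFiniteMeasure μ] (H : IsSuperadditive μ T K h)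
    (hK : 0 ≤ K) (k : ℕ) : ∫ x, h k x ∂μ ≤ k * ∫ x, upperRate h x ∂μ := by
  rcases Nat.eq_zero_or_pos k with rfl | hk
  · have : ∀ x, h 0 x = 0 := fun x => le_antisymm (by simpa using H.le 0 x) (H.nonneg 0 x)
    simp [this]
  have hmul : ∀ n : ℕ, n * ∫ x, h k x ∂μ ≤ ∫ x, h (n * k) x ∂μ := by
    intro n
    induction n with
    | zero => simpa using integral_nonneg (H.nonneg _)
    | succ n ih =>
      have hmp := H.measurePreserving.iterate (n * k)
      have hi : Integrable (fun x => h k (T^[n * k] x)) μ :=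
        (hmp.integrable_comp (H.measurable k).aestronglyMeasurable).2 (H.integrable k)
      have h1 : ∫ x, (h (n * k) x + h k (T^[n * k] x)) ∂μ ≤ ∫ x, h ((n + 1) * k) x ∂μ := by
        refine integral_mono_ae ((H.integrable _).add hi) (H.integrable _) ?_
        filter_upwards [H.add_le] with x hx
        have := hx (n * k) k
        rwa [← Nat.succ_mul] at this
      rw [integral_add (H.integrable _) hi, integral_comp_measurePreserving hmp
        (H.measurable k)] at h1
      push_cast
      linarith
  have hlim : Tendsto (fun n : ℕ => ∫ x, h n x / n ∂μ) atTop (𝓝 (∫ x, upperRate h x ∂μ)) :=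
    tendsto_integral_of_dominated_convergence (fun _ => K)
      (fun n => ((H.measurable n).div_const _).aestronglyMeasurable) (integrable_const K)
      (fun n => Eventually.of_forall fun x => by
        rw [Real.norm_eq_abs, abs_of_nonneg (H.rate_nonneg n x)]; exact H.rate_le n x)
      (H.ae_tendsto hK)
  have hsub := hlim.comp (tendsto_id.atTop_mul_const' hk)
  have hkpos : (0 : ℝ) < k := by exact_mod_cast hk
  rw [← div_le_iff₀' hkpos]
  refine ge_of_tendsto hsub ?_
  filter_upwards [eventually_gt_atTop 0] with n hn
  have hnpos : (0 : ℝ) < n := by exact_mod_cast hn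
  simp only [Function.comp_apply, id_eq]
  rw [integral_div, Nat.cast_mul, div_le_div_iff₀ hkpos (by positivity)]
  have := mul_le_mul_of_nonneg_right (hmul n) hkpos.le
  linarith

theorem ae_eq_zero_of_upperRate [IsFiniteMeasure μ] (H : IsSuperadditive μ T K h)
    (hK : 0 ≤ K) (h0 : ∀ᵐ x ∂μ, upperRate h x = 0) : ∀ᵐ x ∂μ, ∀ k, h k x = 0 := by
  refine ae_all_iff.2 fun k => ?_
  have h1 := H.integral_le_integral_upperRate hK k
  rw [integral_congr_ae (g := fun _ => (0 : ℝ)) h0, integral_zero, mul_zero] at h1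
  exact (integral_eq_zero_iff_of_nonneg (H.nonneg k) (H.integrable k)).1
    (le_antisymm h1 (integral_nonneg (H.nonneg k)))

/-- The time reversal of a superadditive process. -/
theorem reverse (H : IsSuperadditive μ T K h) {S : Ω → Ω} (hS : MeasurePreserving S μ μ)
    (hTS : Function.LeftInverse T S) :
    IsSuperadditive μ S K fun n x => h n (S^[n] x) where
  measurePreserving := hS
  measurable n := (H.measurable n).comp (hS.measurable.iterate n)
  nonneg n x := H.nonneg n _
  le n x := H.le n _
  add_le := by
    filter_upwards [ae_orbit hS H.add_le] with x hx m n
    have h1 := hx (m + n) n m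
    rw [add_comm m n, Function.iterate_add_apply S n m, hTS.iterate n] at h1
    rw [← Function.iterate_add_apply S n m, add_comm m n, Function.iterate_add_apply S n m]
    linarith

/-- Composing with S^n preserves integrals and fixes the invariant upper rate, so the reversed
averages converge in L¹ to the same limit. -/
theorem upperRate_reverse [IsFiniteMeasure μ] (H : IsSuperadditive μ T K h) (hK : 0 ≤ K)
    {S : Ω → Ω} (hS : MeasurePreserving S μ μ) (hTS : Function.LeftInverse T S) :
    ∀ᵐ x ∂μ, upperRate (fun n x => h n (S^[n] x)) x = upperRate h x := by
  have R := H.reverse hS hTS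
  set g : ℕ → Ω → ℝ := fun n x => h n (S^[n] x) with hg
  have hinv : ∀ᵐ x ∂μ, ∀ k, upperRate h (S^[k] x) = upperRate h x := by
    have h1 : ∀ᵐ x ∂μ, upperRate h (S x) = upperRate h x := by
      filter_upwards [hS.quasiMeasurePreserving.ae H.upperRate_comp] with x hx
      rw [← hx, hTS x]
    filter_upwards [ae_orbit hS h1] with x hx k
    induction k with
    | zero => rfl
    | succ k ih => rw [Function.iterate_succ_apply', hx k, ih]
  have hint : ∀ n : ℕ, ∫ x, |g n x / n - upperRate h x| ∂μ =
      ∫ x, |h n x / n - upperRate h x| ∂μ := by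
    intro n
    rw [← integral_comp_measurePreserving (f := fun x => |h n x / n - upperRate h x|)
      (hS.iterate n) ((((H.measurable n).div_const (n : ℝ)).sub H.measurable_upperRate).abs)]
    refine integral_congr_ae ?_
    filter_upwards [hinv] with x hx
    simp only [hg, hx n]
  have h1 := (R.tendsto_integral_sub hK).add (H.tendsto_integral_sub hK)
  have hi : ∀ n : ℕ, Integrable (fun x => |g n x / n - upperRate g x|) μ := fun n =>
    (((R.integrable n).div_const _).sub R.integrable_upperRate).abs
  have hi' : ∀ n : ℕ, Integrable (fun x => |g n x / n - upperRate h x|) μ := fun n =>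
    (((R.integrable n).div_const _).sub H.integrable_upperRate).abs
  have h2 : ∫ x, |upperRate g x - upperRate h x| ∂μ ≤ 0 + 0 := by
    refine ge_of_tendsto h1 (Eventually.of_forall fun n => ?_)
    rw [← hint n, ← integral_add (hi n) (hi' n)]
    refine integral_mono (R.integrable_upperRate.sub H.integrable_upperRate).abs
      ((hi n).add (hi' n)) fun x => ?_
    have := abs_sub_le (upperRate g x) (g n x / n) (upperRate h x)
    rwa [abs_sub_comm (upperRate g x) (g n x / n)] at this
  have h3 := (integral_eq_zero_iff_of_nonneg (fun x => abs_nonneg _)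
    (R.integrable_upperRate.sub H.integrable_upperRate).abs).1
    (le_antisymm (by simpa using h2) (integral_nonneg fun x => abs_nonneg _))
  filter_upwards [h3] with x hx
  exact sub_eq_zero.1 (abs_eq_zero.1 hx)

end IsSuperadditive


/-! ### Decay rates of submultiplicative processes -/

/-- Truncation at e^{-j} moves a nonnegative sequence by at most e^{-j}, so convergence of all
truncations makes it Cauchy, even with limit 0. -/
theorem exists_tendsto_of_truncations {b : ℕ → ℝ} {k : ℕ → ℝ} (hb : ∀ n, 0 ≤ b n)
    (h : ∀ j : ℕ, Tendsto (fun n => max (b n) (Real.exp (-j))) atTop (𝓝 (k j))) :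
    ∃ L, Tendsto b atTop (𝓝 L) ∧ (∀ j, k j = max L (Real.exp (-j))) := by
  have hexp : Tendsto (fun j : ℕ => Real.exp (-j)) atTop (𝓝 0) :=
    Real.tendsto_exp_neg_atTop_nhds_zero.comp tendsto_natCast_atTop_atTop
  have hc : CauchySeq b := by
    rw [Metric.cauchySeq_iff']
    intro ε hε
    obtain ⟨j, hj⟩ := (hexp.eventually_lt_const (by positivity : 0 < ε / 3)).exists
    obtain ⟨N, hN⟩ := Metric.cauchySeq_iff'.1 (h j).cauchySeq (ε / 3) (by positivity)
    have hclose : ∀ n, |b n - max (b n) (Real.exp (-j))| ≤ Real.exp (-j) := by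
      intro n
      have h0 := Real.exp_pos (-(j : ℝ))
      rcases le_total (b n) (Real.exp (-j)) with h1 | h1
      · rw [max_eq_right h1, abs_le]
        constructor <;> linarith [hb n]
      · rw [max_eq_left h1, sub_self, abs_zero]
        exact h0.le
    refine ⟨N, fun n hn => ?_⟩
    have h1 := hN n hn
    rw [Real.dist_eq] at h1 ⊢
    have h2 := abs_le.1 (hclose n)
    have h3 := abs_le.1 (hclose N)
    have h4 := abs_lt.1 h1
    rw [abs_lt]
    constructor <;> linarith
  obtain ⟨L, hL⟩ := cauchySeq_tendsto_of_complete hc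
  exact ⟨L, hL, fun j => tendsto_nhds_unique (h j) (hL.max tendsto_const_nhds)⟩

theorem eq_of_max_exp_eq {L L' : ℝ} (hL : 0 ≤ L) (hL' : 0 ≤ L')
    (h : ∀ j : ℕ, max L (Real.exp (-j)) = max L' (Real.exp (-j))) : L = L' := by
  have hexp : Tendsto (fun j : ℕ => Real.exp (-j)) atTop (𝓝 0) :=
    Real.tendsto_exp_neg_atTop_nhds_zero.comp tendsto_natCast_atTop_atTop
  have h1 : Tendsto (fun j : ℕ => max L (Real.exp (-j))) atTop (𝓝 (max L 0)) :=
    tendsto_const_nhds.max hexp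
  have h2 : Tendsto (fun j : ℕ => max L' (Real.exp (-j))) atTop (𝓝 (max L' 0)) :=
    tendsto_const_nhds.max hexp
  simp only [h] at h1
  have := tendsto_nhds_unique h1 h2
  rwa [max_eq_left hL, max_eq_left hL'] at this

/-- A submultiplicative process over `T` with values in `[0, 1]`. -/
structure IsSubmultiplicative {Ω : Type*} [MeasurableSpace Ω] (μ : Measure Ω) (T : Ω → Ω)
    (a : ℕ → Ω → ℝ) : Prop where
  measurePreserving : MeasurePreserving T μ μ
  measurable : ∀ n, Measurable (a n)
  nonneg : ∀ n x, 0 ≤ a n x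
  le_one : ∀ n x, a n x ≤ 1
  le_mul : ∀ᵐ x ∂μ, ∀ m n, a (m + n) x ≤ a m x * a n (T^[m] x)

/-- The negative logarithm of a process, truncated at slope `j`. -/
noncomputable def truncLog {Ω : Type*} (j : ℕ) (a : ℕ → Ω → ℝ) (n : ℕ) (x : Ω) : ℝ :=
  -Real.log (max (a n x) (Real.exp (-(j * n))))

theorem exp_neg_truncLog_div {Ω : Type*} {j : ℕ} {a : ℕ → Ω → ℝ} {n : ℕ} (hn : 0 < n) {x : Ω}
    (h0 : 0 ≤ a n x) : Real.exp (-(truncLog j a n x / n)) =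
      max (a n x ^ (1 / (n : ℝ))) (Real.exp (-j)) := by
  have hpos : 0 < max (a n x) (Real.exp (-(j * n))) := lt_max_of_lt_right (Real.exp_pos _)
  have hn' : (0 : ℝ) < n := by exact_mod_cast hn
  have h1 : Real.exp (-(truncLog j a n x / n)) =
      (max (a n x) (Real.exp (-(j * n)))) ^ (1 / (n : ℝ)) := by
    rw [Real.rpow_def_of_pos hpos, truncLog]
    congr 1
    ring
  rw [h1]
  have h2 : Real.exp (-(j : ℝ)) = Real.exp (-(j * n)) ^ (1 / (n : ℝ)) := by
    rw [← Real.exp_mul]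
    congr 1
    field_simp
  rw [h2]
  have hm : MonotoneOn (fun y : ℝ => y ^ (1 / (n : ℝ))) (Set.Ici 0) := by
    intro y hy z _ hyz
    exact Real.rpow_le_rpow hy hyz (by positivity)
  exact hm.map_max h0 (Real.exp_pos _).le

namespace IsSubmultiplicative

variable {Ω : Type*} [MeasurableSpace Ω] {μ : Measure Ω} {T : Ω → Ω} {a : ℕ → Ω → ℝ}

/-- The cutoff e^{-jn} is multiplicative in n, so the truncated process stays submultiplicative
while its negative logarithm is bounded by jn. -/
theorem isSuperadditive (H : IsSubmultiplicative μ T a) (j : ℕ) :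
    IsSuperadditive μ T j (truncLog j a) where
  measurePreserving := H.measurePreserving
  measurable n := (Real.measurable_log.comp ((H.measurable n).max measurable_const)).neg
  nonneg n x := by
    have h1 : max (a n x) (Real.exp (-(j * n))) ≤ 1 :=
      max_le (H.le_one n x) (Real.exp_le_one_iff.2 (neg_nonpos.2 (by positivity)))
    have := Real.log_nonpos (le_max_of_le_left (H.nonneg n x)) h1
    rw [truncLog]
    linarith
  le n x := by
    have h1 := Real.log_le_log (Real.exp_pos _) (le_max_right (a n x) (Real.exp (-(j * n))))
    rw [Real.log_exp] at h1
    rw [truncLog]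
    linarith
  add_le := by
    filter_upwards [H.le_mul] with x hx m n
    have hpos : ∀ (n : ℕ) (y : Ω), 0 < max (a n y) (Real.exp (-(j * n))) := fun n y =>
      lt_max_of_lt_right (Real.exp_pos _)
    simp only [truncLog]
    rw [← neg_add, neg_le_neg_iff, ← Real.log_mul (hpos m x).ne' (hpos n _).ne']
    refine Real.log_le_log (hpos _ _) (max_le ?_ ?_)
    · exact (hx m n).trans (mul_le_mul (le_max_left _ _) (le_max_left _ _) (H.nonneg _ _)
        (hpos m x).le)
    · have : Real.exp (-(j * (m + n : ℕ))) = Real.exp (-(j * m)) * Real.exp (-(j * n)) := by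
        rw [← Real.exp_add]
        push_cast
        ring_nf
      rw [this]
      exact mul_le_mul (le_max_right _ _) (le_max_right _ _) (Real.exp_pos _).le (hpos m x).le

theorem rate_nonneg (H : IsSubmultiplicative μ T a) (n : ℕ) (x : Ω) :
    0 ≤ a n x ^ (1 / (n : ℝ)) := Real.rpow_nonneg (H.nonneg n x) _

/-- The exponential rate of a process. -/
noncomputable def rate (a : ℕ → Ω → ℝ) (x : Ω) : ℝ :=
  limsup (fun n : ℕ => a n x ^ (1 / (n : ℝ))) atTop

theorem measurable_rate (H : IsSubmultiplicative μ T a) : Measurable (rate a) :=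
  Measurable.limsup fun n => (H.measurable n).pow_const _

theorem ae_tendsto_rate [IsFiniteMeasure μ] (H : IsSubmultiplicative μ T a) :
    ∀ᵐ x ∂μ, Tendsto (fun n : ℕ => a n x ^ (1 / (n : ℝ))) atTop (𝓝 (rate a x)) ∧
      ∀ j : ℕ, Real.exp (-upperRate (truncLog j a) x) = max (rate a x) (Real.exp (-j)) := by
  have h1 : ∀ᵐ x ∂μ, ∀ j : ℕ, Tendsto (fun n : ℕ => truncLog j a n x / n) atTop
      (𝓝 (upperRate (truncLog j a) x)) :=
    ae_all_iff.2 fun j => (H.isSuperadditive j).ae_tendsto j.cast_nonneg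
  filter_upwards [h1] with x hx
  have h2 : ∀ j : ℕ, Tendsto (fun n : ℕ => max (a n x ^ (1 / (n : ℝ))) (Real.exp (-j))) atTop
      (𝓝 (Real.exp (-upperRate (truncLog j a) x))) := by
    intro j
    have h3 := (Real.continuous_exp.tendsto _).comp (hx j).neg
    refine h3.congr' ?_
    filter_upwards [eventually_gt_atTop 0] with n hn
    exact exp_neg_truncLog_div hn (H.nonneg n x)
  obtain ⟨L, hL, hk⟩ := exists_tendsto_of_truncations (fun n => H.rate_nonneg n x) h2
  have hr : rate a x = L := hL.limsup_eq
  rw [hr]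
  exact ⟨hL, hk⟩

theorem ae_rate_nonneg [IsFiniteMeasure μ] (H : IsSubmultiplicative μ T a) :
    ∀ᵐ x ∂μ, 0 ≤ rate a x := by
  filter_upwards [H.ae_tendsto_rate] with x hx
  exact ge_of_tendsto hx.1 (Eventually.of_forall fun n => H.rate_nonneg n x)

theorem ae_rate_comp [IsFiniteMeasure μ] (H : IsSubmultiplicative μ T a) :
    ∀ᵐ x ∂μ, rate a (T x) = rate a x := by
  have h1 : ∀ᵐ x ∂μ, ∀ j : ℕ, upperRate (truncLog j a) (T x) = upperRate (truncLog j a) x :=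
    ae_all_iff.2 fun j => (H.isSuperadditive j).upperRate_comp
  have hq := H.measurePreserving.quasiMeasurePreserving
  filter_upwards [h1, H.ae_tendsto_rate, hq.ae H.ae_tendsto_rate, H.ae_rate_nonneg,
    hq.ae H.ae_rate_nonneg] with x hx h2 h3 h4 h5
  refine eq_of_max_exp_eq h5 h4 fun j => ?_
  rw [← h2.2 j, ← h3.2 j, hx j]

theorem reverse (H : IsSubmultiplicative μ T a) {S : Ω → Ω} (hS : MeasurePreserving S μ μ)
    (hTS : Function.LeftInverse T S) : IsSubmultiplicative μ S fun n x => a n (S^[n] x) where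
  measurePreserving := hS
  measurable n := (H.measurable n).comp (hS.measurable.iterate n)
  nonneg n x := H.nonneg n _
  le_one n x := H.le_one n _
  le_mul := by
    filter_upwards [IsSuperadditive.ae_orbit hS H.le_mul] with x hx m n
    have h1 := hx (m + n) n m
    rw [add_comm m n, Function.iterate_add_apply S n m, hTS.iterate n] at h1
    rw [← Function.iterate_add_apply S n m, add_comm m n, Function.iterate_add_apply S n m]
    linarith [mul_comm (a m (S^[m] x)) (a n (S^[n] (S^[m] x)))]

theorem ae_rate_reverse [IsFiniteMeasure μ] (H : IsSubmultiplicative μ T a) {S : Ω → Ω}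
    (hS : MeasurePreserving S μ μ) (hTS : Function.LeftInverse T S) :
    ∀ᵐ x ∂μ, rate (fun n x => a n (S^[n] x)) x = rate a x := by
  have R := H.reverse hS hTS
  have h1 : ∀ᵐ x ∂μ, ∀ j : ℕ, upperRate (truncLog j fun n x => a n (S^[n] x)) x =
      upperRate (truncLog j a) x :=
    ae_all_iff.2 fun j => (H.isSuperadditive j).upperRate_reverse j.cast_nonneg hS hTS
  filter_upwards [h1, H.ae_tendsto_rate, R.ae_tendsto_rate, H.ae_rate_nonneg,
    R.ae_rate_nonneg] with x hx h2 h3 h4 h5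
  refine eq_of_max_exp_eq h5 h4 fun j => ?_
  rw [← h2.2 j, ← h3.2 j, hx j]

theorem measurePreserving_restrict {f : Ω → ℝ} (hT : MeasurePreserving T μ μ) (hf : Measurable f)
    (h : ∀ᵐ x ∂μ, f (T x) = f x) :
    MeasurePreserving T (μ.restrict (f ⁻¹' {0})) (μ.restrict (f ⁻¹' {0})) := by
  have h1 := hT.restrict_preimage (hf (measurableSet_singleton 0))
  have h2 : (T ⁻¹' (f ⁻¹' {0}) : Set Ω) =ᵐ[μ] (f ⁻¹' {0} : Set Ω) := by
    filter_upwards [h] with x hx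
    apply propext
    change f (T x) = 0 ↔ f x = 0
    rw [hx]
  rwa [Measure.restrict_congr_set h2] at h1

/-- Slope 1 already detects rate 1, since exp(-U) is the larger of the rate and 1/e. On the
invariant set U = 0 the truncated logarithms have zero mean, so they vanish along almost every
S-orbit, against `hlt`. -/
theorem ae_rate_lt_one [IsFiniteMeasure μ] (H : IsSubmultiplicative μ T a) {S : Ω → Ω}
    (hS : MeasurePreserving S μ μ) (hTS : Function.LeftInverse T S)
    (hlt : ∀ᵐ x ∂μ, ∃ n k, 1 ≤ n ∧ a n (S^[k] x) < 1) : ∀ᵐ x ∂μ, rate a x < 1 := by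
  have HU := H.isSuperadditive 1
  set U := upperRate (truncLog 1 a) with hU
  have hUS : ∀ᵐ x ∂μ, U (S x) = U x := by
    filter_upwards [hS.quasiMeasurePreserving.ae HU.upperRate_comp] with x hx
    rw [hU, ← hx, hTS x]
  have HT' := measurePreserving_restrict H.measurePreserving HU.measurable_upperRate
    HU.upperRate_comp
  have HS' := measurePreserving_restrict hS HU.measurable_upperRate hUS
  have hA : MeasurableSet (U ⁻¹' {0}) := HU.measurable_upperRate (measurableSet_singleton 0)
  have HU' : IsSuperadditive (μ.restrict (U ⁻¹' {0})) T (1 : ℕ) (truncLog 1 a) :=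
    { HU with measurePreserving := HT', add_le := ae_restrict_of_ae HU.add_le }
  have h1 := HU'.ae_eq_zero_of_upperRate (Nat.cast_nonneg 1) (by
    filter_upwards [ae_restrict_mem hA] with x hx using hx)
  have h2 : ∀ᵐ x ∂μ.restrict (U ⁻¹' {0}), False := by
    filter_upwards [IsSuperadditive.ae_orbit HS' h1, ae_restrict_of_ae hlt] with x hx ⟨n, k, hn, hlt⟩
    have h3 := hx k n
    rw [truncLog, neg_eq_zero] at h3
    have hn' : (0 : ℝ) < n := by exact_mod_cast hn
    have h4 : max (a n (S^[k] x)) (Real.exp (-((1 : ℕ) * n))) < 1 := by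
      refine max_lt hlt (Real.exp_lt_one_iff.2 ?_)
      simpa using hn'
    have h5 := Real.log_neg (lt_max_of_lt_right (Real.exp_pos _)) h4
    linarith
  have h3 : ∀ᵐ x ∂μ, U x ≠ 0 := by
    rw [ae_restrict_iff' hA] at h2
    filter_upwards [h2] with x hx h0
    exact hx h0
  filter_upwards [h3, H.ae_tendsto_rate] with x hx h4
  have h5 := h4.2 1
  have h6 : 0 < U x := lt_of_le_of_ne (HU.upperRate_nonneg x) (Ne.symm hx)
  calc rate a x ≤ max (rate a x) (Real.exp (-(1 : ℕ))) := le_max_left _ _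
    _ = Real.exp (-U x) := h5.symm
    _ < 1 := Real.exp_lt_one_iff.2 (by linarith)

end IsSubmultiplicative

/-! ### Measurability of the contraction coefficient -/

theorem secondCountableTopology_mat (D : ℕ) : SecondCountableTopology (Mat D) :=
  inferInstanceAs (SecondCountableTopology (Fin D → Fin D → ℂ))

theorem exists_denseRange_states {D : ℕ} (hD : 1 ≤ D) :
    ∃ u : ℕ → {ρ : Mat D // IsState ρ}, DenseRange u := by
  have := secondCountableTopology_mat D
  have : SecondCountableTopology {ρ : Mat D // IsState ρ} :=
    TopologicalSpace.Subtype.secondCountableTopology _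
  have : Nonempty {ρ : Mat D // IsState ρ} := ⟨⟨_, isState_maxMixed hD⟩⟩
  exact ⟨TopologicalSpace.denseSeq _, TopologicalSpace.denseRange_denseSeq _⟩

theorem cnum_le_iff_denseRange {D : ℕ} (hD : 1 ≤ D) {u : ℕ → {ρ : Mat D // IsState ρ}}
    (hu : DenseRange u) {ψ : SuperOp D} (h : Regular ψ) {y : ℝ} (hy0 : 0 ≤ y) :
    cnum ψ ≤ y ↔ ∀ i j k l,
      (1 - y) / (1 + y) * (pairing (ψ (u j)) (u k) * pairing (ψ (u i)) (u l)) ≤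
          pairing (ψ (u i)) (u k) * pairing (ψ (u j)) (u l) := by
  rw [cnum_le_iff hD h hy0]
  constructor
  · exact fun H i j k l => H _ _ _ _ (u i).2 (u j).2 (u k).2 (u l).2
  · intro H
    have hcl : ∀ X : Mat D, Continuous fun ρ : {ρ : Mat D // IsState ρ} => pairing (ψ ρ) X :=
      fun X => ((continuous_pairing_left X).comp (continuous_superOp ψ)).comp
        continuous_subtype_val
    have hcr : ∀ ρ : Mat D, Continuous fun X : {ρ : Mat D // IsState ρ} => pairing (ψ ρ) X :=
      fun ρ => by
        simp only [pairing_comm (ψ ρ)]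
        exact (continuous_pairing_left (ψ ρ)).comp continuous_subtype_val
    have key : ∀ ρ σ X Y : {ρ : Mat D // IsState ρ},
        (1 - y) / (1 + y) * (pairing (ψ σ) X * pairing (ψ ρ) Y) ≤
          pairing (ψ ρ) X * pairing (ψ σ) Y := by
      intro ρ σ X Y
      refine hu.induction_on (p := fun ρ : {ρ : Mat D // IsState ρ} =>
        (1 - y) / (1 + y) * (pairing (ψ σ) X * pairing (ψ ρ) Y) ≤
          pairing (ψ ρ) X * pairing (ψ σ) Y) ρ
        (isClosed_le (continuous_const.mul (continuous_const.mul (hcl _)))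
          ((hcl _).mul continuous_const)) fun i => ?_
      refine hu.induction_on (p := fun σ : {ρ : Mat D // IsState ρ} =>
        (1 - y) / (1 + y) * (pairing (ψ σ) X * pairing (ψ (u i)) Y) ≤
          pairing (ψ (u i)) X * pairing (ψ σ) Y) σ
        (isClosed_le (continuous_const.mul ((hcl _).mul continuous_const))
          (continuous_const.mul (hcl _))) fun j => ?_
      refine hu.induction_on (p := fun X : {ρ : Mat D // IsState ρ} =>
        (1 - y) / (1 + y) * (pairing (ψ (u j)) X * pairing (ψ (u i)) Y) ≤
          pairing (ψ (u i)) X * pairing (ψ (u j)) Y) X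
        (isClosed_le (continuous_const.mul ((hcr _).mul continuous_const))
          ((hcr _).mul continuous_const)) fun k => ?_
      exact hu.induction_on (p := fun Y : {ρ : Mat D // IsState ρ} =>
        (1 - y) / (1 + y) * (pairing (ψ (u j)) (u k) * pairing (ψ (u i)) Y) ≤
          pairing (ψ (u i)) (u k) * pairing (ψ (u j)) Y) Y
        (isClosed_le (continuous_const.mul (continuous_const.mul (hcr _)))
          (continuous_const.mul (hcr _))) fun l => H i j k l
    exact fun ρ σ X Y hρ hσ hX hY => key ⟨ρ, hρ⟩ ⟨σ, hσ⟩ ⟨X, hX⟩ ⟨Y, hY⟩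

theorem measurable_pairing_map {D : ℕ} {Ω : Type*} [MeasurableSpace Ω] {Φ : Ω → SuperOp D}
    (hΦ : ∀ (X : Mat D) (i j : Fin D), Measurable fun ω => Φ ω X i j) (ρ X : Mat D) :
    Measurable fun ω => pairing (Φ ω ρ) X := by
  simp only [pairing, Matrix.trace, Matrix.diag_apply, Matrix.mul_apply]
  exact Complex.measurable_re.comp (Finset.measurable_sum _ fun i _ =>
    Finset.measurable_sum _ fun j _ => (hΦ ρ i j).mul_const _)

/-- Where regularity holds, sublevel sets at levels in [0, 1) are countable intersections of
cross-ratio conditions; on the null set left over the value 1 is imposed. -/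
theorem exists_measurable_cnum {D : ℕ} (hD : 1 ≤ D) {Ω : Type*} [MeasurableSpace Ω]
    {P : Measure Ω} {Φ : Ω → SuperOp D}
    (hΦ : ∀ (X : Mat D) (i j : Fin D), Measurable fun ω => Φ ω X i j)
    (hreg : ∀ᵐ ω ∂P, Regular (Φ ω)) :
    ∃ g : Ω → ℝ, Measurable g ∧ (∀ ω, 0 ≤ g ω) ∧ (∀ ω, g ω ≤ 1) ∧
      ∀ᵐ ω ∂P, g ω = cnum (Φ ω) := by
  classical
  obtain ⟨G, hG, hGm, hGr⟩ := hreg.exists_measurable_mem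
  obtain ⟨u, hu⟩ := exists_denseRange_states hD
  refine ⟨fun ω => if ω ∈ G then cnum (Φ ω) else 1, ?_, ?_, ?_, ?_⟩
  · refine measurable_of_Iic fun y => ?_
    rcases lt_or_ge y 0 with hy | hy
    · convert MeasurableSet.empty
      rw [Set.eq_empty_iff_forall_notMem]
      intro ω hω
      simp only [Set.mem_preimage, Set.mem_Iic] at hω
      split_ifs at hω with h
      · linarith [cnum_nonneg hD (hGr ω h)]
      · linarith
    rcases le_or_gt 1 y with hy1 | hy1
    · convert MeasurableSet.univ
      rw [Set.eq_univ_iff_forall]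
      intro ω
      simp only [Set.mem_preimage, Set.mem_Iic]
      split_ifs with h
      · exact (cnum_le_one hD (hGr ω h)).trans hy1
      · exact hy1
    have : (fun ω => if ω ∈ G then cnum (Φ ω) else 1) ⁻¹' Set.Iic y = G ∩
        ⋂ i, ⋂ j, ⋂ k, ⋂ l, {ω | (1 - y) / (1 + y) * (pairing (Φ ω (u j)) (u k) *
          pairing (Φ ω (u i)) (u l)) ≤ pairing (Φ ω (u i)) (u k) * pairing (Φ ω (u j)) (u l)} := by
      ext ω
      simp only [Set.mem_preimage, Set.mem_Iic, Set.mem_inter_iff, Set.mem_iInter,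
        Set.mem_ofPred_eq]
      by_cases h : ω ∈ G
      · rw [if_pos h, cnum_le_iff_denseRange hD hu (hGr ω h) hy]
        exact ⟨fun hh => ⟨h, hh⟩, fun hh => hh.2⟩
      · rw [if_neg h]
        exact ⟨fun hh => absurd hh (not_le.2 hy1), fun hh => absurd hh.1 h⟩
    rw [this]
    refine hGm.inter (MeasurableSet.iInter fun i => MeasurableSet.iInter fun j =>
      MeasurableSet.iInter fun k => MeasurableSet.iInter fun l => measurableSet_le ?_ ?_)
    · exact ((measurable_pairing_map hΦ _ _).mul (measurable_pairing_map hΦ _ _)).const_mul _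
    · exact (measurable_pairing_map hΦ _ _).mul (measurable_pairing_map hΦ _ _)
  · intro ω
    dsimp only
    split_ifs with h
    · exact cnum_nonneg hD (hGr ω h)
    · exact zero_le_one
  · intro ω
    dsimp only
    split_ifs with h
    · exact cnum_le_one hD (hGr ω h)
    · exact le_rfl
  · filter_upwards [hG] with ω hω
    exact if_pos hω


/-! ### Propagators with a decay rate -/

theorem eventually_le_pow_of_rate {x : ℕ → ℝ} {κ q : ℝ} (hx : ∀ n, 1 ≤ n → 0 ≤ x n)
    (h : Tendsto (fun n : ℕ => x n ^ (1 / (n : ℝ))) atTop (𝓝 κ)) (hq : κ < q) :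
    ∀ᶠ n in atTop, x n ≤ q ^ n := by
  filter_upwards [h.eventually_lt_const hq, eventually_ge_atTop 1] with n hn hn1
  have hn0 : (n : ℝ) ≠ 0 := by exact_mod_cast (by omega : n ≠ 0)
  have h1 : (x n ^ (1 / (n : ℝ))) ^ n = x n := by
    rw [← Real.rpow_natCast, ← Real.rpow_mul (hx n hn1), one_div_mul_cancel hn0, Real.rpow_one]
  rw [← h1]
  exact pow_le_pow_left₀ (Real.rpow_nonneg (hx n hn1) _) hn.le n

/-- Decay rates along integers determine decay rates along the reals, for antitone functions. -/
theorem tendsto_rpow_of_antitone {c : ℝ → ℝ} {κ : ℝ} (h0 : ∀ t, 0 < t → 0 ≤ c t)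
    (h1 : ∀ s t, 0 < s → s ≤ t → c t ≤ c s)
    (h : Tendsto (fun n : ℕ => c n ^ (1 / (n : ℝ))) atTop (𝓝 κ)) :
    Tendsto (fun t : ℝ => c t ^ (1 / t)) atTop (𝓝 κ) := by
  have hf : Tendsto (fun t : ℝ => (⌊t⌋₊ : ℝ) / t) atTop (𝓝 1) := tendsto_nat_floor_div_atTop
  have hf' : Tendsto (fun t : ℝ => ((⌊t⌋₊ + 1 : ℕ) : ℝ) / t) atTop (𝓝 1) := by
    have := hf.add tendsto_inv_atTop_zero
    rw [add_zero] at this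
    refine this.congr fun t => ?_
    push_cast
    ring
  have hfl : Tendsto (fun t : ℝ => ⌊t⌋₊) atTop atTop := tendsto_nat_floor_atTop
  -- c(m)^{1/t} is (c(m)^{1/m})^{m/t} with m/t → 1; the squeeze then uses m = ⌊t⌋ and ⌊t⌋ + 1.
  have key : ∀ m : ℝ → ℕ, Tendsto m atTop atTop → Tendsto (fun t : ℝ => (m t : ℝ) / t) atTop (𝓝 1) →
      Tendsto (fun t : ℝ => c (m t) ^ (1 / t)) atTop (𝓝 κ) := by
    intro m hm hmt
    have h2 := (h.comp hm).rpow hmt (Or.inr one_pos)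
    rw [Real.rpow_one] at h2
    refine h2.congr' ?_
    filter_upwards [hm.eventually_ge_atTop 1] with t ht
    have hm0 : (0 : ℝ) < m t := by exact_mod_cast ht
    simp only [Function.comp_apply]
    rw [← Real.rpow_mul (h0 _ hm0)]
    congr 1
    field_simp
  refine tendsto_of_tendsto_of_tendsto_of_le_of_le' (key _ ((tendsto_add_atTop_nat 1).comp hfl) hf')
    (key _ hfl hf) ?_ ?_
  · filter_upwards [eventually_gt_atTop 0] with t ht
    refine Real.rpow_le_rpow (h0 _ (by simp only [Function.comp_apply]; positivity)) (h1 _ _ ht ?_)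
      (by positivity)
    simp only [Function.comp_apply]
    push_cast
    exact (Nat.lt_floor_add_one t).le
  · filter_upwards [eventually_ge_atTop 1] with t ht
    have : (0 : ℝ) < ⌊t⌋₊ := by exact_mod_cast Nat.floor_pos.2 ht
    exact Real.rpow_le_rpow (h0 _ (by linarith)) (h1 _ _ this (Nat.floor_le (by linarith)))
      (by positivity)

/-- The contraction coefficients of `F` decay at the exponential rate `κ` along integer times. -/
structure HasRate {D : ℕ} (F : ℝ → ℝ → SuperOp D) (κ : ℝ) : Prop where
  forward : ∀ k : ℤ, Tendsto (fun n : ℕ => cnum (F k (k + n)) ^ (1 / (n : ℝ))) atTop (𝓝 κ)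
  backward : ∀ k : ℤ, Tendsto (fun n : ℕ => cnum (F (k - n) k) ^ (1 / (n : ℝ))) atTop (𝓝 κ)

namespace IsPropagator

variable {D : ℕ} {F : ℝ → ℝ → SuperOp D} {κ : ℝ}

theorem cnum_nonneg (hF : IsPropagator F) (hD : 1 ≤ D) {s t : ℝ} (hst : s < t) :
    0 ≤ cnum (F s t) := QDyn.cnum_nonneg hD (hF.regular s t hst)

theorem eventually_forward (hF : IsPropagator F) (hD : 1 ≤ D) (hκ : HasRate F κ) {q : ℝ}
    (hq : κ < q) (k : ℤ) : ∀ᶠ n : ℕ in atTop, cnum (F k (k + n)) ≤ q ^ n :=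
  eventually_le_pow_of_rate (fun n hn => hF.cnum_nonneg hD
    (lt_add_of_pos_right _ (by exact_mod_cast hn))) (hκ.forward k) hq

theorem eventually_backward (hF : IsPropagator F) (hD : 1 ≤ D) (hκ : HasRate F κ) {q : ℝ}
    (hq : κ < q) (k : ℤ) : ∀ᶠ n : ℕ in atTop, cnum (F (k - n) k) ≤ q ^ n :=
  eventually_le_pow_of_rate (fun n hn => hF.cnum_nonneg hD
    (sub_lt_self _ (by exact_mod_cast hn))) (hκ.backward k) hq

theorem tendsto_cnum_atBot (hF : IsPropagator F) (hD : 1 ≤ D) (hκ : HasRate F κ) (h0 : 0 ≤ κ)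
    (h1 : κ < 1) (t : ℝ) : Tendsto (fun s => cnum (F s t)) atBot (𝓝 0) := by
  obtain ⟨q, hq, hq1⟩ := exists_between h1
  refine tendsto_order.2 ⟨fun x hx => ?_, fun x hx => ?_⟩
  · filter_upwards [eventually_lt_atBot t] with s hs
    exact hx.trans_le (hF.cnum_nonneg hD hs)
  · obtain ⟨n, ⟨hn, hnx⟩, hn1⟩ := (((hF.eventually_backward hD hκ hq ⌊t⌋).and
      ((tendsto_pow_atTop_nhds_zero_of_lt_one (h0.trans hq.le) hq1).eventually_lt_const hx)).and
      (eventually_ge_atTop 1)).exists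
    have hn0 : (0 : ℝ) < n := by exact_mod_cast hn1
    filter_upwards [eventually_le_atBot ((⌊t⌋ : ℝ) - n)] with s hs
    exact ((hF.cnum_anti hD hs (sub_lt_self _ hn0) (Int.floor_le t)).trans hn).trans_lt hnx

theorem tendsto_cnum_atTop (hF : IsPropagator F) (hD : 1 ≤ D) (hκ : HasRate F κ) (h0 : 0 ≤ κ)
    (h1 : κ < 1) (s : ℝ) : Tendsto (fun t => cnum (F s t)) atTop (𝓝 0) := by
  obtain ⟨q, hq, hq1⟩ := exists_between h1
  refine tendsto_order.2 ⟨fun x hx => ?_, fun x hx => ?_⟩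
  · filter_upwards [eventually_gt_atTop s] with t ht
    exact hx.trans_le (hF.cnum_nonneg hD ht)
  · obtain ⟨n, ⟨hn, hnx⟩, hn1⟩ := (((hF.eventually_forward hD hκ hq ⌈s⌉).and
      ((tendsto_pow_atTop_nhds_zero_of_lt_one (h0.trans hq.le) hq1).eventually_lt_const hx)).and
      (eventually_ge_atTop 1)).exists
    have hn0 : (0 : ℝ) < n := by exact_mod_cast hn1
    filter_upwards [eventually_ge_atTop ((⌈s⌉ : ℝ) + n)] with t ht
    exact ((hF.cnum_anti hD (Int.le_ceil s) (lt_add_of_pos_right _ hn0) ht).trans hn).trans_lt hnx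

theorem tendsto_rate_atTop (hF : IsPropagator F) (hD : 1 ≤ D) (hκ : HasRate F κ) :
    Tendsto (fun t : ℝ => cnum (F 0 t) ^ (1 / t)) atTop (𝓝 κ) := by
  refine tendsto_rpow_of_antitone (fun t ht => hF.cnum_nonneg hD ht)
    (fun s t hs hst => hF.cnum_anti hD le_rfl hs hst) ?_
  simpa using hκ.forward 0

theorem tendsto_rate_atBot (hF : IsPropagator F) (hD : 1 ≤ D) (hκ : HasRate F κ) :
    Tendsto (fun s : ℝ => cnum (F s 0) ^ (1 / |s|)) atBot (𝓝 κ) := by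
  have h1 : Tendsto (fun t : ℝ => cnum (F (-t) 0) ^ (1 / t)) atTop (𝓝 κ) := by
    refine tendsto_rpow_of_antitone (c := fun t => cnum (F (-t) 0))
      (fun t ht => hF.cnum_nonneg hD (by linarith))
      (fun s t hs hst => hF.cnum_anti hD (by linarith) (by linarith) le_rfl) ?_
    simpa using hκ.backward 0
  refine (h1.comp tendsto_neg_atBot_atTop).congr' ?_
  filter_upwards [eventually_lt_atBot 0] with s hs
  simp [abs_of_neg hs]

/-- Uniform exponential bounds over integer intervals with an endpoint in a bounded window. -/
theorem exists_window_bound (hF : IsPropagator F) (hD : 1 ≤ D) (hκ : HasRate F κ) {q : ℝ}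
    (hq : κ < q) (N : ℕ) : ∃ K : ℕ, 3 ≤ K ∧ ∀ (a : ℤ) (n : ℕ), 1 ≤ n →
      (|a| ≤ N ∨ |a + n| ≤ N) → K ≤ n + 2 → cnum (F a (a + n)) ≤ q ^ n := by
  have h1 : ∀ᶠ n : ℕ in atTop, ∀ a ∈ Finset.Icc (-(N : ℤ)) N, cnum (F a (a + n)) ≤ q ^ n :=
    (Finset.eventually_all _).2 fun a _ => hF.eventually_forward hD hκ hq a
  have h2 : ∀ᶠ n : ℕ in atTop, ∀ a ∈ Finset.Icc (-(N : ℤ)) N, cnum (F (a - n) a) ≤ q ^ n :=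
    (Finset.eventually_all _).2 fun a _ => hF.eventually_backward hD hκ hq a
  obtain ⟨n₀, hn₀⟩ := eventually_atTop.1 (h1.and h2)
  -- The integer interval inside [s,t] may be shorter by nearly 2, hence K ≤ n + 2; K ≥ 3 will
  -- guarantee that it is nondegenerate.
  refine ⟨n₀ + 3, by omega, fun a n _ hw hK => ?_⟩
  obtain ⟨e1, e2⟩ := hn₀ n (by omega)
  rcases hw with hw | hw
  · exact e1 a (Finset.mem_Icc.2 (abs_le.1 hw))
  · have := e2 (a + n) (Finset.mem_Icc.2 (abs_le.1 hw))
    push_cast at this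
    rwa [add_sub_cancel_right] at this

/-- Shrink [s,t] to [⌈s⌉,⌊t⌋], which can only increase c and has length at least t - s - 2. Rounding
keeps an endpoint in the window because N is an integer. -/
theorem cnum_le_rpow (hF : IsPropagator F) (hD : 1 ≤ D) {q : ℝ} (hq0 : 0 < q) (hq1 : q ≤ 1)
    {N K : ℕ} (hK3 : 3 ≤ K) (hK : ∀ (a : ℤ) (n : ℕ), 1 ≤ n →
      (|a| ≤ N ∨ |a + n| ≤ N) → K ≤ n + 2 → cnum (F a (a + n)) ≤ q ^ n)
    {s t : ℝ} (hw : |s| ≤ N ∨ |t| ≤ N) (hst : K ≤ t - s) :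
    cnum (F s t) ≤ q ^ (t - s - 2) := by
  have hK3' : (3 : ℝ) ≤ K := by exact_mod_cast hK3
  have hs1 := Int.le_ceil s
  have hs2 := Int.ceil_lt_add_one s
  have ht1 := Int.floor_le t
  have ht2 := Int.lt_floor_add_one t
  have hlt : (⌈s⌉ : ℝ) < ⌊t⌋ := by linarith
  have hlt' : ⌈s⌉ < ⌊t⌋ := by exact_mod_cast hlt
  obtain ⟨n, hn⟩ := Int.eq_ofNat_of_zero_le (sub_nonneg.2 hlt'.le)
  have hnt : ⌊t⌋ = ⌈s⌉ + n := by omega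
  have hnr : (⌊t⌋ : ℝ) = ⌈s⌉ + n := by exact_mod_cast hnt
  have hKn : K ≤ n + 2 := by
    have : (K : ℝ) < ((n + 2 : ℕ) : ℝ) + 1 := by push_cast; linarith
    have : K < n + 2 + 1 := by exact_mod_cast this
    omega
  have hwin : |⌈s⌉| ≤ (N : ℤ) ∨ |⌈s⌉ + (n : ℤ)| ≤ (N : ℤ) := by
    rcases hw with hw | hw
    · left
      rw [abs_le] at hw ⊢
      constructor
      · have : ((-(N : ℤ) : ℤ) : ℝ) ≤ ⌈s⌉ := by push_cast; linarith
        exact_mod_cast this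
      · exact Int.ceil_le.2 (by exact_mod_cast hw.2)
    · right
      rw [← hnt]
      rw [abs_le] at hw ⊢
      constructor
      · exact Int.le_floor.2 (by push_cast; linarith)
      · have : (⌊t⌋ : ℝ) ≤ (N : ℤ) := by push_cast; linarith
        exact_mod_cast this
  have h1 := hK ⌈s⌉ n (by omega) hwin hKn
  rw [← hnr] at h1
  refine (hF.cnum_anti hD hs1 hlt ht1).trans (h1.trans ?_)
  rw [← Real.rpow_natCast]
  exact Real.rpow_le_rpow_of_exponent_ge hq0 hq1 (by linarith)

end IsPropagator

/-! ### Measurable limits -/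

/-- The entrywise limit of a sequence of matrices. -/
noncomputable def seqLimit {D : ℕ} (u : ℕ → Mat D) : Mat D :=
  Matrix.of fun i j => ((limsup (fun n => (u n i j).re) atTop : ℝ) : ℂ) +
    ((limsup (fun n => (u n i j).im) atTop : ℝ) : ℂ) * Complex.I

theorem seqLimit_eq {D : ℕ} {u : ℕ → Mat D} {L : Mat D} (h : Tendsto u atTop (𝓝 L)) :
    seqLimit u = L := by
  ext i j
  have h1 : Tendsto (fun n => u n i j) atTop (𝓝 (L i j)) :=
    tendsto_pi_nhds.1 (tendsto_pi_nhds.1 h i) j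
  have h2 := ((Complex.continuous_re.tendsto _).comp h1).limsup_eq
  have h3 := ((Complex.continuous_im.tendsto _).comp h1).limsup_eq
  simp only [Function.comp_def] at h2 h3
  rw [seqLimit, Matrix.of_apply, h2, h3, Complex.re_add_im]

/-- The limsup formula is measurable without any convergence, so limits existing only almost surely
need no modification on a null set. -/
theorem measurable_seqLimit {D : ℕ} {Ω : Type*} [MeasurableSpace Ω] {u : ℕ → Ω → Mat D}
    (h : ∀ n i j, Measurable fun ω => u n ω i j) (i j : Fin D) :
    Measurable fun ω => seqLimit (fun n => u n ω) i j := by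
  simp only [seqLimit, Matrix.of_apply]
  exact (Complex.measurable_ofReal.comp (Measurable.limsup fun n =>
    Complex.measurable_re.comp (h n i j))).add ((Complex.measurable_ofReal.comp
      (Measurable.limsup fun n => Complex.measurable_im.comp (h n i j))).mul_const _)

theorem measurable_proj {D : ℕ} {Ω : Type*} [MeasurableSpace Ω] {Φ : Ω → SuperOp D}
    (hΦ : ∀ (X : Mat D) (i j : Fin D), Measurable fun ω => Φ ω X i j) (ρ : Mat D)
    (i j : Fin D) : Measurable fun ω => proj (Φ ω) ρ i j := by
  simp only [proj, Matrix.smul_apply, smul_eq_mul, Matrix.trace, Matrix.diag_apply]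
  exact (Finset.measurable_sum _ fun k _ => hΦ ρ k k).inv.mul (hΦ ρ i j)

theorem measurable_adj {D : ℕ} {Ω : Type*} [MeasurableSpace Ω] {Φ : Ω → SuperOp D}
    (hΦ : ∀ (X : Mat D) (i j : Fin D), Measurable fun ω => Φ ω X i j) (X : Mat D)
    (i j : Fin D) : Measurable fun ω => adj (Φ ω) X i j := by
  change Measurable fun ω => ((Φ ω (Matrix.single i j 1))ᴴ * X).trace
  simp only [Matrix.trace, Matrix.diag_apply, Matrix.mul_apply, Matrix.conjTranspose_apply]
  exact Finset.measurable_sum _ fun k _ => Finset.measurable_sum _ fun l _ =>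
    (continuous_star.measurable.comp (hΦ _ l k)).mul_const _

/-! ### Stationary propagators -/

theorem IsFlow.iterate {Ω : Type*} [MeasurableSpace Ω] {P : Measure Ω} {θ : ℝ → Ω → Ω}
    (hθ : IsFlow P θ) (h : ℝ) (n : ℕ) : (θ h)^[n] = θ (n * h) := by
  induction n with
  | zero => simp [hθ.zero]
  | succ n ih =>
    rw [Function.iterate_succ', ih, ← hθ.add]
    congr 1
    push_cast
    ring

theorem IsFlow.apply_apply {Ω : Type*} [MeasurableSpace Ω] {P : Measure Ω} {θ : ℝ → Ω → Ω}
    (hθ : IsFlow P θ) (h k : ℝ) (ω : Ω) : θ h (θ k ω) = θ (h + k) ω := by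
  rw [hθ.add]; rfl

theorem IsFlow.ae_int {Ω : Type*} [MeasurableSpace Ω] {P : Measure Ω} {θ : ℝ → Ω → Ω}
    (hθ : IsFlow P θ) {p : Ω → Prop} (hp : ∀ᵐ ω ∂P, p ω) : ∀ᵐ ω ∂P, ∀ k : ℤ, p (θ k ω) :=
  ae_all_iff.2 fun k => (hθ.measurePreserving k).quasiMeasurePreserving.ae hp

theorem ae_isPropagator {D : ℕ} {Ω : Type*} [MeasurableSpace Ω] {P : Measure Ω} {θ : ℝ → Ω → Ω}
    {φ : ℝ → ℝ → Ω → SuperOp D} (hφ : IsStationaryPropagator P θ φ) (hnd : Nondegenerate P φ) :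
    ∀ᵐ ω ∂P, IsPropagator fun s t => φ s t ω := by
  filter_upwards [hφ.positive, hφ.comp, hnd] with ω h1 h2 h3
  exact ⟨fun s t hst => ⟨h1 s t hst, fun ρ hρ => (h3 s t hst ρ hρ).1,
    fun ρ hρ => (h3 s t hst ρ hρ).2⟩, h2⟩

/-- The contraction coefficients of a stationary propagator over integer times have measurable
versions generated by the flow. -/
theorem exists_cnum_process {D : ℕ} (hD : 1 ≤ D) {Ω : Type*} [MeasurableSpace Ω] {P : Measure Ω}
    {θ : ℝ → Ω → Ω} (hθ : IsFlow P θ) {φ : ℝ → ℝ → Ω → SuperOp D}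
    (hφ : IsStationaryPropagator P θ φ) (hnd : Nondegenerate P φ) :
    ∃ a : ℕ → Ω → ℝ, IsSubmultiplicative P (θ 1) a ∧
      ∀ᵐ ω ∂P, ∀ (k : ℤ) (n : ℕ), 1 ≤ n → a n (θ k ω) = cnum (φ k (k + n) ω) := by
  have hF := ae_isPropagator hφ hnd
  have hex : ∀ n : ℕ, ∃ g : Ω → ℝ, Measurable g ∧ (∀ ω, 0 ≤ g ω) ∧ (∀ ω, g ω ≤ 1) ∧
      (1 ≤ n → ∀ᵐ ω ∂P, g ω = cnum (φ 0 n ω)) ∧ (n = 0 → ∀ ω, g ω = 1) := by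
    intro n
    rcases Nat.eq_zero_or_pos n with rfl | hn
    -- φ carries no information at equal times; the value 1 keeps submultiplicativity true when m or
    -- n is 0.
    · exact ⟨fun _ => 1, measurable_const, fun _ => zero_le_one, fun _ => le_rfl,
        fun h => absurd h (by norm_num), fun _ _ => rfl⟩
    · have hn0 : (0 : ℝ) < n := by exact_mod_cast hn
      obtain ⟨g, h1, h2, h3, h4⟩ := exists_measurable_cnum hD (hφ.measurable 0 n hn0) (by
        filter_upwards [hF] with ω h using h.regular 0 n hn0)
      exact ⟨g, h1, h2, h3, fun _ => h4, fun h => absurd h (by omega)⟩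
  choose a hm h0 h1 hae hz using hex
  have key : ∀ᵐ ω ∂P, ∀ (k : ℤ) (n : ℕ), 1 ≤ n → a n (θ k ω) = cnum (φ k (k + n) ω) := by
    refine ae_all_iff.2 fun k => ae_all_iff.2 fun n => ?_
    by_cases hn : 1 ≤ n
    · have hn0 : (0 : ℝ) < n := by exact_mod_cast hn
      filter_upwards [(hθ.measurePreserving k).quasiMeasurePreserving.ae (hae n hn),
        hφ.stationary k] with ω h2 h3 _
      rw [h2, h3 0 n hn0, zero_add, add_comm (n : ℝ)]
    · exact Eventually.of_forall fun ω h => absurd h hn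
  refine ⟨a, ⟨hθ.measurePreserving 1, hm, h0, h1, ?_⟩, key⟩
  filter_upwards [key, hF] with ω hω hFω m n
  rw [hθ.iterate, mul_one]
  rcases Nat.eq_zero_or_pos m with rfl | hm
  · have : θ ((0 : ℕ) : ℝ) ω = ω := by simp [hθ.zero]
    rw [this, hz 0 rfl, zero_add, one_mul]
  rcases Nat.eq_zero_or_pos n with rfl | hn
  · rw [hz 0 rfl, mul_one, add_zero]
  have hm0 : (0 : ℝ) < m := by exact_mod_cast hm
  have hn0 : (0 : ℝ) < n := by exact_mod_cast hn
  have e1 := hω 0 (m + n) (by omega)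
  have e2 := hω 0 m hm
  have e3 := hω m n hn
  simp only [Int.cast_zero, hθ.zero, id_eq, zero_add, Nat.cast_add, Int.cast_natCast] at e1 e2 e3
  rw [e1, e2, e3, mul_comm]
  exact hFω.cnum_le_mul hD hm0 (lt_add_of_pos_right _ hn0)

/-- The decay rate of a stationary propagator, with measurable versions of the contraction
coefficients over integer times. -/
theorem exists_rate {D : ℕ} (hD : 1 ≤ D) {Ω : Type*} [MeasurableSpace Ω] {P : Measure Ω}
    [IsProbabilityMeasure P] {θ : ℝ → Ω → Ω} (hθ : IsFlow P θ) {φ : ℝ → ℝ → Ω → SuperOp D}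
    (hφ : IsStationaryPropagator P θ φ) (hnd : Nondegenerate P φ)
    (hsp : EventuallyStrictlyPositive P φ) :
    ∃ (κ : Ω → ℝ) (c : ℤ → ℕ → Ω → ℝ), Measurable κ ∧ (∀ k n, Measurable (c k n)) ∧
      ∀ᵐ ω ∂P, κ ω ∈ Set.Ico (0 : ℝ) 1 ∧ HasRate (fun s t => φ s t ω) (κ ω) ∧
        ∀ (k : ℤ) (n : ℕ), 1 ≤ n → c k n ω = cnum (φ k (k + n) ω) := by
  obtain ⟨a, ha, hac⟩ := exists_cnum_process hD hθ hφ hnd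
  have hS := hθ.measurePreserving (-1)
  have hTS : Function.LeftInverse (θ 1) (θ (-1)) := fun ω => by
    rw [hθ.apply_apply]; simp [hθ.zero]
  have R := ha.reverse hS hTS
  -- The strictly positive φ s t is enclosed in the integer interval from -k to n - k, whose
  -- coefficient is no larger.
  have hlt : ∀ᵐ ω ∂P, ∃ n k, 1 ≤ n ∧ a n ((θ (-1))^[k] ω) < 1 := by
    filter_upwards [hac, ae_isPropagator hφ hnd, hsp] with ω h1 h2 ⟨s, t, hst, h3⟩
    obtain ⟨k, hk⟩ := exists_nat_ge (-s)
    obtain ⟨n, hn⟩ := exists_nat_ge (t + k)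
    have hn1 : 1 ≤ n := by
      have : (0 : ℝ) < n := by linarith
      exact_mod_cast this
    refine ⟨n, k, hn1, ?_⟩
    have h4 := h1 (-k) n hn1
    push_cast at h4
    rw [hθ.iterate, mul_neg_one, h4]
    exact (h2.cnum_anti hD (by linarith) hst (by linarith)).trans_lt
      (cnum_lt_one hD (h2.regular s t hst) h3)
  have hinv : ∀ᵐ ω ∂P, ∀ k : ℤ,
      IsSubmultiplicative.rate a (θ k ω) = IsSubmultiplicative.rate a ω := by
    have h1 := IsSuperadditive.ae_orbit ha.measurePreserving ha.ae_rate_comp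
    have h2 : ∀ᵐ ω ∂P, ∀ n : ℕ,
        IsSubmultiplicative.rate a (θ n ω) = IsSubmultiplicative.rate a ω := by
      filter_upwards [h1] with ω hω n
      induction n with
      | zero => simp [hθ.zero]
      | succ n ih =>
        have h3 := hω n
        rw [hθ.iterate, mul_one, hθ.apply_apply, add_comm] at h3
        rw [Nat.cast_succ, h3, ih]
    filter_upwards [h2, hθ.ae_int h2] with ω h3 h4 k
    -- For negative times, apply forward invariance at the shifted point θ(-n) ω.
    obtain ⟨n, rfl | rfl⟩ := k.eq_nat_or_neg
    · exact_mod_cast h3 n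
    · have h5 := h4 (-n) n
      rw [hθ.apply_apply] at h5
      rw [← h5]
      simp [hθ.zero]
  refine ⟨IsSubmultiplicative.rate a, fun k n ω => a n (θ k ω), ha.measurable_rate,
    fun k n => (ha.measurable n).comp (hθ.measurePreserving k).measurable, ?_⟩
  filter_upwards [ha.ae_rate_nonneg, ha.ae_rate_lt_one hS hTS hlt, hac, hinv,
    hθ.ae_int ha.ae_tendsto_rate, hθ.ae_int R.ae_tendsto_rate,
    hθ.ae_int (ha.ae_rate_reverse hS hTS)] with ω h0 h1 h2 h3 h4 h5 h6
  refine ⟨⟨h0, h1⟩, ⟨fun k => ?_, fun k => ?_⟩, h2⟩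
  · have := (h4 k).1
    rw [h3 k] at this
    refine this.congr' ?_
    filter_upwards [eventually_ge_atTop 1] with n hn
    rw [h2 k n hn]
  · have := (h5 k).1
    rw [h6 k, h3 k] at this
    refine this.congr' ?_
    filter_upwards [eventually_ge_atTop 1] with n hn
    have h7 := h2 (k - n) n hn
    push_cast at h7
    rw [sub_add_cancel] at h7
    rw [← h7, hθ.iterate, hθ.apply_apply]
    congr 3
    ring



/-! ### Measurable thresholds and limit states -/

open Classical in
/-- A random threshold: given measurable sets of pairs `(ω, K)`, a measurable choice of `K`
realizing the condition wherever this is possible. -/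
theorem exists_measurable_threshold {Ω : Type*} [MeasurableSpace Ω] {p : Ω → ℕ → Prop}
    (hp : ∀ K, MeasurableSet {ω | p ω K}) :
    ∃ T : Ω → ℕ, Measurable T ∧ ∀ ω, (∃ K, p ω K) → p ω (T ω) := by
  -- The second alternative makes the least-index search total, with value 0 where no K works.
  have hex : ∀ ω, ∃ K, p ω K ∨ ∀ K', ¬ p ω K' := fun ω => by
    by_cases h : ∃ K, p ω K
    · exact h.imp fun _ => Or.inl
    · exact ⟨0, Or.inr (not_exists.1 h)⟩
  refine ⟨fun ω => Nat.find (hex ω), measurable_find hex fun K => ?_, fun ω ⟨K, hK⟩ => ?_⟩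
  · have h : MeasurableSet {ω | ∀ K', ¬ p ω K'} := by
      simp only [Set.ofPred_forall]
      exact MeasurableSet.iInter fun K' => (hp K').compl
    exact (hp K).union h
  · exact (Nat.find_spec (hex ω)).resolve_right fun h => h K hK

/-- The decay of the contraction coefficients over a bounded window of integer times, beyond a
measurable threshold. -/
theorem exists_measurable_window_threshold {Ω : Type*} [MeasurableSpace Ω] {μ : Ω → ℝ}
    (hμ : Measurable μ) {c : ℤ → ℕ → Ω → ℝ} (hc : ∀ k n, Measurable (c k n)) (N : ℕ) :
    ∃ T : Ω → ℕ, Measurable T ∧ ∀ ω, (∃ K : ℕ, 3 ≤ K ∧ ∀ (a : ℤ) (n : ℕ), 1 ≤ n →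
      (|a| ≤ N ∨ |a + n| ≤ N) → K ≤ n + 2 → c a n ω ≤ μ ω ^ n) →
      3 ≤ T ω ∧ ∀ (a : ℤ) (n : ℕ), 1 ≤ n →
        (|a| ≤ N ∨ |a + n| ≤ N) → T ω ≤ n + 2 → c a n ω ≤ μ ω ^ n := by
  refine exists_measurable_threshold fun K => ?_
  have h : MeasurableSet {ω | ∀ (a : ℤ) (n : ℕ), 1 ≤ n →
      (|a| ≤ N ∨ |a + n| ≤ N) → K ≤ n + 2 → c a n ω ≤ μ ω ^ n} := by
    simp only [Set.ofPred_forall]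
    exact MeasurableSet.iInter fun a => MeasurableSet.iInter fun n => MeasurableSet.iInter fun _ =>
      MeasurableSet.iInter fun _ => MeasurableSet.iInter fun _ =>
        measurableSet_le (hc a n) (hμ.pow_const n)
  exact (MeasurableSet.const _).inter h

/-- The past limit at time `t`, as a limit along the integers of the images of the maximally mixed
state. -/
noncomputable def pastState {D : ℕ} (F : ℝ → ℝ → SuperOp D) (t : ℝ) : Mat D :=
  -- The shift by 1 keeps the times strictly ordered at n = 0, as measurability requires.
  seqLimit fun n => proj (F (t - (n + 1)) t) ((D : ℂ)⁻¹ • 1)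

/-- The future limit at time `s`, as a limit along the integers of the images of the maximally
mixed state. -/
noncomputable def futureState {D : ℕ} (F : ℝ → ℝ → SuperOp D) (s : ℝ) : Mat D :=
  seqLimit fun n => proj (adj (F s (s + (n + 1)))) ((D : ℂ)⁻¹ • 1)

theorem IsPropagator.pastState_spec {D : ℕ} (hD : 1 ≤ D) {F : ℝ → ℝ → SuperOp D}
    (h : IsPropagator F) (hc : ∀ t, Tendsto (fun s => cnum (F s t)) atBot (𝓝 0)) :
    (∀ t, IsInteriorState (pastState F t)) ∧
      (∀ s t, s < t → proj (F s t) (pastState F s) = pastState F t) ∧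
      (∀ t ρ, IsState ρ → Tendsto (fun s => proj (F s t) ρ) atBot (𝓝 (pastState F t))) ∧
      ∀ t, Tendsto (fun s => rightPF (F s t)) atBot (𝓝 (pastState F t)) := by
  obtain ⟨Z, hZ⟩ := h.exists_pastLimit hD hc
  have : pastState F = Z := by
    funext t
    have h1 : Tendsto (fun n : ℕ => t - ((n : ℝ) + 1)) atTop atBot := by
      simp only [sub_eq_add_neg]
      exact tendsto_atBot_add_const_left _ _ (tendsto_neg_atTop_atBot.comp
        (tendsto_atTop_add_const_right _ _ tendsto_natCast_atTop_atTop))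
    exact seqLimit_eq ((hZ.2.2.1 t _ (isState_maxMixed hD)).comp h1)
  rwa [this]

theorem IsPropagator.futureState_spec {D : ℕ} (hD : 1 ≤ D) {F : ℝ → ℝ → SuperOp D}
    (h : IsPropagator F) (hc : ∀ s, Tendsto (fun t => cnum (F s t)) atTop (𝓝 0)) :
    (∀ s, IsInteriorState (futureState F s)) ∧
      (∀ s t, s < t → proj (adj (F s t)) (futureState F t) = futureState F s) ∧
      (∀ s ρ, IsState ρ →
        Tendsto (fun t => proj (adj (F s t)) ρ) atTop (𝓝 (futureState F s))) ∧
      ∀ s, Tendsto (fun t => leftPF (F s t)) atTop (𝓝 (futureState F s)) := by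
  obtain ⟨Z, hZ⟩ := h.exists_futureLimit hD hc
  have : futureState F = Z := by
    funext s
    have h1 : Tendsto (fun n : ℕ => s + ((n : ℝ) + 1)) atTop atTop :=
      tendsto_atTop_add_const_left _ _
        (tendsto_atTop_add_const_right _ _ tendsto_natCast_atTop_atTop)
    exact seqLimit_eq ((hZ.2.2.1 s _ (isState_maxMixed hD)).comp h1)
  rwa [this]

/-! ### From thresholds to constants -/

section Exponential

variable {D : ℕ} {F : ℝ → ℝ → SuperOp D} {q : ℝ} {E : ℝ → ℝ → ℝ}

/-- An exponential bound beyond a threshold gives one for all times, with a constant. -/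
theorem exists_const_of_threshold (hq0 : 0 < q) (hq1 : q ≤ 1) {K : ℝ} {p : ℝ → ℝ → Prop}
    (h8 : ∀ s t, s < t → E s t ≤ 8)
    (h : ∀ s t, s < t → p s t → K ≤ t - s → E s t ≤ 8 * q ^ (t - s - 2)) (hK : 0 ≤ K) :
    ∃ C : ℝ, ∀ s t, s < t → p s t → E s t ≤ C * q ^ (t - s) := by
  -- For t - s < K the right side is at least 8; for t - s ≥ K use -(K + 2) ≤ -2.
  refine ⟨8 * q ^ (-(K + 2)), fun s t hst hp => ?_⟩
  rw [mul_assoc, ← Real.rpow_add hq0]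
  rcases le_or_gt K (t - s) with h1 | h1
  · refine (h s t hst hp h1).trans ?_
    gcongr ?_ * ?_
    exact Real.rpow_le_rpow_of_exponent_ge hq0 hq1 (by linarith)
  · have := Real.one_le_rpow_of_pos_of_le_one_of_nonpos hq0 hq1
      (show -(K + 2) + (t - s) ≤ 0 by linarith)
    linarith [h8 s t hst]

end Exponential

end QDyn

/-! ### Main theorem -/

theorem theorem3 {D : ℕ} (hD : 1 ≤ D) {Ω : Type*} [MeasurableSpace Ω]
    (P : Measure Ω) [IsProbabilityMeasure P] (θ : ℝ → Ω → Ω) (hθ : QDyn.IsFlow P θ)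
    (φ : ℝ → ℝ → Ω → QDyn.SuperOp D) (hφ : QDyn.IsStationaryPropagator P θ φ)
    (hnd : QDyn.Nondegenerate P φ) (hsp : QDyn.EventuallyStrictlyPositive P φ) :
    ∃ (κ : Ω → ℝ) (Z Z' : ℝ → Ω → QDyn.Mat D),
      QDyn.IsDecayRate P φ κ ∧ QDyn.IsPastLimit P φ Z ∧ QDyn.IsFutureLimit P φ Z' ∧
      -- the bound by the contraction coefficient, for all times at once
      (∀ᵐ ω ∂P, ∀ s t : ℝ, s < t →
        QDyn.rankOneError (φ s t ω) (Z' s ω) (Z t ω) ≤ 8 * QDyn.cnum (φ s t ω)) ∧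
      -- the exponential bound beyond a random threshold, uniformly in bounded time windows
      (∀ l : ℝ, 0 < l → l < 1 → ∃ T : ℕ → Ω → ℕ, (∀ n, Measurable (T n)) ∧
        ∀ᵐ ω ∂P, ∀ r : ℝ, 0 ≤ r → ∀ s t : ℝ, s < t → (|s| ≤ r ∨ |t| ≤ r) →
          (T ⌈r⌉₊ ω : ℝ) ≤ t - s →
          QDyn.rankOneError (φ s t ω) (Z' s ω) (Z t ω) ≤ 8 * QDyn.cnum (φ s t ω) ∧
          8 * QDyn.cnum (φ s t ω) ≤ 8 * (l * κ ω + (1 - l)) ^ (t - s - 2)) ∧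
      -- exponential convergence to zero, uniformly in bounded time windows
      (∀ l : ℝ, 0 < l → l < 1 → ∀ᵐ ω ∂P, 0 < l * κ ω + (1 - l) ∧ l * κ ω + (1 - l) < 1 ∧
        ∀ r : ℝ, 0 ≤ r → ∃ C : ℝ, ∀ s t : ℝ, s < t → (|s| ≤ r ∨ |t| ≤ r) →
          QDyn.rankOneError (φ s t ω) (Z' s ω) (Z t ω) ≤
            C * (l * κ ω + (1 - l)) ^ (t - s)) ∧
      (∀ᵐ ω ∂P,
        (∀ t : ℝ, Tendsto (fun s => QDyn.rankOneError (φ s t ω) (Z' s ω) (Z t ω))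
          atBot (𝓝 0)) ∧
        (∀ s : ℝ, Tendsto (fun t => QDyn.rankOneError (φ s t ω) (Z' s ω) (Z t ω))
          atTop (𝓝 0))) := by
  open QDyn in
  obtain ⟨κ, c, hκm, hcm, hae⟩ := exists_rate hD hθ hφ hnd hsp
  have hprop := ae_isPropagator hφ hnd
  have hpast : ∀ᵐ ω ∂P, _ := (hprop.and hae).mono fun ω h =>
    h.1.pastState_spec hD (h.1.tendsto_cnum_atBot hD h.2.2.1 h.2.1.1 h.2.1.2)
  have hfut : ∀ᵐ ω ∂P, _ := (hprop.and hae).mono fun ω h =>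
    h.1.futureState_spec hD (h.1.tendsto_cnum_atTop hD h.2.2.1 h.2.1.1 h.2.1.2)
  have hbound : ∀ᵐ ω ∂P, ∀ s t : ℝ, s < t →
      rankOneError (φ s t ω) (futureState (fun s t => φ s t ω) s)
        (pastState (fun s t => φ s t ω) t) ≤ 8 * cnum (φ s t ω) := by
    filter_upwards [hprop, hpast, hfut] with ω h1 h2 h3 s t hst
    -- Covariance writes Z_t and Z'_s as images under φ_{s,t}· and φ*_{s,t}·, the form the rank-one
    -- estimate needs.
    rw [← h2.2.1 s t hst, ← h3.2.1 s t hst]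
    exact rankOneError_le hD (h1.regular s t hst) (h2.1 s).isState (h3.1 t).isState
  -- Mixing κ with 1 leaves strict room above κ for the root asymptotics, and makes the base
  -- positive even when κ = 0.
  have hrange : ∀ l : ℝ, 0 < l → l < 1 → ∀ ω, κ ω ∈ Set.Ico (0 : ℝ) 1 →
      0 < l * κ ω + (1 - l) ∧ l * κ ω + (1 - l) < 1 ∧ κ ω < l * κ ω + (1 - l) :=
    fun l h0 h1 ω hκ => ⟨by nlinarith [hκ.1], by nlinarith [hκ.2], by nlinarith [hκ.2]⟩
  have hthr : ∀ l : ℝ, 0 < l → l < 1 → ∃ T : ℕ → Ω → ℕ, (∀ n, Measurable (T n)) ∧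
      ∀ᵐ ω ∂P, ∀ r : ℝ, 0 ≤ r → ∀ s t : ℝ, s < t → (|s| ≤ r ∨ |t| ≤ r) →
        (T ⌈r⌉₊ ω : ℝ) ≤ t - s →
        cnum (φ s t ω) ≤ (l * κ ω + (1 - l)) ^ (t - s - 2) := by
    intro l h0 h1
    choose T hTm hT using fun N : ℕ => exists_measurable_window_threshold
      ((hκm.const_mul l).add_const (1 - l)) hcm N
    refine ⟨T, hTm, ?_⟩
    filter_upwards [hprop, hae] with ω h2 h3 r hr s t hst hw hTt
    obtain ⟨hq0, hq1, hκq⟩ := hrange l h0 h1 ω h3.1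
    -- This K only shows that a threshold exists; the measurable `T` then satisfies the same
    -- integer-time condition.
    obtain ⟨K, hK3, hK⟩ := h2.exists_window_bound hD h3.2.1 hκq ⌈r⌉₊
    obtain ⟨hT3, hTb⟩ := hT ⌈r⌉₊ ω ⟨K, hK3, fun a n hn hw hKn => by
      rw [h3.2.2 a n hn]; exact hK a n hn hw hKn⟩
    refine h2.cnum_le_rpow hD hq0 hq1.le hT3 (fun a n hn hw hKn => ?_)
      (hw.imp (fun h => h.trans (Nat.le_ceil r)) fun h => h.trans (Nat.le_ceil r)) hTt
    rw [← h3.2.2 a n hn]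
    exact hTb a n hn hw hKn
  refine ⟨κ, fun t ω => pastState (fun s t => φ s t ω) t,
    fun s ω => futureState (fun s t => φ s t ω) s,
    ⟨hκm, hae.mono fun ω h => h.1, ?_, ?_⟩,
    ⟨fun t => ?_, hpast.mono fun ω h => h.1, hpast.mono fun ω h => h.2.2.2,
      hpast.mono fun ω h => h.2.2.1⟩,
    ⟨fun s => ?_, hfut.mono fun ω h => h.1, hfut.mono fun ω h => h.2.2.2,
      hfut.mono fun ω h => h.2.2.1⟩, hbound, fun l h0 h1 => ?_, fun l h0 h1 => ?_, ?_⟩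
  · exact (hprop.and hae).mono fun ω h => h.1.tendsto_rate_atTop hD h.2.2.1
  · exact (hprop.and hae).mono fun ω h => h.1.tendsto_rate_atBot hD h.2.2.1
  · exact measurable_seqLimit fun n =>
      measurable_proj (hφ.measurable _ _ (sub_lt_self t n.cast_add_one_pos)) _
  · exact measurable_seqLimit fun n => measurable_proj (measurable_adj
      (hφ.measurable _ _ (lt_add_of_pos_right s n.cast_add_one_pos))) _
  · obtain ⟨T, hTm, hT⟩ := hthr l h0 h1
    refine ⟨T, hTm, ?_⟩
    filter_upwards [hT, hbound] with ω h2 h3 r hr s t hst hw hTt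
    exact ⟨h3 s t hst, by linarith [h2 r hr s t hst hw hTt]⟩
  · obtain ⟨T, -, hT⟩ := hthr l h0 h1
    filter_upwards [hT, hbound, hprop, hae] with ω h2 h3 h4 h5
    obtain ⟨hq0, hq1, -⟩ := hrange l h0 h1 ω h5.1
    refine ⟨hq0, hq1, fun r hr => exists_const_of_threshold hq0 hq1.le
      (p := fun s t => |s| ≤ r ∨ |t| ≤ r) (fun s t hst => ?_) (fun s t hst hw hTt => ?_)
      (Nat.cast_nonneg (T ⌈r⌉₊ ω))⟩
    · linarith [h3 s t hst, cnum_le_one hD (h4.regular s t hst)]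
    · linarith [h3 s t hst, h2 r hr s t hst hw hTt]
  · filter_upwards [hbound, hprop, hae] with ω h2 h3 h4
    have hzero {l : Filter ℝ} {f : ℝ → ℝ} (h : Tendsto f l (𝓝 0)) :
        Tendsto (fun x => 8 * f x) l (𝓝 0) := by
      simpa using h.const_mul 8
    refine ⟨fun t => ?_, fun s => ?_⟩
    · refine tendsto_of_tendsto_of_tendsto_of_le_of_le' tendsto_const_nhds
        (hzero (h3.tendsto_cnum_atBot hD h4.2.1 h4.1.1 h4.1.2 t))
        (.of_forall fun s => opNorm_nonneg _) ?_
      filter_upwards [eventually_lt_atBot t] with s hs using h2 s t hs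
    · refine tendsto_of_tendsto_of_tendsto_of_le_of_le' tendsto_const_nhds
        (hzero (h3.tendsto_cnum_atTop hD h4.2.1 h4.1.1 h4.1.2 s))
        (.of_forall fun t => opNorm_nonneg _) ?_
      filter_upwards [eventually_gt_atTop s] with t ht using h2 s t ht
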